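/- Manifolds are smooth, Hausdorff, finite-dimensional and without boundary. A Poisson structure on $P$ is a smooth bivector field $\pi$, with associated skew-symmetric bundle map $\pi^\sharp\colon T^*P\to TP$, $\langle \eta,\pi^\sharp\xi\rangle=\pi(\xi,\eta)$, such that $\{f,g\}=\pi(df,dg)$ satisfies the Jacobi identity. The cotangent Lie algebroid of $(P,\pi)$ is $T^*P$ with anchor $\pi^\sharp$ and bracket $$[\xi,\eta]=L_{\pi^\sharp\xi}\eta-L_{\pi^\sharp\eta}\xi-d(\pi(\xi,\eta)).$$ Its differential and Lie derivative are given, for functions $f$, one-forms $\xi,\eta$ and vector fields $X$, by $\langle d_*f,\eta\rangle=(\pi^\sharp\eta)f$ and $\langle L_\xi X,\eta\rangle=(\pi^\sharp\xi)\langle X,\eta\rangle-\langle X,[\xi,\eta]\rangle$. The bundle $E=TP\oplus T^*P$ carries the pairings $(X_1+\xi_1,X_2+\xi_2)_\pm=\frac12(\langle\xi_1,X_2\rangle\pm\langle\xi_2,X_1\rangle)$ and, for sections $e_i=X_i+\xi_i$, the bracket $$[e_1,e_2]=\big([X_1,X_2]+L_{\xi_1}X_2-L_{\xi_2}X_1-d_*(e_1,e_2)_-\big)+\big([\xi_1,\xi_2]+L_{X_1}\xi_2-L_{X_2}\xi_1+d(e_1,e_2)_-\big).$$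 A Dirac structure in $E$ is a smooth subbundle $L\subseteq E$ which is maximally isotropic for $(\cdot,\cdot)_+$ and whose space of smooth sections is closed under this bracket. For a smooth subbundle $D\subseteq TP$ let $D^\perp\subseteq T^*P$ be its annihilator. $D$ is called integrable if every point of $P$ lies on an integral manifold of $D$. For an open set $U\subseteq P$, two points of $U$ lie on the same leaf of $D|_U$ if a smooth curve in $U$ tangent to $D$ joins them. A manifold $Q$ with a map $p\colon U\to Q$ is called the quotient manifold $U/D$ if $p$ is a surjective smooth submersion with $\ker dp=D|_U$ whose fibres are exactly the leaves of $D|_U$. **Corollary.** Let $(P,\pi)$ be a Poisson manifold and $D\subseteq TP$ a smooth subbundle. (a) $D\oplus D^\perp$ is a Dirac structure in $E=TP\oplus T^*P$ if and only if $D$ is integrable and $\pi$ descends locally to the quotient by $D$, i.e. every point of $P$ has an open neighbourhood $U$ such that the quotient manifold $U/D$ exists and carries a Poisson structure for which the projection $p\colon U\to U/D$ is a Poisson map, i.e. $\{f\circ p,g\circ p\}=\{f,g\}\circ p$ on $U$ for all smooth functions $f,g$ on $U/D$. (b) If the quotient manifold $P/D$ exists globally, then $D\oplus D^\perp$ is a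 Dirac structure in $E$ if and only if $D$ is integrable and $P/D$ carries a Poisson structure for which the projection $P\to P/D$ is a Poisson map. -/

import Mathlib

open scoped Manifold ContDiff
open Bundle Set

noncomputable section

namespace DiracReduction

/-! Manifolds are modelled on `EuclideanSpace ℝ (Fin n)` (finite-dimensional, without boundary). -/

section Basic

variable (n : ℕ) {P : Type*} [TopologicalSpace P] [ChartedSpace (EuclideanSpace ℝ (Fin n)) P]

/-- The tangent space `T_x P`. -/
abbrev Tan (x : P) : Type := TangentSpace (𝓡 n) x

/-- The cotangent space `T*_x P`. -/
abbrev Cotan (x : P) : Type := TangentSpace (𝓡 n) x →L[ℝ] ℝ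

variable (P) in
/-- Not necessarily smooth vector fields on `P`. -/
abbrev VField : Type _ := ∀ x : P, Tan n x

variable (P) in
/-- Not necessarily smooth one-forms on `P`. -/
abbrev OneForm : Type _ := ∀ x : P, Cotan n x

variable (P) in
/-- Not necessarily smooth sections `X + ξ` of `TP ⊕ T*P`. -/
abbrev GenSection : Type _ := ∀ x : P, Tan n x × Cotan n x

variable {n}

/-- The coordinate basis of `T_x P` given by the preferred chart at `x`. -/
def tanBasis (x : P) : Module.Basis (Fin n) ℝ (Tan n x) :=
  (EuclideanSpace.basisFun (Fin n) ℝ).toBasis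

/-- The dual basis of `T*_x P`. -/
def cotanBasis (x : P) (i : Fin n) : Cotan n x :=
  (EuclideanSpace.proj i : EuclideanSpace ℝ (Fin n) →L[ℝ] ℝ)

theorem cotanBasis_apply (x : P) (i : Fin n) (v : Tan n x) :
    cotanBasis x i v = (tanBasis x).repr v i := rfl

/-- The covector whose value at `v` is `φ v`, for a linear functional `φ` on `T_x P`. -/
def toCovector (x : P) (φ : Tan n x → ℝ) : Cotan n x :=
  ∑ i, φ (tanBasis x i) • cotanBasis x i

/-- The vector `v` with `η v = φ η` for all covectors `η`, for a linear functional `φ` on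
`T*_x P`. -/
def toVector (x : P) (φ : Cotan n x → ℝ) : Tan n x :=
  ∑ i, φ (cotanBasis x i) • tanBasis x i

theorem toCovector_apply (x : P) (φ : Tan n x →ₗ[ℝ] ℝ) (v : Tan n x) :
    toCovector x φ v = φ v := by
  conv_rhs => rw [← (tanBasis x).sum_repr v, map_sum]
  simp [toCovector, cotanBasis_apply, mul_comm]

theorem apply_toVector (x : P) (φ : Cotan n x →ₗ[ℝ] ℝ) (η : Cotan n x) :
    η (toVector x φ) = φ η := by
  have h : η = ∑ i, η (tanBasis x i) • cotanBasis x i := by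
    ext v
    exact (toCovector_apply x η.toLinearMap v).symm
  conv_rhs => rw [h, map_sum]
  simp [toVector, map_sum, mul_comm]

/-- The differential `df` of a function. -/
abbrev diff (f : P → ℝ) : OneForm n P := mvfderiv (𝓡 n) f

variable [IsManifold (𝓡 n) ∞ P]

/-- `X` is a smooth vector field on `U`. -/
def SmoothVFieldOn (U : Set P) (X : VField n P) : Prop :=
  ContMDiffOn (𝓡 n) ((𝓡 n).prod 𝓘(ℝ, EuclideanSpace ℝ (Fin n))) ∞
    (fun x => TotalSpace.mk' (EuclideanSpace ℝ (Fin n)) (E := fun x : P => Tan n x) x (X x)) U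

/-- `ξ` is a smooth one-form on `U`. -/
def SmoothOneFormOn (U : Set P) (ξ : OneForm n P) : Prop :=
  ContMDiffOn (𝓡 n) ((𝓡 n).prod 𝓘(ℝ, EuclideanSpace ℝ (Fin n) →L[ℝ] ℝ)) ∞
    (fun x => TotalSpace.mk' (EuclideanSpace ℝ (Fin n) →L[ℝ] ℝ)
      (E := fun x : P => Cotan n x) x (ξ x)) U

/-- `e = X + ξ` is a smooth section of `TP ⊕ T*P` over `U`. -/
def SmoothGenSectionOn (U : Set P) (e : GenSection n P) : Prop :=
  SmoothVFieldOn U (fun x => (e x).1) ∧ SmoothOneFormOn U (fun x => (e x).2)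

/-- The extension of a tangent vector at `x` to a vector field which is smooth near `x`
(it has constant coordinates in the preferred chart at `x`). -/
def extendTan {x : P} (v : Tan n x) : VField n P :=
  FiberBundle.extend (EuclideanSpace ℝ (Fin n)) v

/-- The extension of a covector at `x` to a one-form which is smooth near `x`
(it has constant coordinates in the preferred chart at `x`). -/
def extendCotan {x : P} (η : Cotan n x) : OneForm n P :=
  FiberBundle.extend (E := fun x : P => Cotan n x) (EuclideanSpace ℝ (Fin n) →L[ℝ] ℝ) η

/-- The function `⟨ξ, X⟩`. -/
def pairing (ξ : OneForm n P) (X : VField n P) : P → ℝ := fun x => ξ x (X x)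

/-- The Lie derivative `L_X ξ`, i.e. `⟨L_X ξ, Y⟩ = X ⟨ξ, Y⟩ - ⟨ξ, [X, Y]⟩`. The right-hand side is
tensorial in `Y`, so it may be evaluated on extensions of tangent vectors. -/
def lieDerivForm (X : VField n P) (ξ : OneForm n P) : OneForm n P := fun x =>
  toCovector x fun v =>
    diff (pairing ξ (extendTan v)) x (X x) - ξ x (VectorField.mlieBracket (𝓡 n) X (extendTan v) x)

/-- The defining expression of the Lie derivative of a one-form is tensorial in `Y`. -/
theorem lieDerivForm_tensorial (X : VField n P) (ξ : OneForm n P) (x : P)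
   (hξ : MDifferentiableAt (𝓡 n) ((𝓡 n).prod 𝓘(ℝ, EuclideanSpace ℝ (Fin n) →L[ℝ] ℝ))
    (fun x => TotalSpace.mk' (EuclideanSpace ℝ (Fin n) →L[ℝ] ℝ)
      (E := fun x : P => Cotan n x) x (ξ x)) x) :
   TensorialAt (𝓡 n) (EuclideanSpace ℝ (Fin n)) (fun Y : VField n P =>
    diff (pairing ξ Y) x (X x) - ξ x (VectorField.mlieBracket (𝓡 n) X Y x)) x := by
  have key : ∀ {Y : VField n P}, MDifferentiableAt (𝓡 n) ((𝓡 n).prod 𝓘(ℝ, EuclideanSpace ℝ (Fin n)))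
    (fun x => TotalSpace.mk' (EuclideanSpace ℝ (Fin n)) (E := fun x : P => Tan n x) x (Y x)) x →
     MDifferentiableAt (𝓡 n) 𝓘(ℝ,ℝ) (pairing ξ Y) x := by
    intro Y hY
    have := MDifferentiableAt.clm_bundle_apply (E₂ := Trivial P ℝ) (F₂ := ℝ) (v := Y) (b := id) (ϕ := ξ) hξ hY
    exact (mdifferentiableAt_section (F := ℝ) (E := Trivial P ℝ) (IB := 𝓡 n) (s := pairing ξ Y)).1 this
  constructor
  · intro f Y hf hY
    have : pairing ξ (f • Y) = f • pairing ξ Y := by ext y; simp [pairing]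
    rw [this]
    simp only [diff]
    rw [mvfderiv_smul hf (key hY), VectorField.mlieBracket_smul_right hf hY]
    simp [pairing, mvfderiv]
    ring
  · intro Y Y' hY hY'
    have : pairing ξ (Y + Y') = pairing ξ Y + pairing ξ Y' := by ext y; simp [pairing]
    rw [this]
    simp only [diff]
    rw [mvfderiv_add (key hY) (key hY'), VectorField.mlieBracket_add_right hY hY']
    simp
    ring

/-- The defining formula of the Lie derivative of a one-form holds for all vector fields `Y`. -/
theorem lieDerivForm_apply (X : VField n P) (ξ : OneForm n P) (x : P) (Y : VField n P)
   (hY : MDifferentiableAt (𝓡 n) ((𝓡 n).prod 𝓘(ℝ, EuclideanSpace ℝ (Fin n)))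
    (fun x => TotalSpace.mk' (EuclideanSpace ℝ (Fin n)) (E := fun x : P => Tan n x) x (Y x)) x)
   (hξ : MDifferentiableAt (𝓡 n) ((𝓡 n).prod 𝓘(ℝ, EuclideanSpace ℝ (Fin n) →L[ℝ] ℝ))
    (fun x => TotalSpace.mk' (EuclideanSpace ℝ (Fin n) →L[ℝ] ℝ)
      (E := fun x : P => Cotan n x) x (ξ x)) x) :
   lieDerivForm X ξ x (Y x) = diff (pairing ξ Y) x (X x) - ξ x (VectorField.mlieBracket (𝓡 n) X Y x) := by
  rw [← TensorialAt.mkHom_apply (lieDerivForm_tensorial X ξ x hξ) hY]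
  exact toCovector_apply x (TensorialAt.mkHom _ x (lieDerivForm_tensorial X ξ x hξ)).toLinearMap (Y x)

end Basic

section Poisson

variable (n : ℕ) (P : Type*) [TopologicalSpace P] [ChartedSpace (EuclideanSpace ℝ (Fin n)) P]
  [IsManifold (𝓡 n) ∞ P]

/-- A Poisson structure on `P`: a smooth bivector field `π`, given as the skew-symmetric bundle map
`π♯ : T*P → TP`, `⟨η, π♯ ξ⟩ = π(ξ, η)`, such that the bracket `{f, g} = π(df, dg)` satisfies the
Jacobi identity. -/
structure PoissonStructure where
  /-- The bundle map `π♯`. -/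
  sharp : ∀ x : P, Cotan n x →L[ℝ] Tan n x
  smooth : ContMDiff (𝓡 n)
    ((𝓡 n).prod 𝓘(ℝ, (EuclideanSpace ℝ (Fin n) →L[ℝ] ℝ) →L[ℝ] EuclideanSpace ℝ (Fin n))) ∞
    (fun x => TotalSpace.mk'
      ((EuclideanSpace ℝ (Fin n) →L[ℝ] ℝ) →L[ℝ] EuclideanSpace ℝ (Fin n))
      (E := fun x : P => Cotan n x →L[ℝ] Tan n x) x (sharp x))
  skew : ∀ (x : P) (ξ η : Cotan n x), η (sharp x ξ) = -ξ (sharp x η)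
  jacobi : ∀ f g h : P → ℝ, ContMDiff (𝓡 n) 𝓘(ℝ, ℝ) ∞ f → ContMDiff (𝓡 n) 𝓘(ℝ, ℝ) ∞ g →
    ContMDiff (𝓡 n) 𝓘(ℝ, ℝ) ∞ h →
    let br : (P → ℝ) → (P → ℝ) → P → ℝ := fun f g x => diff g x (sharp x (diff f x))
    ∀ x, br f (br g h) x + br g (br h f) x + br h (br f g) x = 0

variable {n P}

namespace PoissonStructure

variable (πP : PoissonStructure n P)

/-- The Poisson bracket `{f, g} = π(df, dg)`. -/
def bracket (f g : P → ℝ) : P → ℝ := fun x => diff g x (πP.sharp x (diff f x))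

/-- The vector field `π♯ ξ`; this is the anchor of the cotangent Lie algebroid. -/
def anchor (ξ : OneForm n P) : VField n P := fun x => πP.sharp x (ξ x)

/-- The bracket of the cotangent Lie algebroid,
`[ξ, η] = L_{π♯ ξ} η - L_{π♯ η} ξ - d (π(ξ, η))`. -/
def formBracket (ξ η : OneForm n P) : OneForm n P := fun x =>
  lieDerivForm (πP.anchor ξ) η x - lieDerivForm (πP.anchor η) ξ x
    - diff (pairing η (πP.anchor ξ)) x

/-- The Lie derivative `L_ξ X` of a section of `TP` with respect to the cotangent Lie algebroid,
i.e. `⟨L_ξ X, η⟩ = (π♯ ξ) ⟨X, η⟩ - ⟨X, [ξ, η]⟩`. The right-hand side is tensorial in `η`, so it may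
be evaluated on extensions of covectors. -/
def lieDerivVField (ξ : OneForm n P) (X : VField n P) : VField n P := fun x =>
  toVector x fun η =>
    diff (pairing (extendCotan η) X) x (πP.sharp x (ξ x)) - πP.formBracket ξ (extendCotan η) x (X x)

/-- The differential `d_* f`, a section of `TP`, of the cotangent Lie algebroid, i.e.
`⟨d_* f, η⟩ = (π♯ η) f`. -/
def dStar (f : P → ℝ) : VField n P := fun x => toVector x fun η => diff f x (πP.sharp x η)

end PoissonStructure

/-- The function `(e₁, e₂)₋ = ½ (⟨ξ₁, X₂⟩ - ⟨ξ₂, X₁⟩)`. -/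
def minusPairing (e₁ e₂ : GenSection n P) : P → ℝ := fun x =>
  ((e₁ x).2 (e₂ x).1 - (e₂ x).2 (e₁ x).1) / 2

/-- The symmetric form `(e₁, e₂)₊ = ½ (⟨ξ₁, X₂⟩ + ⟨ξ₂, X₁⟩)` on `T_x P ⊕ T*_x P`. -/
def plusPairing {x : P} (e₁ e₂ : Tan n x × Cotan n x) : ℝ := (e₁.2 e₂.1 + e₂.2 e₁.1) / 2

/-- The bracket of the Courant algebroid `E = TP ⊕ T*P`, the double of the Lie bialgebroid
`(TP, T*P)` in which `T*P` is the cotangent Lie algebroid of `π`: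
`[e₁, e₂] = ([X₁, X₂] + L_{ξ₁} X₂ - L_{ξ₂} X₁ - d_* (e₁, e₂)₋)
  + ([ξ₁, ξ₂] + L_{X₁} ξ₂ - L_{X₂} ξ₁ + d (e₁, e₂)₋)`. -/
def courantBracket (πP : PoissonStructure n P) (e₁ e₂ : GenSection n P) : GenSection n P :=
  let X₁ : VField n P := fun x => (e₁ x).1
  let ξ₁ : OneForm n P := fun x => (e₁ x).2
  let X₂ : VField n P := fun x => (e₂ x).1
  let ξ₂ : OneForm n P := fun x => (e₂ x).2
  fun x =>
    (VectorField.mlieBracket (𝓡 n) X₁ X₂ x + πP.lieDerivVField ξ₁ X₂ x - πP.lieDerivVField ξ₂ X₁ x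
        - πP.dStar (minusPairing e₁ e₂) x,
      πP.formBracket ξ₁ ξ₂ x + lieDerivForm X₁ ξ₂ x - lieDerivForm X₂ ξ₁ x
        + diff (minusPairing e₁ e₂) x)

/-- `D` is a smooth vector subbundle of `TP`: it has smooth local frames. -/
def IsTanSubbundle (D : ∀ x : P, Submodule ℝ (Tan n x)) : Prop :=
  ∀ x₀ : P, ∃ U : Set P, IsOpen U ∧ x₀ ∈ U ∧ ∃ (k : ℕ) (X : Fin k → VField n P),
    (∀ i, SmoothVFieldOn U (X i)) ∧
    ∀ x ∈ U, LinearIndependent ℝ (fun i => X i x) ∧ Submodule.span ℝ (range fun i => X i x) = D x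

/-- `L` is a smooth vector subbundle of `TP ⊕ T*P`: it has smooth local frames. -/
def IsGenSubbundle (L : ∀ x : P, Submodule ℝ (Tan n x × Cotan n x)) : Prop :=
  ∀ x₀ : P, ∃ U : Set P, IsOpen U ∧ x₀ ∈ U ∧ ∃ (k : ℕ) (e : Fin k → GenSection n P),
    (∀ i, SmoothGenSectionOn U (e i)) ∧
    ∀ x ∈ U, LinearIndependent ℝ (fun i => e i x) ∧ Submodule.span ℝ (range fun i => e i x) = L x

/-- A subspace on which the symmetric form `(·, ·)₊` vanishes. -/
def IsIsotropic {x : P} (W : Submodule ℝ (Tan n x × Cotan n x)) : Prop :=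
  ∀ a ∈ W, ∀ b ∈ W, plusPairing a b = 0

/-- A Dirac structure in the Courant algebroid `TP ⊕ T*P` of the Poisson manifold `(P, π)`: a
subbundle which is maximally isotropic and whose space of smooth sections is closed under the
bracket. -/
structure IsDirac (πP : PoissonStructure n P)
    (L : ∀ x : P, Submodule ℝ (Tan n x × Cotan n x)) : Prop where
  subbundle : IsGenSubbundle L
  isotropic : ∀ x, IsIsotropic (L x)
  maximal : ∀ x (W : Submodule ℝ (Tan n x × Cotan n x)), IsIsotropic W → L x ≤ W → W = L x
  integrable : ∀ e₁ e₂ : GenSection n P, SmoothGenSectionOn univ e₁ → SmoothGenSectionOn univ e₂ →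
    (∀ x, e₁ x ∈ L x) → (∀ x, e₂ x ∈ L x) → ∀ x, courantBracket πP e₁ e₂ x ∈ L x

/-- The annihilator `D^⊥ ⊆ T*P`. -/
def annihilator (D : ∀ x : P, Submodule ℝ (Tan n x)) (x : P) : Submodule ℝ (Cotan n x) where
  carrier := {ξ | ∀ v ∈ D x, ξ v = 0}
  add_mem' ha hb v hv := by simp [ha v hv, hb v hv]
  zero_mem' v _ := by simp
  smul_mem' c ξ hξ v hv := by simp [hξ v hv]

/-- The subbundle `D ⊕ D^⊥` of `TP ⊕ T*P`. -/
def nullBundle (D : ∀ x : P, Submodule ℝ (Tan n x)) (x : P) :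
    Submodule ℝ (Tan n x × Cotan n x) :=
  (D x).prod (annihilator D x)

/-- `D` is integrable: through every point passes an integral manifold of `D`, i.e. an immersed
submanifold (here given by a local parametrization `s`) whose tangent spaces are the spaces of
`D`. -/
def IsIntegrableDistribution (D : ∀ x : P, Submodule ℝ (Tan n x)) : Prop :=
  ∀ x₀ : P, ∃ (k : ℕ) (W : Set (EuclideanSpace ℝ (Fin k))) (s : EuclideanSpace ℝ (Fin k) → P),
    IsOpen W ∧ 0 ∈ W ∧ s 0 = x₀ ∧ ContMDiffOn (𝓡 k) (𝓡 n) ∞ s W ∧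
    ∀ w ∈ W, Function.Injective (mfderiv (𝓡 k) (𝓡 n) s w) ∧
      (mfderiv (𝓡 k) (𝓡 n) s w).range = D (s w)

/-- `x` and `y` lie on the same leaf of the restriction of `D` to the open set `U`: they are joined
by a smooth curve in `U` tangent to `D`. -/
def SameLeaf (D : ∀ x : P, Submodule ℝ (Tan n x)) (U : Set P) (x y : P) : Prop :=
  ∃ γ : ℝ → P, ContMDiff 𝓘(ℝ, ℝ) (𝓡 n) ∞ γ ∧ γ 0 = x ∧ γ 1 = y ∧
    ∀ t : ℝ, γ t ∈ U ∧ mfderiv 𝓘(ℝ, ℝ) (𝓡 n) γ t (1 : ℝ) ∈ D (γ t)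

section Quotient

variable {m : ℕ} {Q : Type*} [TopologicalSpace Q] [ChartedSpace (EuclideanSpace ℝ (Fin m)) Q]
  [IsManifold (𝓡 m) ∞ Q]

/-- The map `p`, of which only the restriction to the open set `U` matters, exhibits the manifold
`Q` as the quotient manifold `U/D`: `p : U → Q` is a surjective submersion, its fibres are the
leaves of `D` in `U`, and the tangent spaces of the fibres are the spaces of `D`. -/
structure IsQuotientManifold (D : ∀ x : P, Submodule ℝ (Tan n x)) (U : Set P) (p : P → Q) :
    Prop where
  smooth : ContMDiffOn (𝓡 n) (𝓡 m) ∞ p U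
  surjective : p '' U = univ
  submersion : ∀ x ∈ U, Function.Surjective (mfderiv (𝓡 n) (𝓡 m) p x)
  ker_eq : ∀ x ∈ U, (mfderiv (𝓡 n) (𝓡 m) p x).ker = D x
  fibre : ∀ x ∈ U, ∀ y ∈ U, p x = p y ↔ SameLeaf D U x y

/-- `p : U → Q` is a Poisson map: `{f ∘ p, g ∘ p} = {f, g} ∘ p` on `U`. -/
def IsPoissonMapOn (πP : PoissonStructure n P) (πQ : PoissonStructure m Q) (U : Set P)
    (p : P → Q) : Prop :=
  ContMDiffOn (𝓡 n) (𝓡 m) ∞ p U ∧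
  ∀ f g : Q → ℝ, ContMDiff (𝓡 m) 𝓘(ℝ, ℝ) ∞ f → ContMDiff (𝓡 m) 𝓘(ℝ, ℝ) ∞ g →
    ∀ x ∈ U, πP.bracket (f ∘ p) (g ∘ p) x = πQ.bracket f g (p x)

end Quotient

/-- The Poisson structure `π` descends locally to the quotient by `D`: every point has an open
neighbourhood `U` such that `U/D` is a (Hausdorff) manifold which carries a Poisson structure for
which the projection `U → U/D` is a Poisson map. -/
def DescendsLocally (πP : PoissonStructure n P) (D : ∀ x : P, Submodule ℝ (Tan n x)) : Prop :=
  ∀ x₀ : P, ∃ U : Set P, IsOpen U ∧ x₀ ∈ U ∧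
    ∃ (m : ℕ) (Q : Type) (_ : TopologicalSpace Q) (_ : ChartedSpace (EuclideanSpace ℝ (Fin m)) Q)
      (_ : IsManifold (𝓡 m) ∞ Q) (_ : T2Space Q) (p : P → Q),
      IsQuotientManifold (m := m) D U p ∧ ∃ πQ : PoissonStructure m Q, IsPoissonMapOn πP πQ U p

end Poisson

end DiracReduction

end

open DiracReduction

/-! On sections of `D ⊕ D^⊥` the pairing `(·,·)₋` vanishes, so closure under the Courant bracket
means that `[X, Y]` and `L_ξ X` lie in `D` and that `[ξ, η]` and `L_X ξ` lie in `D^⊥`, for `X, Y` in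
`D` and `ξ, η` in `D^⊥`. The condition on `[X, Y]` is involutivity and implies the one on `L_X ξ`.
The two conditions involving `π` are governed by the expression `cob`: when `ξ, η` annihilate `D`
and `Y` lies in `D`, the derivative terms in `⟨[ξ, η], Y⟩` vanish and `cob ξ η Y` remains
(`formBracket_apply`). It is tensorial in `ξ` and `η`, and for functions `f, g` constant along `D`
it gives `cob (df) (dg) Y = Y{f, g}` (`cob_diff`). Thus being Dirac amounts to involutivity of `D`
together with: the bracket of functions constant along `D` is constant along `D`.

If `D ⊕ D^⊥` is Dirac, Frobenius (`exists_foliated_chart`) gives charts onto `E₁ × E₂` in which `D`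
is tangent to the slices `E₁ × {c}`. The slices are integral manifolds and the `E₂`-coordinate is a
local quotient map. Brackets of pulled-back functions are constant on leaves, so they define a
bracket on the quotient, which inherits the Jacobi identity (`exists_poissonStructure_quotient`).

Conversely, coordinates of the quotient pull back to functions `yᵢ` whose differentials frame `D^⊥`
and whose brackets are pullbacks, hence constant along `D` (`IsBasicFrame`). Involutivity holds
because `D` is the common kernel of the `dyᵢ`; `cob` vanishes on `D^⊥ × D^⊥ × D` because it vanishes
on the `dyᵢ`. For a global quotient both arguments apply with `U = P`.

Frobenius is proved by writing `D` as the graphs of `A z : E₁ → E₂`. Involutivity is the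
compatibility condition of the total differential equation `dφ = A(x, φ)`. Along rays this is an
integral equation in `C([0,1], E₂)`, solved by the implicit function theorem, which also yields
smooth dependence on parameters; a Gronwall argument then recovers the total equation. -/

namespace DiracReduction

open Filter Topology unitInterval

/-! ### Smoothness of post-composition on spaces of continuous functions -/

section Nemytskii

variable {K : Type*} [TopologicalSpace K] [CompactSpace K]
  {F : Type*} [NormedAddCommGroup F] [NormedSpace ℝ F]
  {G : Type*} [NormedAddCommGroup G] [NormedSpace ℝ G]
  {H : Type*} [NormedAddCommGroup H] [NormedSpace ℝ H]

/-- A continuous bilinear map applied pointwise to continuous functions. -/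
noncomputable def pointwiseApply (B : H →L[ℝ] F →L[ℝ] G) : C(K, H) →L[ℝ] C(K, F) →L[ℝ] C(K, G) :=
  LinearMap.mkContinuous₂
    (LinearMap.mk₂ ℝ (fun (a : C(K, H)) (b : C(K, F)) =>
        (⟨fun t => B (a t) (b t), by fun_prop⟩ : C(K, G)))
      (fun _ _ _ => by ext; simp) (fun _ _ _ => by ext; simp)
      (fun _ _ _ => by ext; simp) (fun _ _ _ => by ext; simp))
    ‖B‖ fun a b => by
      have hB : 0 ≤ ‖B‖ := B.opNorm_nonneg
      rw [ContinuousMap.norm_le _ (mul_nonneg (mul_nonneg hB (norm_nonneg _)) (norm_nonneg _))]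
      intro t
      simp only [LinearMap.mk₂_apply, ContinuousMap.coe_mk]
      exact (B.le_opNorm₂ _ _).trans (mul_le_mul
        (mul_le_mul_of_nonneg_left (a.norm_coe_le_norm t) hB)
        (b.norm_coe_le_norm t) (norm_nonneg _) (mul_nonneg hB (norm_nonneg _)))

noncomputable instance : PseudoMetricSpace C(K, F →L[ℝ] G) :=
  ContinuousMap.instPseudoMetricSpace _ _

/-- The mean value inequality on the segment from `γ t` to `η t`, made uniform in `t`: each point of
the segment is the value at `t` of some `γ + s • (η - γ)`, which is as close to `γ` as `η` is, and
`η ↦ f' ∘ η` is continuous in the sup norm. -/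
theorem hasFDerivAt_postcomp (f : C(F, G)) (f' : C(F, F →L[ℝ] G))
    (hf : ∀ x, HasFDerivAt f (f' x) x) (γ : C(K, F)) :
    HasFDerivAt (fun γ : C(K, F) => f.comp γ)
      (pointwiseApply (ContinuousLinearMap.id ℝ (F →L[ℝ] G)) (f'.comp γ)) γ := by
  rw [hasFDerivAt_iff_isLittleO, Asymptotics.isLittleO_iff]
  intro ε hε
  have hc : Continuous fun η : C(K, F) => f'.comp η := f'.continuous_postcomp
  obtain ⟨r, hr, hball⟩ := Metric.continuousAt_iff.1 (hc.continuousAt (x := γ)) ε hε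
  filter_upwards [Metric.ball_mem_nhds γ hr] with η hη
  rw [ContinuousMap.norm_le _ (by positivity)]
  intro t
  have key : ∀ x ∈ segment ℝ (γ t) (η t), ‖f' x - f' (γ t)‖ ≤ ε := by
    intro x hx
    rw [segment_eq_image'] at hx
    obtain ⟨s, hs, rfl⟩ := hx
    have h1 : dist (γ + s • (η - γ)) γ < r := by
      rw [dist_eq_norm, add_sub_cancel_left, norm_smul, Real.norm_of_nonneg hs.1, ← dist_eq_norm]
      exact (mul_le_of_le_one_left dist_nonneg hs.2).trans_lt hη
    have h2 := (ContinuousMap.dist_apply_le_dist t).trans_lt (hball h1)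
    rw [dist_eq_norm] at h2
    exact h2.le
  have := (convex_segment (𝕜 := ℝ) (γ t) (η t)).norm_image_sub_le_of_norm_hasFDerivWithin_le'
    (f := f) (f' := f') (φ := f' (γ t)) (fun x _ => (hf x).hasFDerivWithinAt) key
    (left_mem_segment ℝ _ _) (right_mem_segment ℝ _ _)
  refine this.trans ?_
  gcongr
  exact (η - γ).norm_coe_le_norm t

/-- Induction on the order: the derivative is again post-composition, with `f'`, followed by a
bounded linear map. The target `G` varies in the induction because `f'` takes values in `F →L[ℝ] G`.
-/
theorem contDiff_postcomp {F : Type} [NormedAddCommGroup F] [NormedSpace ℝ F] (n : ℕ) :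
    ∀ {G : Type} [NormedAddCommGroup G] [NormedSpace ℝ G] (f : C(F, G)), ContDiff ℝ n f →
      ContDiff ℝ n (fun γ : C(K, F) => f.comp γ) := by
  induction n with
  | zero =>
    intro G _ _ f _
    exact contDiff_zero.2 f.continuous_postcomp
  | succ n ih =>
    intro G _ _ f hf
    push_cast at hf ⊢
    obtain ⟨f', hf', hd⟩ := contDiff_succ_iff_hasFDerivAt.1 hf
    exact contDiff_succ_iff_hasFDerivAt.2
      ⟨fun γ => pointwiseApply (ContinuousLinearMap.id ℝ (F →L[ℝ] G))
        ((⟨f', hf'.continuous⟩ : C(F, F →L[ℝ] G)).comp γ),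
      ContDiff.comp (g := pointwiseApply (K := K) (ContinuousLinearMap.id ℝ (F →L[ℝ] G)))
        (ContinuousLinearMap.contDiff _) (ih ⟨f', hf'.continuous⟩ hf'),
      fun γ => hasFDerivAt_postcomp f ⟨f', hf'.continuous⟩ hd γ⟩

end Nemytskii

/-! ### Integration as a bounded operator on curves -/

section Primitive

variable {G : Type*} [NormedAddCommGroup G] [NormedSpace ℝ G]

/-- The primitive vanishing at `0` of a continuous function on the unit interval. -/
noncomputable def primitive [CompleteSpace G] : C(I, G) →L[ℝ] C(I, G) :=
  LinearMap.mkContinuous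
    { toFun := fun γ => ⟨fun t => ∫ s in (0 : ℝ)..t, IccExtend zero_le_one γ s, by
        refine Continuous.comp (g := fun t : ℝ => ∫ s in (0 : ℝ)..t, IccExtend zero_le_one γ s) ?_
          continuous_subtype_val
        exact intervalIntegral.continuous_primitive
          (fun a b => γ.continuous.Icc_extend'.intervalIntegrable a b) 0⟩
      map_add' := fun a b => by
        ext t
        simp only [ContinuousMap.coe_mk, ContinuousMap.add_apply]
        rw [← intervalIntegral.integral_add (a.continuous.Icc_extend'.intervalIntegrable _ _)
          (b.continuous.Icc_extend'.intervalIntegrable _ _)]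
        rfl
      map_smul' := fun c a => by
        ext t
        simp only [ContinuousMap.coe_mk, ContinuousMap.smul_apply, RingHom.id_apply]
        rw [← intervalIntegral.integral_smul]
        rfl }
    1 fun γ => by
      rw [ContinuousMap.norm_le _ (by positivity)]
      intro t
      refine (intervalIntegral.norm_integral_le_of_norm_le_const
        (C := ‖γ‖) fun s _ => γ.norm_coe_le_norm _).trans ?_
      rw [one_mul, sub_zero, abs_of_nonneg t.2.1]
      exact mul_le_of_le_one_right (norm_nonneg _) t.2.2

theorem hasDerivAt_primitive [CompleteSpace G] (γ : C(I, G)) (t : ℝ) :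
    HasDerivAt (fun t : ℝ => ∫ s in (0 : ℝ)..t, IccExtend zero_le_one γ s)
      (IccExtend zero_le_one γ t) t :=
  intervalIntegral.integral_hasDerivAt_right
    (γ.continuous.Icc_extend'.intervalIntegrable _ _)
    (γ.continuous.Icc_extend'.stronglyMeasurableAtFilter _ _) γ.continuous.Icc_extend'.continuousAt

end Primitive

end DiracReduction

namespace DiracReduction

open Filter Topology unitInterval

/-! ### Implicit and inverse functions smooth near a point -/

section ImplicitFunction

variable {E₁ E₂ F : Type*} [NormedAddCommGroup E₁] [NormedSpace ℝ E₁] [CompleteSpace E₁]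
  [NormedAddCommGroup E₂] [NormedSpace ℝ E₂] [CompleteSpace E₂]
  [NormedAddCommGroup F] [NormedSpace ℝ F] [CompleteSpace F]

/-- Being `C^∞` at one point does not give a common neighbourhood for all orders. Here the partial
derivative stays invertible along the graph of `ψ`, so the implicit function theorem applies afresh
at each nearby `(x, ψ x)`, and by local uniqueness its solution there is again `ψ`. -/
theorem eventually_contDiffAt_implicitFunction {f : E₁ × E₂ → F} (hf : ContDiff ℝ ∞ f)
    (u : E₁ × E₂) (hinv : (fderiv ℝ f u ∘L .inr ℝ E₁ E₂).IsInvertible) :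
    ∀ᶠ x in 𝓝 u.1, ContDiffAt ℝ ∞
      ((hf.contDiffAt (x := u)).implicitFunction (by simp) hinv) x := by
  have hfu : ContDiffAt ℝ ∞ f u := hf.contDiffAt
  set ψ := hfu.implicitFunction (by simp) hinv with hψ
  have hc : ContDiffAt ℝ ∞ ψ u.1 := hfu.contDiffAt_implicitFunction (by simp) hinv
  have hψu : ψ u.1 = u.2 := hfu.implicitFunction_apply_self (by simp) hinv
  have e1 : ∀ᶠ x in 𝓝 u.1, ContinuousAt ψ x :=
    ((hc.of_le (by simp : (1 : ℕ∞ω) ≤ ∞)).eventually (by simp)).mono fun z hz => hz.continuousAt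
  have e2 : ∀ᶠ x in 𝓝 u.1, (fderiv ℝ f (x, ψ x) ∘L .inr ℝ E₁ E₂).IsInvertible := by
    have h1 : Continuous fun p : E₁ × E₂ => fderiv ℝ f p ∘L .inr ℝ E₁ E₂ :=
      (hf.continuous_fderiv (by simp)).clm_comp continuous_const
    have h2 : ContinuousAt (fun x => fderiv ℝ f (x, ψ x) ∘L .inr ℝ E₁ E₂) u.1 :=
      ContinuousAt.comp (g := fun p : E₁ × E₂ => fderiv ℝ f p ∘L .inr ℝ E₁ E₂)
        h1.continuousAt (continuousAt_id.prodMk hc.continuousAt)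
    refine h2.eventually_mem (ContinuousLinearEquiv.isOpen.mem_nhds ?_)
    rw [hψu]
    exact hinv
  filter_upwards [e1, e2,
    (hfu.eventually_apply_implicitFunction (by simp) hinv).eventually_nhds] with x h1 h2 h3
  have hx : ContDiffAt ℝ ∞ f (x, ψ x) := hf.contDiffAt
  refine (hx.contDiffAt_implicitFunction (by simp) h2).congr_of_eventuallyEq ?_
  have ht : Tendsto (fun x' => (x', ψ x')) (𝓝 x) (𝓝 (x, ψ x)) := continuousAt_id.prodMk h1
  filter_upwards [ht.eventually (hx.eventually_apply_eq_iff_implicitFunction (by simp) h2), h3]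
    with x' h4 h5
  exact (h4.1 (h5.trans h3.self_of_nhds.symm)).symm

/-- The inverse function theorem for maps which are smooth in a neighbourhood of a point. -/
theorem exists_smooth_localInverse {E₁ E₂ : Type*} [NormedAddCommGroup E₁] [NormedSpace ℝ E₁]
    [CompleteSpace E₁] [NormedAddCommGroup E₂] [NormedSpace ℝ E₂] {f : E₁ → E₂} {a : E₁}
    (hf : ∀ᶠ x in 𝓝 a, ContDiffAt ℝ ∞ f x) (hinv : (fderiv ℝ f a).IsInvertible) :
    ∃ e : OpenPartialHomeomorph E₁ E₂, a ∈ e.source ∧ ⇑e = f ∧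
      ContDiffOn ℝ ∞ e e.source ∧ ContDiffOn ℝ ∞ e.symm e.target ∧
      ∀ x ∈ e.source, (fderiv ℝ f x).IsInvertible := by
  have hfa := hf.self_of_nhds
  obtain ⟨f', hf'⟩ := hinv
  have hd : HasFDerivAt f (f' : E₁ →L[ℝ] E₂) a := by
    rw [hf']
    exact (hfa.differentiableAt (by simp)).hasFDerivAt
  have hev : ∀ᶠ x in 𝓝 a, (fderiv ℝ f x).IsInvertible := by
    refine ((hfa.fderiv_right (m := 0) (by simp)).continuousAt).eventually_mem
      (ContinuousLinearEquiv.isOpen.mem_nhds ⟨f', hf'⟩)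
  obtain ⟨V, hV, hVo, haV⟩ := eventually_nhds_iff.1 (hf.and hev)
  let e₀ := hfa.toOpenPartialHomeomorph f hd (by simp)
  refine ⟨e₀.restrOpen V hVo, ?_, ?_, ?_, ?_, ?_⟩
  · exact ⟨hfa.mem_toOpenPartialHomeomorph_source hd (by simp), haV⟩
  · rfl
  · intro x hx
    exact (hV x hx.2).1.contDiffWithinAt
  · intro y hy
    have hx := (e₀.restrOpen V hVo).map_target hy
    obtain ⟨g, hg⟩ := (hV _ hx.2).2
    refine (OpenPartialHomeomorph.contDiffAt_symm _ hy (f₀' := g) ?_ ?_).contDiffWithinAt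
    · rw [hg]
      exact ((hV _ hx.2).1.differentiableAt (by simp)).hasFDerivAt
    · exact (hV _ hx.2).1
  · exact fun x hx => (hV x hx.2).2

end ImplicitFunction

/-! ### Total differential equations, solved along rays -/

section ParametrizedODE

variable {E₁ E₂ : Type} [NormedAddCommGroup E₁] [NormedSpace ℝ E₁]
  [NormedAddCommGroup E₂] [NormedSpace ℝ E₂]

variable (E₁ E₂) in
/-- The curve `s ↦ ((s x, γ s), x)` as a function of `(x, γ)`. -/
noncomputable def pathMap : (E₁ × C(I, E₂)) →L[ℝ] C(I, (E₁ × E₂) × E₁) where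
  toFun p := ⟨fun s => (((s : ℝ) • p.1, p.2 s), p.1), by fun_prop⟩
  map_add' p q := by ext s <;> simp
  map_smul' c p := by
    ext s <;> simp
    rw [smul_comm]
  cont := by
    refine ContinuousMap.continuous_of_continuous_uncurry _ ?_
    simp only [Function.uncurry_def, ContinuousMap.coe_mk]
    fun_prop

@[simp]
theorem pathMap_apply (x : E₁) (γ : C(I, E₂)) (s : I) :
    pathMap E₁ E₂ (x, γ) s = (((s : ℝ) • x, γ s), x) := rfl

theorem fderiv_clm_apply_pair {A : E₁ × E₂ → E₁ →L[ℝ] E₂} (hA : ContDiff ℝ ∞ A)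
    (w v : (E₁ × E₂) × E₁) :
    fderiv ℝ (fun w : (E₁ × E₂) × E₁ => A w.1 w.2) w v =
      fderiv ℝ A w.1 v.1 w.2 + A w.1 v.2 := by
  have h1 : HasFDerivAt (fun w : (E₁ × E₂) × E₁ => A w.1)
      (fderiv ℝ A w.1 ∘L .fst ℝ _ _) w :=
    (hA.differentiable (by simp) w.1).hasFDerivAt.comp w hasFDerivAt_fst
  have h2 : HasFDerivAt (fun w : (E₁ × E₂) × E₁ => w.2) (.snd ℝ _ _) w := hasFDerivAt_snd
  rw [(h1.clm_apply h2).fderiv]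
  simp [add_comm]

/-- The integral equation `γ(t) = y + ∫₀ᵗ A(s x, γ(s)) x ds` has, for small `(x, y)`, a solution
depending smoothly on `(x, y)`. -/
theorem exists_contDiffAt_solution [CompleteSpace E₁] [CompleteSpace E₂]
    {A : E₁ × E₂ → E₁ →L[ℝ] E₂} (hA : ContDiff ℝ ∞ A) :
    ∃ Γ : E₁ × E₂ → C(I, E₂), (∀ᶠ z in 𝓝 0, ContDiffAt ℝ ∞ Γ z) ∧ Γ 0 = 0 ∧
      ∀ᶠ z in 𝓝 (0 : E₁ × E₂), Γ z = ContinuousMap.const I z.2 +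
        primitive ((⟨fun w : (E₁ × E₂) × E₁ => A w.1 w.2, by
          have := hA.continuous; fun_prop⟩ : C((E₁ × E₂) × E₁, E₂)).comp
            (pathMap E₁ E₂ (z.1, Γ z))) := by
  set g : C((E₁ × E₂) × E₁, E₂) := ⟨fun w => A w.1 w.2, by have := hA.continuous; fun_prop⟩
    with hgdef
  have hg : ContDiff ℝ ∞ g := by
    change ContDiff ℝ ∞ fun w : (E₁ × E₂) × E₁ => A w.1 w.2
    fun_prop
  let c : E₂ →L[ℝ] C(I, E₂) := ContinuousLinearMap.const ℝ I
  -- The zeros of `H` are exactly the solutions of the integral equation.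
  let H : (E₁ × E₂) × C(I, E₂) → C(I, E₂) := fun p =>
    p.2 - c p.1.2 - primitive (g.comp (pathMap E₁ E₂ (p.1.1, p.2)))
  have hN : ContDiff ℝ ∞ fun γ : C(I, (E₁ × E₂) × E₁) => g.comp γ :=
    contDiff_infty.2 fun n => contDiff_postcomp n g (contDiff_infty.1 hg n)
  have hH : ContDiff ℝ ∞ H := by
    have h1 : ContDiff ℝ ∞ fun p : (E₁ × E₂) × C(I, E₂) => (p.1.1, p.2) := by fun_prop
    have h2 := hN.comp ((pathMap E₁ E₂).contDiff.comp h1)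
    have h3 := (primitive (G := E₂)).contDiff.comp h2 (n := ∞)
    have h4 : ContDiff ℝ ∞ fun p : (E₁ × E₂) × C(I, E₂) => c p.1.2 := by fun_prop
    exact (contDiff_snd.sub h4).sub h3
  -- At `x = 0`, `y = 0` the integrand `A(0, γ) 0` vanishes, so the partial derivative of `H` in `γ`
  -- is the identity and no contraction estimate is needed.
  have hH0 : ∀ γ, H (0, γ) = γ := by
    intro γ
    have : g.comp (pathMap E₁ E₂ (0, γ)) = 0 := by
      ext s
      simp [hgdef]
    simp [H, this]
  have hd : fderiv ℝ H 0 ∘L .inr ℝ (E₁ × E₂) (C(I, E₂)) = ContinuousLinearMap.id ℝ _ := by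
    have h1 : HasFDerivAt (fun γ : C(I, E₂) => H (0, γ))
        (fderiv ℝ H 0 ∘L .inr ℝ (E₁ × E₂) (C(I, E₂))) 0 :=
      HasFDerivAt.comp (g := H) (f := fun γ : C(I, E₂) => ((0 : E₁ × E₂), γ)) 0
        ((hH.differentiable (by simp) _).hasFDerivAt)
        (ContinuousLinearMap.inr ℝ (E₁ × E₂) (C(I, E₂))).hasFDerivAt
    have h2 : HasFDerivAt (fun γ : C(I, E₂) => H (0, γ)) (ContinuousLinearMap.id ℝ _) 0 := by
      simp only [hH0]
      exact hasFDerivAt_id _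
    exact h1.unique h2
  have hinv : (fderiv ℝ H 0 ∘L .inr ℝ (E₁ × E₂) (C(I, E₂))).IsInvertible := by
    rw [hd]
    exact ⟨ContinuousLinearEquiv.refl ℝ _, rfl⟩
  have hHat : ContDiffAt ℝ ∞ H 0 := hH.contDiffAt
  refine ⟨hHat.implicitFunction (by simp) hinv, eventually_contDiffAt_implicitFunction hH 0 hinv,
    hHat.implicitFunction_apply_self (by simp) hinv, ?_⟩
  filter_upwards [hHat.eventually_apply_implicitFunction (by simp) hinv] with z hz
  have h0 : H 0 = 0 := hH0 0
  rw [h0] at hz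
  simp only [H] at hz
  rw [sub_sub, sub_eq_zero] at hz
  exact hz

variable [CompleteSpace E₂]

/-- The derivative of a solution of the total differential equation along the rays with respect
to the end point of the ray, for an integrable right-hand side. -/
theorem linearized_eq {A : E₁ × E₂ → E₁ →L[ℝ] E₂} (hA : ContDiff ℝ ∞ A) (x u : E₁) (y : E₂)
    (γ δ h k : C(I, E₂)) (hγ : γ = ContinuousMap.const I y + primitive k) (hδ : δ = primitive h)
    (hk : ∀ s : I, k s = A ((s : ℝ) • x, γ s) x)
    (hh : ∀ s : I, h s = fderiv ℝ A ((s : ℝ) • x, γ s) ((s : ℝ) • u, δ s) x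
      + A ((s : ℝ) • x, γ s) u)
    (hsymm : ∀ s : I, ∀ u v : E₁,
      fderiv ℝ A ((s : ℝ) • x, γ s) (u, A ((s : ℝ) • x, γ s) u) v =
        fderiv ℝ A ((s : ℝ) • x, γ s) (v, A ((s : ℝ) • x, γ s) v) u) :
    δ 1 = A (x, γ 1) u := by
  set δ' : ℝ → E₂ := fun t => ∫ s in (0 : ℝ)..t, IccExtend zero_le_one h s with hδ'
  set γ' : ℝ → E₂ := fun t => y + ∫ s in (0 : ℝ)..t, IccExtend zero_le_one k s with hγ'
  have hδt : ∀ t : I, δ' t = δ t := fun t => by rw [hδ]; rfl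
  have hγt : ∀ t : I, γ' t = γ t := fun t => by rw [hγ]; rfl
  have dδ : ∀ t, HasDerivAt δ' (IccExtend zero_le_one h t) t := hasDerivAt_primitive h
  have dγ : ∀ t, HasDerivAt γ' (IccExtend zero_le_one k t) t := fun t =>
    (hasDerivAt_primitive k t).const_add y
  have cγ : Continuous γ' := continuous_iff_continuousAt.2 fun t => (dγ t).continuousAt
  -- `w` measures the failure of the total equation at the point `t • x` of the ray; the claim is `w
  -- 1 = 0`. It satisfies `w 0 = 0` and, by the symmetry condition, a linear homogeneous equation,
  -- so Gronwall gives `w = 0`.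
  set w : ℝ → E₂ := fun t => δ' t - t • A (t • x, γ' t) u with hw
  have dw : ∀ t, HasDerivAt w (IccExtend zero_le_one h t -
      (t • fderiv ℝ A (t • x, γ' t) (x, IccExtend zero_le_one k t) u +
        A (t • x, γ' t) u)) t := by
    intro t
    have h1 : HasDerivAt (fun t : ℝ => (t • x, γ' t)) (x, IccExtend zero_le_one k t) t := by
      have := (hasDerivAt_id t).smul_const x
      rw [one_smul] at this
      exact this.prodMk (dγ t)
    have h2 : HasDerivAt (fun t : ℝ => A (t • x, γ' t))
        (fderiv ℝ A (t • x, γ' t) (x, IccExtend zero_le_one k t)) t :=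
      (hA.differentiable (by simp) (t • x, γ' t)).hasFDerivAt.comp_hasDerivAt t h1
    have h3 : HasDerivAt (fun t : ℝ => A (t • x, γ' t) u)
        (fderiv ℝ A (t • x, γ' t) (x, IccExtend zero_le_one k t) u) t := by
      have := h2.clm_apply (hasDerivAt_const t u)
      simpa using this
    have h4 := (hasDerivAt_id t).smul h3
    rw [one_smul] at h4
    exact (dδ t).sub h4
  have dw' : ∀ t ∈ Ico (0 : ℝ) 1, HasDerivWithinAt w
      (fderiv ℝ A (t • x, γ' t) (0, w t) x) (Ici t) t := by
    intro t ht
    have htI : t ∈ I := ⟨ht.1, ht.2.le⟩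
    convert (dw t).hasDerivWithinAt using 1
    rw [IccExtend_of_mem _ _ htI, IccExtend_of_mem _ _ htI, hh, hk]
    simp only
    rw [hγt ⟨t, htI⟩]
    have e1 : w t = δ ⟨t, htI⟩ - t • A (t • x, γ ⟨t, htI⟩) u := by
      rw [hw]
      simp only
      rw [hγt ⟨t, htI⟩, hδt ⟨t, htI⟩]
    -- The subtracted vector is `t` times the lift of `u` to the graph of `A`, the kind of vector in
    -- which `hsymm` allows `x` and `u` to be exchanged.
    have e2 : ((0 : E₁), w t) = (t • u, δ ⟨t, htI⟩) - t • (u, A (t • x, γ ⟨t, htI⟩) u) := by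
      rw [e1]
      ext <;> simp
    have e3 := hsymm ⟨t, htI⟩ x u
    simp only at e3
    rw [e2, map_sub, map_smul, sub_apply, smul_apply, e3]
    abel
  set T : ℝ → E₂ →L[ℝ] E₂ := fun t => ContinuousLinearMap.apply ℝ E₂ x ∘L
    fderiv ℝ A (t • x, γ' t) ∘L .inr ℝ E₁ E₂ with hT
  have cT : Continuous T := by
    have h1 : Continuous fun t => fderiv ℝ A (t • x, γ' t) :=
      (hA.continuous_fderiv (by simp)).comp (by fun_prop)
    exact continuous_const.clm_comp (h1.clm_comp continuous_const)
  obtain ⟨C, hC⟩ := isCompact_Icc.exists_bound_of_continuousOn (s := Icc (0 : ℝ) 1)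
    cT.continuousOn
  have hzero := eq_zero_of_abs_deriv_le_mul_abs_self_of_eq_zero_right (f := w)
    (f' := fun t => fderiv ℝ A (t • x, γ' t) (0, w t) x) (K := C) (a := 0) (b := 1)
    (fun t _ => (dw t).continuousAt.continuousWithinAt) dw' (by simp [hw, hδ'])
    (fun t ht => ((T t).le_opNorm (w t)).trans
      (mul_le_mul_of_nonneg_right (hC t ⟨ht.1, ht.2.le⟩) (norm_nonneg _)))
    1 ⟨zero_le_one, le_rfl⟩
  have h1 := hδt 1
  have h2 := hγt 1
  simp only [Icc.coe_one] at h1 h2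
  rw [hw] at hzero
  simp only [one_smul, h1, h2] at hzero
  exact sub_eq_zero.1 hzero

/-- A smooth solution operator for the total differential equation `dφ = A(x, φ)`. -/
theorem exists_integral_map [CompleteSpace E₁] {A : E₁ × E₂ → E₁ →L[ℝ] E₂} (hA : ContDiff ℝ ∞ A)
    (hsymm : ∀ᶠ z in 𝓝 (0 : E₁ × E₂), ∀ u v : E₁,
      fderiv ℝ A z (u, A z u) v = fderiv ℝ A z (v, A z v) u) :
    ∃ Φ : E₁ × E₂ → E₂, (∀ᶠ z in 𝓝 0, ContDiffAt ℝ ∞ Φ z) ∧ (∀ᶠ y in 𝓝 (0 : E₂), Φ (0, y) = y) ∧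
      ∀ᶠ z in 𝓝 (0 : E₁ × E₂), ∀ u : E₁, fderiv ℝ Φ z (u, 0) = A (z.1, Φ z) u := by
  obtain ⟨Γ, hΓ, hΓ0, heq⟩ := exists_contDiffAt_solution hA
  set g : C((E₁ × E₂) × E₁, E₂) := ⟨fun w => A w.1 w.2, by
    have := hA.continuous; fun_prop⟩ with hgdef
  have hg : ContDiff ℝ ∞ g := by
    change ContDiff ℝ ∞ fun w : (E₁ × E₂) × E₁ => A w.1 w.2
    fun_prop
  let ev : C(I, E₂) →L[ℝ] E₂ := ContinuousMap.evalCLM ℝ 1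
  refine ⟨fun z => ev (Γ z), hΓ.mono fun z hz => ev.contDiff.contDiffAt.comp z hz, ?_, ?_⟩
  · have ht : Tendsto (fun y : E₂ => ((0 : E₁), y)) (𝓝 0) (𝓝 0) := by
      have : Continuous fun y : E₂ => ((0 : E₁), y) := by fun_prop
      exact this.tendsto 0
    filter_upwards [ht.eventually heq] with y hy
    have : g.comp (pathMap E₁ E₂ (0, Γ (0, y))) = 0 := by
      ext s
      simp [hgdef]
    rw [hy, this]
    simp [ev]
  · obtain ⟨r, hr, hball⟩ := Metric.eventually_nhds_iff.1 hsymm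
    have e1 : ∀ᶠ z in 𝓝 (0 : E₁ × E₂), ‖Γ z‖ < r := by
      have := hΓ.self_of_nhds.continuousAt.norm
      rw [ContinuousAt, hΓ0, norm_zero] at this
      exact this.eventually (gt_mem_nhds hr)
    have e2 : ∀ᶠ z in 𝓝 (0 : E₁ × E₂), ‖z.1‖ < r := by
      have : Continuous fun z : E₁ × E₂ => ‖z.1‖ := by fun_prop
      have := this.tendsto 0
      rw [Prod.fst_zero, norm_zero] at this
      exact this.eventually (gt_mem_nhds hr)
    have e3 : ∀ᶠ z in 𝓝 (0 : E₁ × E₂), DifferentiableAt ℝ Γ z :=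
      hΓ.mono fun z hz => hz.differentiableAt (by simp)
    filter_upwards [e1, e2, e3, heq.eventually_nhds] with z h1 h2 h3 h4 u
    set δ := fderiv ℝ Γ z (u, 0) with hδ
    have hev : fderiv ℝ (fun z => ev (Γ z)) z (u, 0) = δ 1 := by
      have : HasFDerivAt (fun z => ev (Γ z)) (ev ∘L fderiv ℝ Γ z) z :=
        ev.hasFDerivAt.comp z h3.hasFDerivAt
      rw [this.fderiv]
      rfl
    let g' : C((E₁ × E₂) × E₁, ((E₁ × E₂) × E₁) →L[ℝ] E₂) :=
      ⟨fderiv ℝ g, hg.continuous_fderiv (by simp)⟩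
    let h : C(I, E₂) := pointwiseApply (ContinuousLinearMap.id ℝ _)
      (g'.comp (pathMap E₁ E₂ (z.1, Γ z))) (pathMap E₁ E₂ (u, δ))
    -- Differentiate the integral equation in the direction `(u, 0)`; the constant term depends only
    -- on `z.2` and drops out.
    have hprim : δ = primitive h := by
      have d1 : HasFDerivAt (fun z : E₁ × E₂ => (z.1, Γ z))
        ((ContinuousLinearMap.fst ℝ E₁ E₂).prod (fderiv ℝ Γ z)) z :=
        hasFDerivAt_fst.prodMk h3.hasFDerivAt
      have d2 : HasFDerivAt (fun z : E₁ × E₂ => pathMap E₁ E₂ (z.1, Γ z)) _ z :=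
        (pathMap E₁ E₂).hasFDerivAt.comp z d1
      have d3 : HasFDerivAt (fun z : E₁ × E₂ => g.comp (pathMap E₁ E₂ (z.1, Γ z))) _ z :=
        HasFDerivAt.comp (g := fun γ : C(I, (E₁ × E₂) × E₁) => g.comp γ) z
          (hasFDerivAt_postcomp g g' (fun x => (hg.differentiable (by simp) x).hasFDerivAt)
            (pathMap E₁ E₂ (z.1, Γ z))) d2
      have d4 : HasFDerivAt (fun z : E₁ × E₂ =>
          primitive (g.comp (pathMap E₁ E₂ (z.1, Γ z)))) _ z :=
        (primitive (G := E₂)).hasFDerivAt.comp z d3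
      have d5 : HasFDerivAt (fun z : E₁ × E₂ => ContinuousMap.const I z.2) _ z :=
        (ContinuousLinearMap.const ℝ I (M := E₂)).hasFDerivAt.comp z hasFDerivAt_snd
      have d6 := (d5.add d4).congr_of_eventuallyEq h4
      rw [hδ, d6.fderiv]
      ext t
      simp [h]
      rfl
    rw [hev]
    refine linearized_eq hA z.1 u z.2 (Γ z) δ h (g.comp (pathMap E₁ E₂ (z.1, Γ z)))
      h4.self_of_nhds hprim (fun s => rfl) (fun s => ?_) (fun s u v => ?_)
    · exact fderiv_clm_apply_pair hA (((s : ℝ) • z.1, Γ z s), z.1) (((s : ℝ) • u, δ s), u)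
    · refine hball ?_ u v
      rw [dist_zero_right, Prod.norm_def]
      refine max_lt ?_ (((Γ z).norm_coe_le_norm s).trans_lt h1)
      simp only [norm_smul, Real.norm_of_nonneg s.2.1]
      exact (mul_le_of_le_one_left (norm_nonneg _) s.2.2).trans_lt h2

end ParametrizedODE

end DiracReduction

namespace DiracReduction

open Filter Topology

/-! ### Frobenius theorem for graphs -/

section Flattening

variable {E₁ E₂ : Type} [NormedAddCommGroup E₁] [InnerProductSpace ℝ E₁] [FiniteDimensional ℝ E₁]
  [NormedAddCommGroup E₂] [InnerProductSpace ℝ E₂] [FiniteDimensional ℝ E₂]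

/-- Cutting off a map which is smooth near `0`. -/
theorem exists_contDiff_eventuallyEq {E F : Type*} [NormedAddCommGroup E] [NormedSpace ℝ E]
    [FiniteDimensional ℝ E] [NormedAddCommGroup F] [NormedSpace ℝ F] {A : E → F} {V : Set E}
    (hV : IsOpen V) (h0 : 0 ∈ V) (hA : ContDiffOn ℝ ∞ A V) :
    ∃ A' : E → F, ContDiff ℝ ∞ A' ∧ A' =ᶠ[𝓝 0] A := by
  obtain ⟨r, hr, hrV⟩ := Metric.isOpen_iff.1 hV 0 h0
  let χ : ContDiffBump (0 : E) := ⟨r / 4, r / 2, by positivity, by linarith⟩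
  refine ⟨fun z => χ z • A z, ?_, ?_⟩
  · refine contMDiff_iff_contDiff.1 (contMDiff_of_tsupport fun z hz => ContDiffAt.contMDiffAt ?_)
    have hz' : z ∈ tsupport χ := tsupport_smul_subset_left _ _ hz
    rw [χ.tsupport_eq] at hz'
    have hzV : z ∈ V := hrV (Metric.closedBall_subset_ball (by change r / 2 < r; linarith) hz')
    exact χ.contDiff.contDiffAt.smul (hA.contDiffAt (hV.mem_nhds hzV))
  · filter_upwards [χ.eventuallyEq_one] with z hz
    simp [hz]

/-- The coordinate change is `Ψ(x, y) = (x, Φ(x, y))`, where `Φ(·, y)` solves `dφ = A(x, φ)` with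
`φ(0) = y`: it carries the slices to integral manifolds. Since `Φ(0, y) = y`, its derivative at `0`
is block triangular with identity diagonal blocks, hence invertible. -/
theorem exists_localFlattening {A : E₁ × E₂ → E₁ →L[ℝ] E₂} {V : Set (E₁ × E₂)} (hV : IsOpen V)
    (h0 : 0 ∈ V) (hA : ContDiffOn ℝ ∞ A V)
    (hsymm : ∀ z ∈ V, ∀ u v : E₁,
      fderiv ℝ A z (u, A z u) v = fderiv ℝ A z (v, A z v) u) :
    ∃ e : OpenPartialHomeomorph (E₁ × E₂) (E₁ × E₂), 0 ∈ e.source ∧ e 0 = 0 ∧ e.target ⊆ V ∧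
      ContDiffOn ℝ ∞ e e.source ∧ ContDiffOn ℝ ∞ e.symm e.target ∧
      ∀ z ∈ e.source, ∀ u : E₁, fderiv ℝ e z (u, 0) = (u, A (e z) u) := by
  -- The solution operator needs a globally smooth right-hand side; only the germ at `0` matters for
  -- the conclusion.
  obtain ⟨A', hA', hAA'⟩ := exists_contDiff_eventuallyEq hV h0 hA
  have hs' : ∀ᶠ z in 𝓝 (0 : E₁ × E₂), ∀ u v : E₁,
      fderiv ℝ A' z (u, A' z u) v = fderiv ℝ A' z (v, A' z v) u := by
    filter_upwards [hAA'.eventuallyEq_nhds, hV.mem_nhds h0] with z hz hzV u v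
    rw [hz.fderiv_eq, hz.self_of_nhds]
    exact hsymm z hzV u v
  obtain ⟨Φ, hΦ, hΦ0, hΦd⟩ := exists_integral_map hA' hs'
  set Ψ : E₁ × E₂ → E₁ × E₂ := fun z => (z.1, Φ z) with hΨ
  have hΨs : ∀ᶠ z in 𝓝 0, ContDiffAt ℝ ∞ Ψ z := hΦ.mono fun z hz => contDiffAt_fst.prodMk hz
  have hΨ0 : Ψ 0 = 0 := by
    have := hΦ0.self_of_nhds
    simp only [hΨ]
    exact Prod.ext rfl this
  have hd : ∀ z, ContDiffAt ℝ ∞ Φ z → ∀ w, fderiv ℝ Ψ z w = (w.1, fderiv ℝ Φ z w) := by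
    intro z hz w
    have : HasFDerivAt Ψ ((ContinuousLinearMap.fst ℝ E₁ E₂).prod (fderiv ℝ Φ z)) z :=
      hasFDerivAt_fst.prodMk (hz.differentiableAt (by simp)).hasFDerivAt
    rw [this.fderiv]
    rfl
  have hd2 : ∀ v : E₂, fderiv ℝ Φ 0 (0, v) = v := by
    intro v
    have h1 : HasFDerivAt (fun y : E₂ => Φ (0, y)) (fderiv ℝ Φ 0 ∘L .inr ℝ E₁ E₂) 0 :=
      HasFDerivAt.comp (g := Φ) (f := fun y : E₂ => ((0 : E₁), y)) 0
        ((hΦ.self_of_nhds.differentiableAt (by simp)).hasFDerivAt)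
        (ContinuousLinearMap.inr ℝ E₁ E₂).hasFDerivAt
    have h2 : HasFDerivAt (fun y : E₂ => Φ (0, y)) (ContinuousLinearMap.id ℝ E₂) 0 :=
      (hasFDerivAt_id (𝕜 := ℝ) (0 : E₂)).congr_of_eventuallyEq hΦ0
    exact congrArg (fun T : E₂ →L[ℝ] E₂ => T v) (h1.unique h2)
  have hinv : (fderiv ℝ Ψ 0).IsInvertible := by
    have hinj : Function.Injective (fderiv ℝ Ψ 0) := by
      rw [injective_iff_map_eq_zero]
      intro w hw
      rw [hd 0 hΦ.self_of_nhds, Prod.mk_eq_zero] at hw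
      obtain ⟨w1, w2⟩ := w
      obtain ⟨rfl, h2⟩ := hw
      rw [hd2] at h2
      rw [h2, Prod.mk_zero_zero]
    exact ⟨(LinearEquiv.ofInjectiveEndo _ hinj).toContinuousLinearEquiv, by ext <;> rfl⟩
  obtain ⟨e, he0, heΨ, hes, het, -⟩ := exists_smooth_localInverse hΨs hinv
  have hg : ∀ᶠ z in 𝓝 (0 : E₁ × E₂), (ContDiffAt ℝ ∞ Φ z ∧
      ∀ u, fderiv ℝ Φ z (u, 0) = A' (z.1, Φ z) u) ∧ A' (Ψ z) = A (Ψ z) ∧ Ψ z ∈ V := by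
    have ht : Tendsto Ψ (𝓝 0) (𝓝 0) := by
      have := hΨs.self_of_nhds.continuousAt
      rwa [ContinuousAt, hΨ0] at this
    exact (hΦ.and hΦd).and ((ht.eventually hAA').and (ht.eventually (hV.mem_nhds h0)))
  obtain ⟨W, hW, hWo, h0W⟩ := eventually_nhds_iff.1 hg
  refine ⟨e.restrOpen W hWo, ⟨he0, h0W⟩, ?_, ?_, ?_, ?_, ?_⟩
  · change e 0 = 0
    rw [heΨ, hΨ0]
  · intro y hy
    have hx := (e.restrOpen W hWo).map_target hy
    rw [← (e.restrOpen W hWo).right_inv hy]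
    change e _ ∈ V
    rw [heΨ]
    exact (hW _ hx.2).2.2
  · exact hes.mono fun x hx => hx.1
  · refine het.mono fun y hy => ?_
    exact hy.1
  · intro z hz u
    change fderiv ℝ e z (u, 0) = (u, A (e z) u)
    obtain ⟨⟨h1, h2⟩, h3, -⟩ := hW z hz.2
    rw [heΨ, hd z h1, h2, ← h3]

/-- **Frobenius theorem**, for the family of subspaces of `E₁ × E₂` which are the graphs of
`A z : E₁ → E₂`: near `0`, the graphs are the tangent spaces of the slices of a coordinate system,
whose domain may be assumed to be the whole of `E₁ × E₂`. -/
theorem exists_flattening {A : E₁ × E₂ → E₁ →L[ℝ] E₂} {V : Set (E₁ × E₂)} (hV : IsOpen V)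
    (h0 : 0 ∈ V) (hA : ContDiffOn ℝ ∞ A V)
    (hsymm : ∀ z ∈ V, ∀ u v : E₁,
      fderiv ℝ A z (u, A z u) v = fderiv ℝ A z (v, A z v) u) :
    ∃ e : OpenPartialHomeomorph (E₁ × E₂) (E₁ × E₂), e.source = univ ∧ e 0 = 0 ∧ e.target ⊆ V ∧
      ContDiff ℝ ∞ e ∧ ContDiffOn ℝ ∞ e.symm e.target ∧
      ∀ w ∈ e.target, ∀ v : E₁ × E₂, v.2 = A w v.1 ↔ (fderiv ℝ e.symm w v).2 = 0 := by
  obtain ⟨e, he0, h00, heV, hes, het, hd⟩ := exists_localFlattening hV h0 hA hsymm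
  obtain ⟨r, hr, hre⟩ := Metric.isOpen_iff.1 e.open_source 0 he0
  -- Diffeomorphisms of the two factors onto balls of radius `r`. Their product has image inside
  -- `e.source` and preserves slices, so precomposing with it makes the domain everything without
  -- spoiling the flattening.
  set β₁ : OpenPartialHomeomorph E₁ E₁ := OpenPartialHomeomorph.univBall (0 : E₁) r with hβ₁
  set β₂ : OpenPartialHomeomorph E₂ E₂ := OpenPartialHomeomorph.univBall (0 : E₂) r with hβ₂
  have hs1 : ContDiff ℝ ∞ β₁ := OpenPartialHomeomorph.contDiff_univBall
  have hs2 : ContDiff ℝ ∞ β₂ := OpenPartialHomeomorph.contDiff_univBall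
  have ht1 : ContDiffOn ℝ ∞ β₁.symm β₁.target := by
    rw [hβ₁, OpenPartialHomeomorph.univBall_target _ hr]
    exact OpenPartialHomeomorph.contDiffOn_univBall_symm
  have ht2 : ContDiffOn ℝ ∞ β₂.symm β₂.target := by
    rw [hβ₂, OpenPartialHomeomorph.univBall_target _ hr]
    exact OpenPartialHomeomorph.contDiffOn_univBall_symm
  have hmem : ∀ z : E₁ × E₂, (β₁ z.1, β₂ z.2) ∈ e.source := by
    intro z
    apply hre
    have m1 : β₁ z.1 ∈ β₁.target := β₁.map_source (by simp [hβ₁])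
    have m2 : β₂ z.2 ∈ β₂.target := β₂.map_source (by simp [hβ₂])
    rw [hβ₁, OpenPartialHomeomorph.univBall_target _ hr, mem_ball_zero_iff] at m1
    rw [hβ₂, OpenPartialHomeomorph.univBall_target _ hr, mem_ball_zero_iff] at m2
    rw [mem_ball_zero_iff, Prod.norm_def]
    exact max_lt m1 m2
  set f : OpenPartialHomeomorph (E₁ × E₂) (E₁ × E₂) := (β₁.prod β₂).trans e with hf
  have hfs : f.source = univ := by
    rw [eq_univ_iff_forall]
    intro z
    refine ⟨by simp [hβ₁, hβ₂], hmem z⟩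
  have hfd : ContDiff ℝ ∞ f := by
    rw [contDiff_iff_contDiffAt]
    intro z
    refine ContDiffAt.comp (g := e) z (hes.contDiffAt (e.open_source.mem_nhds (hmem z))) ?_
    exact (hs1.prodMap hs2).contDiffAt
  have hfs' : ContDiffOn ℝ ∞ f.symm f.target := by
    intro w hw
    refine ContDiffWithinAt.comp (t := β₁.target ×ˢ β₂.target) (g := (β₁.prod β₂).symm) w ?_
      ((het w hw.1).mono fun x hx => hx.1) fun x hx => hx.2
    exact (ht1.prodMap ht2) _ hw.2
  refine ⟨f, hfs, ?_, ?_, hfd, hfs', ?_⟩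
  · change e (β₁ 0, β₂ 0) = 0
    rw [hβ₁, hβ₂]
    simpa using! h00
  · exact fun w hw => heV hw.1
  · have key : ∀ z (u : E₁), fderiv ℝ f z (u, 0) =
        (fderiv ℝ β₁ z.1 u, A (f z) (fderiv ℝ β₁ z.1 u)) := by
      intro z u
      have h1 : HasFDerivAt (fun z : E₁ × E₂ => (β₁ z.1, β₂ z.2))
          ((fderiv ℝ β₁ z.1).prodMap (fderiv ℝ β₂ z.2)) z :=
        HasFDerivAt.prodMap z (hs1.differentiable (by simp) _).hasFDerivAt
          (hs2.differentiable (by simp) _).hasFDerivAt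
      have h2 : HasFDerivAt f _ z := HasFDerivAt.comp (g := e) z
        ((hes.contDiffAt (e.open_source.mem_nhds (hmem z))).differentiableAt
          (by simp)).hasFDerivAt h1
      rw [h2.fderiv]
      simp only [ContinuousLinearMap.comp_apply, ContinuousLinearMap.coe_prodMap', Prod.map_apply,
        map_zero]
      exact hd _ (hmem z) _
    -- Needed so that every vector of the graph, and not only those over the image of `dβ₁`, comes
    -- from a slice direction.
    have hsurj : ∀ x (u : E₁), ∃ u', fderiv ℝ β₁ x u' = u := by
      intro x u
      have hx : β₁ x ∈ β₁.target := β₁.map_source (by simp [hβ₁])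
      have h1 : HasFDerivAt β₁.symm _ (β₁ x) := ((ht1.contDiffAt
        (β₁.open_target.mem_nhds hx)).differentiableAt (by simp)).hasFDerivAt
      have h2 : HasFDerivAt β₁ (fderiv ℝ β₁ (β₁.symm (β₁ x))) (β₁.symm (β₁ x)) :=
        (hs1.differentiable (by simp) _).hasFDerivAt
      have h3 := h2.comp _ h1
      have h4 : β₁ ∘ β₁.symm =ᶠ[𝓝 (β₁ x)] id := β₁.eventually_right_inverse hx
      have h5 := (h3.congr_of_eventuallyEq h4.symm).unique (hasFDerivAt_id _)
      rw [β₁.left_inv (by simp [hβ₁])] at h5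
      exact ⟨_, congrArg (fun T : E₁ →L[ℝ] E₁ => T u) h5⟩
    intro w hw v
    have hz : f.symm w ∈ f.source := f.map_target hw
    have d1 : HasFDerivAt f.symm (fderiv ℝ f.symm w) w := ((hfs'.contDiffAt
        (f.open_target.mem_nhds hw)).differentiableAt (by simp)).hasFDerivAt
    have d2 : HasFDerivAt f (fderiv ℝ f (f.symm w)) (f.symm w) :=
        (hfd.differentiable (by simp) _).hasFDerivAt
    have c1 : fderiv ℝ f (f.symm w) (fderiv ℝ f.symm w v) = v := by
      have h4 : f ∘ f.symm =ᶠ[𝓝 w] id := f.eventually_right_inverse hw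
      exact congrArg (fun T : E₁ × E₂ →L[ℝ] E₁ × E₂ => T v)
        (((d2.comp _ d1).congr_of_eventuallyEq h4.symm).unique (hasFDerivAt_id _))
    have c2 : ∀ v, fderiv ℝ f.symm w (fderiv ℝ f (f.symm w) v) = v := by
      intro v
      have h4 : f.symm ∘ f =ᶠ[𝓝 (f.symm w)] id := f.eventually_left_inverse hz
      have d1' : HasFDerivAt f.symm (fderiv ℝ f.symm w) (f (f.symm w)) := by
        rwa [f.right_inv hw]
      exact congrArg (fun T : E₁ × E₂ →L[ℝ] E₁ × E₂ => T v)
        (((d1'.comp _ d2).congr_of_eventuallyEq h4.symm).unique (hasFDerivAt_id _))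
    constructor
    · intro hv
      obtain ⟨u', hu'⟩ := hsurj (f.symm w).1 v.1
      have h1 := key (f.symm w) u'
      rw [hu', f.right_inv hw, ← hv] at h1
      have h2 := c2 (u', 0)
      rw [h1] at h2
      rw [h2]
    · intro hv
      have h1 := key (f.symm w) (fderiv ℝ f.symm w v).1
      rw [← hv, c1, f.right_inv hw] at h1
      have h2 := congrArg Prod.fst h1
      have h3 := congrArg Prod.snd h1
      simp only at h2 h3
      rw [h3, h2]

end Flattening

end DiracReduction

namespace DiracReduction

open Filter Topology VectorField

/-! ### Lie brackets as commutators of derivations -/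

section VectorFields

variable {n : ℕ} {P : Type*} [TopologicalSpace P] [ChartedSpace (EuclideanSpace ℝ (Fin n)) P]
  {F : Type*} [NormedAddCommGroup F] [NormedSpace ℝ F]

theorem mvfderiv_eq_fderiv {f : P → F} {x : P} (hf : MDifferentiableAt (𝓡 n) 𝓘(ℝ, F) f x)
    (v : Tan n x) : mvfderiv (𝓡 n) f x v =
      fderiv ℝ (f ∘ (extChartAt (𝓡 n) x).symm) (extChartAt (𝓡 n) x x) v := by
  rw [hf.mvfderiv, ModelWithCorners.Boundaryless.range_eq_univ, fderivWithin_univ]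
  rfl

variable [IsManifold (𝓡 n) ∞ P]

/-- `X` is differentiable at `x` as a vector field. -/
abbrev VFieldDiffAt (X : VField n P) (x : P) : Prop :=
  MDifferentiableAt (𝓡 n) ((𝓡 n).prod 𝓘(ℝ, EuclideanSpace ℝ (Fin n)))
    (fun x => TotalSpace.mk' (EuclideanSpace ℝ (Fin n)) (E := fun x : P => Tan n x) x (X x)) x

/-- `ξ` is differentiable at `x` as a one-form. -/
abbrev OneFormDiffAt (ξ : OneForm n P) (x : P) : Prop :=
  MDifferentiableAt (𝓡 n) ((𝓡 n).prod 𝓘(ℝ, EuclideanSpace ℝ (Fin n) →L[ℝ] ℝ))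
    (fun x => TotalSpace.mk' (EuclideanSpace ℝ (Fin n) →L[ℝ] ℝ)
      (E := fun x : P => Cotan n x) x (ξ x)) x

theorem mdifferentiableAt_of_differentiableAt {f : P → F} {x : P}
    (hf : DifferentiableAt ℝ (f ∘ (extChartAt (𝓡 n) x).symm) (extChartAt (𝓡 n) x x)) :
    MDifferentiableAt (𝓡 n) 𝓘(ℝ, F) f x := by
  have h1 : MDifferentiableAt (𝓡 n) 𝓘(ℝ, F)
      ((f ∘ (extChartAt (𝓡 n) x).symm) ∘ extChartAt (𝓡 n) x) x :=
    hf.mdifferentiableAt.comp x (mdifferentiableAt_extChartAt (mem_chart_source _ x))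
  refine h1.congr_of_eventuallyEq ?_
  filter_upwards [extChartAt_source_mem_nhds (I := 𝓡 n) x] with y hy
  simp only [Function.comp_apply, (extChartAt (𝓡 n) x).left_inv hy]

/-- The differentiation operator along `[V, W]` is the commutator of the differentiation operators
along `V` and `W`. -/
theorem mvfderiv_mlieBracket {f : P → F} {x : P} {V W : VField n P}
    (hf : ContMDiffAt (𝓡 n) 𝓘(ℝ, F) 2 f x) (hV : VFieldDiffAt V x) (hW : VFieldDiffAt W x) :
    MDifferentiableAt (𝓡 n) 𝓘(ℝ, F) (fun y => mvfderiv (𝓡 n) f y (V y)) x ∧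
    mvfderiv (𝓡 n) f x (mlieBracket (𝓡 n) V W x) =
      mvfderiv (𝓡 n) (fun y => mvfderiv (𝓡 n) f y (W y)) x (V x) -
        mvfderiv (𝓡 n) (fun y => mvfderiv (𝓡 n) f y (V y)) x (W x) := by
  have h2 : (2 : ℕ∞ω) ≤ ∞ := WithTop.coe_le_coe.2 (le_top : (2 : ℕ∞) ≤ ⊤)
  have : IsManifold (𝓡 n) 2 P := IsManifold.of_le (n := ∞) h2
  set φ := extChartAt (𝓡 n) x with hφ
  set f' : EuclideanSpace ℝ (Fin n) → F := f ∘ φ.symm with hf'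
  have key : ∀ Z : VField n P, VFieldDiffAt Z x →
      ∃ Z' : EuclideanSpace ℝ (Fin n) → EuclideanSpace ℝ (Fin n),
        Z' = mpullbackWithin 𝓘(ℝ, EuclideanSpace ℝ (Fin n)) (𝓡 n) φ.symm Z (range (𝓡 n)) ∧
        DifferentiableAt ℝ Z' (φ x) ∧ Z' (φ x) = Z x ∧
        (fun y => mvfderiv (𝓡 n) f y (Z y)) ∘ φ.symm =ᶠ[𝓝 (φ x)] fun z => fderiv ℝ f' z (Z' z) := by
    intro Z hZ
    refine ⟨_, rfl, ?_, ?_, ?_⟩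
    · have := MDifferentiableWithinAt.differentiableWithinAt_mpullbackWithin_vectorField
        (mdifferentiableWithinAt_univ.2 hZ)
      rw [preimage_univ, univ_inter] at this
      exact this.differentiableAt (by simp)
    -- The tangent space at `x` is identified with the model space through the preferred chart at
    -- `x`, so the inverse chart has identity derivative at the base point.
    · have h1 : mfderivWithin 𝓘(ℝ, EuclideanSpace ℝ (Fin n)) (𝓡 n) φ.symm (range (𝓡 n)) (φ x) =
          ContinuousLinearMap.id ℝ (EuclideanSpace ℝ (Fin n)) := mfderivWithin_range_extChartAt_symm
      rw [mpullbackWithin_apply]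
      let Zc : P → EuclideanSpace ℝ (Fin n) := fun y => Z y
      have aux : ∀ (A : EuclideanSpace ℝ (Fin n) →L[ℝ] EuclideanSpace ℝ (Fin n)) (v),
          A = ContinuousLinearMap.id ℝ _ → A.inverse v = v := by
        rintro _ v rfl
        simp
      exact (aux _ (Zc (φ.symm (φ x))) h1).trans (congrArg Zc (extChartAt_to_inv x))
    · have hc : ContinuousAt φ.symm (φ x) := continuousAt_extChartAt_symm x
      have h1 : ∀ᶠ y in 𝓝 (φ.symm (φ x)), MDifferentiableAt (𝓡 n) 𝓘(ℝ, F) f y := by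
        rw [extChartAt_to_inv]
        exact ((contMDiffAt_iff_contMDiffAt_nhds (by simp)).1 hf).mono fun y hy =>
          hy.mdifferentiableAt (by simp)
      filter_upwards [hc.eventually h1, extChartAt_target_mem_nhds (I := 𝓡 n) x] with z hz hzt
      have h2 : MDifferentiableAt 𝓘(ℝ, EuclideanSpace ℝ (Fin n)) (𝓡 n) φ.symm z := by
        have := mdifferentiableWithinAt_extChartAt_symm (I := 𝓡 n) hzt
        simpa using! this
      have h3 : fderiv ℝ f' z = mvfderiv (𝓡 n) f (φ.symm z) ∘L
          mfderiv 𝓘(ℝ, EuclideanSpace ℝ (Fin n)) (𝓡 n) φ.symm z := by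
        rw [← mfderiv_eq_fderiv]
        exact mfderiv_comp z hz h2
      have h4 := isInvertible_mfderivWithin_extChartAt_symm (I := 𝓡 n) hzt
      rw [mpullbackWithin_apply]
      rw [ModelWithCorners.Boundaryless.range_eq_univ, mfderivWithin_univ] at h4 ⊢
      rw [h3]
      simp only [Function.comp_apply]
      change _ = mvfderiv (𝓡 n) f (φ.symm z) (mfderiv 𝓘(ℝ, EuclideanSpace ℝ (Fin n)) (𝓡 n) φ.symm z
        _)
      rw [h4.self_apply_inverse]
  obtain ⟨V', hV', dV, V0, eV⟩ := key V hV
  obtain ⟨W', hW', dW, W0, eW⟩ := key W hW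
  have hf2 : ContDiffAt ℝ 2 f' (φ x) := by
    have := (contMDiffAt_iff.1 hf).2
    simpa using! this
  have hdd : ∀ Z', DifferentiableAt ℝ Z' (φ x) →
      DifferentiableAt ℝ (fun z => fderiv ℝ f' z (Z' z)) (φ x) := fun Z' hZ' =>
    ((hf2.fderiv_right (m := 1) (by norm_num)).differentiableAt (by norm_num)).clm_apply hZ'
  have mV := mdifferentiableAt_of_differentiableAt ((hdd V' dV).congr_of_eventuallyEq eV)
  have mW := mdifferentiableAt_of_differentiableAt ((hdd W' dW).congr_of_eventuallyEq eW)
  refine ⟨mV, ?_⟩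
  rw [mvfderiv_eq_fderiv (hf.mdifferentiableAt (by norm_num)), mvfderiv_eq_fderiv mV,
    mvfderiv_eq_fderiv mW, eV.fderiv_eq, eW.fderiv_eq]
  have hb : mlieBracket (𝓡 n) V W x = lieBracket ℝ V' W' (φ x) := by
    rw [← mlieBracketWithin_univ, mlieBracketWithin_apply, ← hV', ← hW', preimage_univ, univ_inter,
      ModelWithCorners.Boundaryless.range_eq_univ, lieBracketWithin_univ]
    have h1 : mfderiv (𝓡 n) 𝓘(ℝ, EuclideanSpace ℝ (Fin n)) (extChartAt (𝓡 n) x) x =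
        ContinuousLinearMap.id ℝ (EuclideanSpace ℝ (Fin n)) := mfderiv_extChartAt_self
    rw [h1]
    exact congrArg (fun T : EuclideanSpace ℝ (Fin n) →L[ℝ] EuclideanSpace ℝ (Fin n) => T _)
      ContinuousLinearMap.inverse_id
  rw [hb]
  have := fderiv_apply_lieBracket hf2 (by simp) dW dV
  rw [W0, V0] at this
  exact this

end VectorFields

end DiracReduction

namespace DiracReduction

open Filter Topology VectorField

/-! ### Smoothness of differentials and pairings -/

section Smoothness

variable {n : ℕ} {P : Type*} [TopologicalSpace P] [ChartedSpace (EuclideanSpace ℝ (Fin n)) P]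
  [IsManifold (𝓡 n) ∞ P] {F : Type*} [NormedAddCommGroup F] [NormedSpace ℝ F]

/-- `X` is smooth at `x` as a vector field. -/
abbrev VFieldSmoothAt (X : VField n P) (x : P) : Prop :=
  ContMDiffAt (𝓡 n) ((𝓡 n).prod 𝓘(ℝ, EuclideanSpace ℝ (Fin n))) ∞
    (fun x => TotalSpace.mk' (EuclideanSpace ℝ (Fin n)) (E := fun x : P => Tan n x) x (X x)) x

/-- `ξ` is smooth at `x` as a one-form. -/
abbrev OneFormSmoothAt (ξ : OneForm n P) (x : P) : Prop :=
  ContMDiffAt (𝓡 n) ((𝓡 n).prod 𝓘(ℝ, EuclideanSpace ℝ (Fin n) →L[ℝ] ℝ)) ∞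
    (fun x => TotalSpace.mk' (EuclideanSpace ℝ (Fin n) →L[ℝ] ℝ)
      (E := fun x : P => Cotan n x) x (ξ x)) x

theorem contMDiffAt_mvfderiv {f : P → F} {x : P} (hf : ContMDiffAt (𝓡 n) 𝓘(ℝ, F) ∞ f x) :
    ContMDiffAt (𝓡 n) ((𝓡 n).prod 𝓘(ℝ, EuclideanSpace ℝ (Fin n) →L[ℝ] F)) ∞
      (fun x => TotalSpace.mk' (EuclideanSpace ℝ (Fin n) →L[ℝ] F)
        (E := fun x : P => Tan n x →L[ℝ] Trivial P F x) x (mvfderiv (𝓡 n) f x)) x := by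
  -- Differentiation costs one order, and `∞ + 1 = ∞`.
  have : IsManifold (𝓡 n) (∞ + 1) P := ‹IsManifold (𝓡 n) ∞ P›
  rw [contMDiffAt_hom_bundle]
  refine ⟨contMDiffAt_id, ?_⟩
  convert! ContMDiffAt.mfderiv_const (m := ∞) hf le_rfl using 1
  ext y
  simp [inTangentCoordinates, ContinuousLinearMap.inCoordinates]
  rfl

theorem contMDiffAt_mvfderiv_apply {f : P → F} {x : P} {X : VField n P}
    (hf : ContMDiffAt (𝓡 n) 𝓘(ℝ, F) ∞ f x) (hX : VFieldSmoothAt X x) :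
    ContMDiffAt (𝓡 n) 𝓘(ℝ, F) ∞ (fun y => mvfderiv (𝓡 n) f y (X y)) x := by
  have := ContMDiffAt.clm_bundle_apply (E₂ := Trivial P F) (F₂ := F) (v := X) (b := id)
    (contMDiffAt_mvfderiv hf) hX
  exact (contMDiffAt_section (F := F) (E := Trivial P F) (IB := 𝓡 n) _).1 this

theorem oneFormSmoothAt_diff {f : P → ℝ} {x : P} (hf : ContMDiffAt (𝓡 n) 𝓘(ℝ, ℝ) ∞ f x) :
    OneFormSmoothAt (diff (n := n) f) x := contMDiffAt_mvfderiv hf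

theorem OneFormSmoothAt.diffAt {ξ : OneForm n P} {x : P} (h : OneFormSmoothAt ξ x) :
    OneFormDiffAt ξ x := h.mdifferentiableAt (by simp)

theorem VFieldSmoothAt.diffAt {X : VField n P} {x : P} (h : VFieldSmoothAt X x) :
    VFieldDiffAt X x := h.mdifferentiableAt (by simp)

theorem OneFormDiffAt.pairing {ξ : OneForm n P} {Y : VField n P} {x : P} (hξ : OneFormDiffAt ξ x)
    (hY : VFieldDiffAt Y x) : MDifferentiableAt (𝓡 n) 𝓘(ℝ, ℝ) (pairing ξ Y) x := by
  have := MDifferentiableAt.clm_bundle_apply (E₂ := Trivial P ℝ) (F₂ := ℝ) (v := Y) (b := id)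
    (ϕ := ξ) hξ hY
  exact (mdifferentiableAt_section (F := ℝ) (E := Trivial P ℝ) (IB := 𝓡 n)
    (s := DiracReduction.pairing ξ Y)).1 this

end Smoothness

/-! ### The tensorial part of the cotangent bracket -/

namespace PoissonStructure

variable {n : ℕ} {P : Type*} [TopologicalSpace P] [ChartedSpace (EuclideanSpace ℝ (Fin n)) P]
  [IsManifold (𝓡 n) ∞ P] (πP : PoissonStructure n P)

theorem anchor_smoothAt {ξ : OneForm n P} {x : P} (hξ : OneFormSmoothAt ξ x) :
    VFieldSmoothAt (πP.anchor ξ) x :=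
  ContMDiffAt.clm_bundle_apply (v := ξ) (b := id) (ϕ := πP.sharp) (πP.smooth x) hξ

theorem anchor_diffAt {ξ : OneForm n P} {x : P} (hξ : OneFormDiffAt ξ x) :
    VFieldDiffAt (πP.anchor ξ) x :=
  MDifferentiableAt.clm_bundle_apply (v := ξ) (b := id) (ϕ := πP.sharp)
    ((πP.smooth x).mdifferentiableAt (by simp)) hξ

theorem bracket_smoothAt {f g : P → ℝ} {x : P} (hf : ContMDiffAt (𝓡 n) 𝓘(ℝ, ℝ) ∞ f x)
    (hg : ContMDiffAt (𝓡 n) 𝓘(ℝ, ℝ) ∞ g x) : ContMDiffAt (𝓡 n) 𝓘(ℝ, ℝ) ∞ (πP.bracket f g) x :=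
  contMDiffAt_mvfderiv_apply hg (πP.anchor_smoothAt (oneFormSmoothAt_diff hf))

theorem bracket_swap (f g : P → ℝ) : πP.bracket g f = -πP.bracket f g := by
  ext x
  exact πP.skew x _ _

theorem pairing_anchor_swap (ξ η : OneForm n P) :
    pairing ξ (πP.anchor η) = -pairing η (πP.anchor ξ) := by
  ext x
  exact πP.skew x _ _

/-- The expression `-(L_Y π)(ξ, η)`. It is the part of `⟨[ξ, η], Y⟩` which is tensorial in `ξ` and
in `η`. -/
noncomputable def cob (ξ η : OneForm n P) (Y : VField n P) (x : P) : ℝ :=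
  ξ x (mlieBracket (𝓡 n) (πP.anchor η) Y x) - η x (mlieBracket (𝓡 n) (πP.anchor ξ) Y x)
    - diff (pairing η (πP.anchor ξ)) x (Y x)

theorem cob_swap (ξ η : OneForm n P) (Y : VField n P) (x : P) :
    πP.cob ξ η Y x = -πP.cob η ξ Y x := by
  simp only [cob, πP.pairing_anchor_swap ξ η, diff]
  rw [mvfderiv_neg]
  simp
  ring

/-- Isolates the tensorial part: the last two terms vanish as soon as `ξ` and `η` annihilate `Y`
near `x`, so for `D^⊥` paired with `D` only `cob` remains. -/
theorem formBracket_apply {ξ η : OneForm n P} {Y : VField n P} {x : P} (hξ : OneFormDiffAt ξ x)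
    (hη : OneFormDiffAt η x) (hY : VFieldDiffAt Y x) :
    πP.formBracket ξ η x (Y x) = πP.cob ξ η Y x + diff (pairing η Y) x (πP.sharp x (ξ x))
      - diff (pairing ξ Y) x (πP.sharp x (η x)) := by
  simp only [formBracket, cob]
  rw [sub_apply, sub_apply, lieDerivForm_apply _ _ _ _ hY hη, lieDerivForm_apply _ _ _ _ hY hξ]
  simp only [anchor]
  ring

/-- Replacing `ξ` by `f ξ` creates two derivative terms, `(Y f) π(ξ, η)` from the Lie bracket `[f
π♯ξ, Y]` and its negative from the last summand; they cancel. -/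
theorem cob_tensorial_left {η : OneForm n P} {Y : VField n P} {x : P}
    (hη : OneFormDiffAt η x) :
    TensorialAt (𝓡 n) (EuclideanSpace ℝ (Fin n) →L[ℝ] ℝ) (V := fun x : P => Cotan n x)
      (fun ξ : OneForm n P => πP.cob ξ η Y x) x := by
  constructor
  · intro f ξ hf hξ
    have hX := πP.anchor_diffAt hξ
    have h1 : πP.anchor (f • ξ) = f • πP.anchor ξ := by
      ext1 y
      simp [anchor]
    have h2 : pairing η (f • πP.anchor ξ) = f • pairing η (πP.anchor ξ) := by
      ext y
      simp [pairing]
    simp only [cob, h1, h2, diff]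
    rw [mlieBracket_smul_left hf hX, mvfderiv_smul hf (hη.pairing hX)]
    simp [pairing, mvfderiv]
    ring
  · intro ξ ξ' hξ hξ'
    have hX := πP.anchor_diffAt hξ
    have hX' := πP.anchor_diffAt hξ'
    have h1 : πP.anchor (ξ + ξ') = πP.anchor ξ + πP.anchor ξ' := by
      ext1 y
      simp [anchor]
    have h2 : pairing η (πP.anchor ξ + πP.anchor ξ') =
        pairing η (πP.anchor ξ) + pairing η (πP.anchor ξ') := by
      ext y
      simp [pairing]
    simp only [cob, h1, h2, diff]
    rw [mlieBracket_add_left hX hX', mvfderiv_add (hη.pairing hX) (hη.pairing hX')]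
    simp
    ring

theorem cob_tensorial_right {ξ : OneForm n P} {Y : VField n P} {x : P}
    (hξ : OneFormDiffAt ξ x) :
    TensorialAt (𝓡 n) (EuclideanSpace ℝ (Fin n) →L[ℝ] ℝ) (V := fun x : P => Cotan n x)
      (fun η : OneForm n P => πP.cob ξ η Y x) x := by
  have h := πP.cob_tensorial_left (Y := Y) hξ
  constructor
  · intro f η hf hη
    simp only [πP.cob_swap ξ]
    rw [h.smul hf hη, smul_neg]
  · intro η η' hη hη'
    simp only [πP.cob_swap ξ]
    rw [h.add hη hη', neg_add]

/-- Each Lie bracket, applied to `f` or `g`, is a commutator of derivations and contributes one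
`Y{f, g}`; the last summand of `cob` removes one of the two. If `f` and `g` are constant along `D`
and `Y` lies in `D`, only `Y{f, g}` survives, which links the Dirac condition to brackets of
functions. -/
theorem cob_diff {f g : P → ℝ} {Y : VField n P} {x : P}
    (hf : ContMDiffAt (𝓡 n) 𝓘(ℝ, ℝ) ∞ f x) (hg : ContMDiffAt (𝓡 n) 𝓘(ℝ, ℝ) ∞ g x)
    (hY : VFieldDiffAt Y x) :
    πP.cob (diff f) (diff g) Y x = diff (πP.bracket f g) x (Y x)
      - diff (fun y => diff g y (Y y)) x (πP.sharp x (diff f x))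
      + diff (fun y => diff f y (Y y)) x (πP.sharp x (diff g x)) := by
  have h2 : (2 : ℕ∞ω) ≤ ∞ := WithTop.coe_le_coe.2 (le_top : (2 : ℕ∞) ≤ ⊤)
  have hXf := (πP.anchor_smoothAt (oneFormSmoothAt_diff hf)).diffAt
  have hXg := (πP.anchor_smoothAt (oneFormSmoothAt_diff hg)).diffAt
  have e1 := (mvfderiv_mlieBracket (hf.of_le h2) hXg hY).2
  have e2 := (mvfderiv_mlieBracket (hg.of_le h2) hXf hY).2
  have e3 : (fun y => mvfderiv (𝓡 n) f y (πP.anchor (diff g) y)) = -πP.bracket f g :=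
    πP.bracket_swap f g
  have e4 : (fun y => mvfderiv (𝓡 n) g y (πP.anchor (diff f) y)) = πP.bracket f g := rfl
  have e5 : pairing (diff g) (πP.anchor (diff f)) = πP.bracket f g := rfl
  rw [e3, mvfderiv_neg] at e1
  rw [e4] at e2
  rw [cob, e5]
  simp only [diff] at *
  rw [e1, e2]
  simp only [anchor, neg_apply]
  ring

end PoissonStructure

end DiracReduction

namespace DiracReduction

open Filter Topology VectorField

/-! ### Locality of the operations, and their values on zero sections -/

section Germs

variable {n : ℕ} {P : Type*} [TopologicalSpace P] [ChartedSpace (EuclideanSpace ℝ (Fin n)) P]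

theorem diff_congr {f g : P → ℝ} {x : P} (h : f =ᶠ[𝓝 x] g) :
    (diff f x : Cotan n x) = diff g x := by
  have h1 := h.mfderiv_eq (I := 𝓡 n) (I' := 𝓘(ℝ, ℝ))
  simp only [diff, mvfderiv]
  rw [h1]
  rfl

theorem diff_zero (x : P) : (diff 0 x : Cotan n x) = 0 :=
  mvfderiv_const 0

theorem mlieBracket_congr {X X' Y Y' : VField n P} {x : P} (hX : ∀ᶠ y in 𝓝 x, X y = X' y)
    (hY : ∀ᶠ y in 𝓝 x, Y y = Y' y) : mlieBracket (𝓡 n) X Y x = mlieBracket (𝓡 n) X' Y' x :=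
  EventuallyEq.mlieBracket_vectorField_eq hX hY

variable [IsManifold (𝓡 n) ∞ P]

theorem lieDerivForm_congr {X X' : VField n P} {ξ ξ' : OneForm n P} {x : P}
    (hX : ∀ᶠ y in 𝓝 x, X y = X' y) (hξ : ∀ᶠ y in 𝓝 x, ξ y = ξ' y) :
    lieDerivForm X ξ x = lieDerivForm X' ξ' x := by
  unfold lieDerivForm
  congr 1
  ext v
  have h1 : pairing ξ (extendTan v) =ᶠ[𝓝 x] pairing ξ' (extendTan v) := by
    filter_upwards [hξ] with y hy
    simp [pairing, hy]
  rw [diff_congr h1, hX.self_of_nhds, hξ.self_of_nhds,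
    mlieBracket_congr hX (.of_forall fun _ => rfl)]

theorem lieDerivForm_zero_left (ξ : OneForm n P) : lieDerivForm 0 ξ = 0 := by
  ext1 x
  simp [lieDerivForm, toCovector]

theorem lieDerivForm_zero_right (X : VField n P) : lieDerivForm X 0 = 0 := by
  ext1 x
  have : ∀ Y : VField n P, pairing 0 Y = 0 := fun Y => by ext; simp [pairing]
  simp [lieDerivForm, toCovector, this, -mvfderiv_zero, diff_zero]

namespace PoissonStructure

variable (πP : PoissonStructure n P)

theorem formBracket_congr {ξ ξ' η η' : OneForm n P} {x : P} (hξ : ∀ᶠ y in 𝓝 x, ξ y = ξ' y)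
    (hη : ∀ᶠ y in 𝓝 x, η y = η' y) : πP.formBracket ξ η x = πP.formBracket ξ' η' x := by
  have h1 : ∀ᶠ y in 𝓝 x, πP.anchor ξ y = πP.anchor ξ' y := by
    filter_upwards [hξ] with y hy
    simp [anchor, hy]
  have h2 : ∀ᶠ y in 𝓝 x, πP.anchor η y = πP.anchor η' y := by
    filter_upwards [hη] with y hy
    simp [anchor, hy]
  have h3 : pairing η (πP.anchor ξ) =ᶠ[𝓝 x] pairing η' (πP.anchor ξ') := by
    filter_upwards [h1, hη] with y hy hy'
    simp [pairing, hy, hy']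
  simp only [formBracket]
  rw [lieDerivForm_congr h1 hη, lieDerivForm_congr h2 hξ, diff_congr h3]

theorem anchor_zero : πP.anchor 0 = 0 := by
  ext1 x
  simp [anchor]

theorem formBracket_zero_left (η : OneForm n P) : πP.formBracket 0 η = 0 := by
  ext1 x
  have : pairing η 0 = 0 := by ext; simp [pairing]
  simp [formBracket, anchor_zero, lieDerivForm_zero_left, lieDerivForm_zero_right, this]

theorem lieDerivVField_zero_left (X : VField n P) : πP.lieDerivVField 0 X = 0 := by
  ext1 x
  simp [lieDerivVField, formBracket_zero_left, toVector]

theorem dStar_zero : πP.dStar 0 = 0 := by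
  ext1 x
  simp [dStar, toVector]

end PoissonStructure

end Germs

/-! ### From local to global sections, and what the Dirac condition says locally -/

section Extension

variable {n : ℕ} {P : Type*} [TopologicalSpace P] [ChartedSpace (EuclideanSpace ℝ (Fin n)) P]
  [IsManifold (𝓡 n) ∞ P] [T2Space P]

theorem exists_bump {U : Set P} (hU : IsOpen U) {x : P} (hx : x ∈ U) :
    ∃ χ : P → ℝ, ContMDiff (𝓡 n) 𝓘(ℝ, ℝ) ∞ χ ∧ tsupport χ ⊆ U ∧ χ =ᶠ[𝓝 x] 1 := by
  obtain ⟨χ, -, hχ⟩ := (SmoothBumpFunction.nhds_basis_tsupport (I := 𝓡 n) x).mem_iff.1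
    (hU.mem_nhds hx)
  exact ⟨χ, χ.contMDiff, hχ, χ.eventuallyEq_one⟩

theorem exists_global_function {U : Set P} (hU : IsOpen U) {x : P} (hx : x ∈ U) {f : P → ℝ}
    (hf : ContMDiffOn (𝓡 n) 𝓘(ℝ, ℝ) ∞ f U) :
    ∃ g : P → ℝ, ContMDiff (𝓡 n) 𝓘(ℝ, ℝ) ∞ g ∧ g =ᶠ[𝓝 x] f := by
  obtain ⟨χ, h1, h2, h3⟩ := exists_bump (n := n) hU hx
  refine ⟨fun y => χ y • f y, contMDiff_of_tsupport fun y hy => ?_, ?_⟩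
  · have hyU : y ∈ U := h2 (tsupport_smul_subset_left _ _ hy)
    exact h1.contMDiffAt.smul (hf.contMDiffAt (hU.mem_nhds hyU))
  · filter_upwards [h3] with y hy
    simp [hy]

/-- Multiplication by a bump function keeps a field in `D`, fibrewise by linearity inside `U` and
because it vanishes outside. This bridges the Dirac condition, which concerns global sections, and
local frames. -/
theorem exists_global_vField {U : Set P} (hU : IsOpen U) {x : P} (hx : x ∈ U) {X : VField n P}
    (hX : SmoothVFieldOn U X) {D : ∀ x : P, Submodule ℝ (Tan n x)} (hXD : ∀ y ∈ U, X y ∈ D y) :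
    ∃ X' : VField n P, SmoothVFieldOn univ X' ∧ (∀ y, X' y ∈ D y) ∧ ∀ᶠ y in 𝓝 x, X' y = X y := by
  obtain ⟨χ, h1, h2, h3⟩ := exists_bump (n := n) hU hx
  refine ⟨χ • X, (ContMDiffOn.smul_section_of_tsupport h1.contMDiffOn hU h2 hX).contMDiffOn,
    fun y => ?_, ?_⟩
  · by_cases hy : y ∈ U
    · exact (D y).smul_mem _ (hXD y hy)
    · have : χ y = 0 := image_eq_zero_of_notMem_tsupport fun h => hy (h2 h)
      simp [this]
  · filter_upwards [h3] with y hy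
    simp [hy]

theorem exists_global_oneForm {U : Set P} (hU : IsOpen U) {x : P} (hx : x ∈ U) {ξ : OneForm n P}
    (hξ : SmoothOneFormOn U ξ) {A : ∀ x : P, Submodule ℝ (Cotan n x)} (hξA : ∀ y ∈ U, ξ y ∈ A y) :
    ∃ ξ' : OneForm n P, SmoothOneFormOn univ ξ' ∧ (∀ y, ξ' y ∈ A y) ∧ ∀ᶠ y in 𝓝 x, ξ' y = ξ y := by
  obtain ⟨χ, h1, h2, h3⟩ := exists_bump (n := n) hU hx
  refine ⟨χ • ξ, (ContMDiffOn.smul_section_of_tsupport (V := fun x : P => Cotan n x)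
    h1.contMDiffOn hU h2 hξ).contMDiffOn, fun y => ?_, ?_⟩
  · by_cases hy : y ∈ U
    · exact (A y).smul_mem _ (hξA y hy)
    · have : χ y = 0 := image_eq_zero_of_notMem_tsupport fun h => hy (h2 h)
      simp [this]
  · filter_upwards [h3] with y hy
    simp [hy]

variable {πP : PoissonStructure n P} {D : ∀ x : P, Submodule ℝ (Tan n x)}

/-- Closure is applied to the sections `(X, 0)` and `(Y, 0)`, cut off to be global: every term of
the tangent component except the Lie bracket vanishes. -/
theorem IsDirac.mlieBracket_mem (h : IsDirac πP (nullBundle D)) {U : Set P} (hU : IsOpen U) {x : P}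
    (hx : x ∈ U) {X Y : VField n P} (hX : SmoothVFieldOn U X) (hY : SmoothVFieldOn U Y)
    (hXD : ∀ y ∈ U, X y ∈ D y) (hYD : ∀ y ∈ U, Y y ∈ D y) : mlieBracket (𝓡 n) X Y x ∈ D x := by
  obtain ⟨X', h1, h2, h3⟩ := exists_global_vField hU hx hX hXD
  obtain ⟨Y', h1', h2', h3'⟩ := exists_global_vField hU hx hY hYD
  have h0 : SmoothOneFormOn univ (0 : OneForm n P) :=
    contMDiffOn_univ.2 (contMDiff_zeroSection ℝ fun x : P => Cotan n x)
  have := (h.integrable (fun y => (X' y, 0)) (fun y => (Y' y, 0)) ⟨h1, h0⟩ ⟨h1', h0⟩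
    (fun y => ⟨h2 y, Submodule.zero_mem _⟩) (fun y => ⟨h2' y, Submodule.zero_mem _⟩) x).1
  have hm : minusPairing (fun y => (X' y, 0)) (fun y => (Y' y, 0)) = (0 : P → ℝ) := by
    ext
    simp [minusPairing]
  have hz := fun Z => congrFun (πP.lieDerivVField_zero_left Z) x
  have hz' := congrFun πP.dStar_zero x
  simp only [Pi.zero_def] at hz hz' hm
  simp only [courantBracket, hz, hz', hm] at this
  rw [← mlieBracket_congr h3 h3']
  simpa using this

/-- Dually, closure is applied to `(0, ξ)` and `(0, η)`, whose Courant bracket has cotangent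
component `[ξ, η]`. -/
theorem IsDirac.formBracket_mem (h : IsDirac πP (nullBundle D)) {U : Set P} (hU : IsOpen U) {x : P}
    (hx : x ∈ U) {ξ η : OneForm n P} (hξ : SmoothOneFormOn U ξ) (hη : SmoothOneFormOn U η)
    (hξD : ∀ y ∈ U, ξ y ∈ annihilator D y) (hηD : ∀ y ∈ U, η y ∈ annihilator D y) :
    πP.formBracket ξ η x ∈ annihilator D x := by
  obtain ⟨ξ', h1, h2, h3⟩ := exists_global_oneForm hU hx hξ hξD
  obtain ⟨η', h1', h2', h3'⟩ := exists_global_oneForm hU hx hη hηD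
  have h0 : SmoothVFieldOn univ (0 : VField n P) :=
    contMDiffOn_univ.2 (contMDiff_zeroSection ℝ fun x : P => Tan n x)
  have := (h.integrable (fun y => (0, ξ' y)) (fun y => (0, η' y)) ⟨h0, h1⟩ ⟨h0, h1'⟩
    (fun y => ⟨Submodule.zero_mem _, h2 y⟩) (fun y => ⟨Submodule.zero_mem _, h2' y⟩) x).2
  have hm : minusPairing (fun y => (0, ξ' y)) (fun y => (0, η' y)) = (0 : P → ℝ) := by
    ext
    simp [minusPairing]
  have hz := fun ζ : OneForm n P => congrFun (lieDerivForm_zero_left ζ) x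
  have hz' := diff_zero (n := n) x
  simp only [Pi.zero_def] at hz hz' hm
  simp only [courantBracket, hz, hz', hm] at this
  rw [← πP.formBracket_congr h3 h3']
  simpa using this

end Extension

end DiracReduction

/-! ### Charts adapted to independent tangent vectors -/

namespace DiracReduction

open Filter Topology VectorField

/-- Let `f` send the standard basis to `w` and let `g` be a left inverse of `f`. Then the space is
`range f ⊕ ker g`, and the equivalence is `v ↦ (g v, v - f (g v))` with `ker g` identified with a
Euclidean space. -/
theorem exists_linearEquiv_prod {n k : ℕ} {w : Fin k → EuclideanSpace ℝ (Fin n)}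
    (hw : LinearIndependent ℝ w) :
    ∃ (m : ℕ) (ℓ : EuclideanSpace ℝ (Fin n) ≃L[ℝ]
      EuclideanSpace ℝ (Fin k) × EuclideanSpace ℝ (Fin m)),
      ∀ i, ℓ (w i) = (EuclideanSpace.single i 1, 0) := by
  let b := (EuclideanSpace.basisFun (Fin k) ℝ).toBasis
  let f : EuclideanSpace ℝ (Fin k) →ₗ[ℝ] EuclideanSpace ℝ (Fin n) := b.constr ℝ w
  have hfw : ∀ i, f (EuclideanSpace.single i 1) = w i := fun i => by
    have := b.constr_basis ℝ w i
    rwa [show b i = EuclideanSpace.single i 1 by simp [b]] at this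
  have hf : f.ker = ⊥ := by
    refine LinearMap.ker_eq_bot'.2 fun c hc => ?_
    rw [b.constr_apply_fintype (S := ℝ)] at hc
    exact b.equivFun.map_eq_zero_iff.1 (funext (Fintype.linearIndependent_iff.1 hw _ hc))
  obtain ⟨g, hg⟩ := f.exists_leftInverse_of_injective hf
  have hgf : ∀ c, g (f c) = c := fun c => LinearMap.congr_fun hg c
  let ψ : g.ker ≃ₗ[ℝ] EuclideanSpace ℝ (Fin (Module.finrank ℝ g.ker)) :=
    LinearEquiv.ofFinrankEq _ _ (by simp)
  let r : EuclideanSpace ℝ (Fin n) →ₗ[ℝ] g.ker :=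
    (LinearMap.id - f ∘ₗ g).codRestrict g.ker fun v => by simp [hgf]
  let ℓ : EuclideanSpace ℝ (Fin n) ≃ₗ[ℝ]
      EuclideanSpace ℝ (Fin k) × EuclideanSpace ℝ (Fin (Module.finrank ℝ g.ker)) :=
    { (g.prod (ψ.toLinearMap ∘ₗ r)) with
      invFun := fun z => f z.1 + ψ.symm z.2
      left_inv := fun v => by simp [r]
      right_inv := fun z => by
        have h1 : g (ψ.symm z.2 : EuclideanSpace ℝ (Fin n)) = 0 := (ψ.symm z.2).2
        have h2 : r (f z.1 + ψ.symm z.2) = ψ.symm z.2 := by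
          ext1
          simp [r, hgf, h1]
        ext1
        · simp [hgf, h1]
        · simp [h2] }
  refine ⟨_, ℓ.toContinuousLinearEquiv, fun i => ?_⟩
  have h1 : r (w i) = 0 := by
    ext1
    simp [r, ← hfw, hgf]
  change (g (w i), ψ (r (w i))) = _
  rw [h1, ← hfw, hgf, map_zero]

section Manifold

variable {n : ℕ} {P : Type*} [TopologicalSpace P] [ChartedSpace (EuclideanSpace ℝ (Fin n)) P]
  {F G : Type*} [NormedAddCommGroup F] [NormedSpace ℝ F] [NormedAddCommGroup G] [NormedSpace ℝ G]

theorem mvfderiv_fderiv_comp {f : P → F} {g : F → G} {x : P}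
    (hg : DifferentiableAt ℝ g (f x)) (hf : MDifferentiableAt (𝓡 n) 𝓘(ℝ, F) f x) (v : Tan n x) :
    mvfderiv (𝓡 n) (g ∘ f) x v = fderiv ℝ g (f x) (mvfderiv (𝓡 n) f x v) := by
  have := mfderiv_comp x (g := g) hg.mdifferentiableAt hf
  rw [mfderiv_eq_fderiv] at this
  exact DFunLike.congr_fun this v

variable [IsManifold (𝓡 n) ∞ P]

theorem exists_adapted_chart (x₀ : P) {k : ℕ} {w : Fin k → Tan n x₀}
    (hw : LinearIndependent ℝ w) :
    ∃ (m : ℕ) (q : OpenPartialHomeomorph P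
      (EuclideanSpace ℝ (Fin k) × EuclideanSpace ℝ (Fin m))),
      x₀ ∈ q.source ∧ q x₀ = 0 ∧
      ContMDiffOn (𝓡 n) 𝓘(ℝ, EuclideanSpace ℝ (Fin k) × EuclideanSpace ℝ (Fin m)) ∞ q q.source ∧
      ContMDiffOn 𝓘(ℝ, EuclideanSpace ℝ (Fin k) × EuclideanSpace ℝ (Fin m)) (𝓡 n) ∞ q.symm
        q.target ∧
      (∀ x ∈ q.source, Function.Bijective (mvfderiv (𝓡 n) q x)) ∧
      ∀ i, mvfderiv (𝓡 n) q x₀ (w i) = (EuclideanSpace.single i 1, 0) := by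
  let φ := chartAt (EuclideanSpace ℝ (Fin n)) x₀
  have hφ : ContMDiffOn (𝓡 n) (𝓡 n) ∞ φ φ.source := contMDiffOn_chart
  have hφ' : ContMDiffOn (𝓡 n) (𝓡 n) ∞ φ.symm φ.target := contMDiffOn_chart_symm
  have hd : φ.MDifferentiable (𝓡 n) (𝓡 n) :=
    ⟨hφ.mdifferentiableOn (by simp), hφ'.mdifferentiableOn (by simp)⟩
  have hx₀ : x₀ ∈ φ.source := mem_chart_source _ x₀
  have hb : ∀ x ∈ φ.source, Function.Bijective (mvfderiv (𝓡 n) φ x) := fun x hx =>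
    hd.mfderiv_bijective hx
  have hw' : LinearIndependent ℝ fun i => mvfderiv (𝓡 n) φ x₀ (w i) :=
    hw.map' (mvfderiv (𝓡 n) φ x₀).toLinearMap (LinearMap.ker_eq_bot.2 (hb x₀ hx₀).1)
  obtain ⟨m, ℓ, hℓ⟩ := exists_linearEquiv_prod hw'
  let h : EuclideanSpace ℝ (Fin n) ≃ₜ EuclideanSpace ℝ (Fin k) × EuclideanSpace ℝ (Fin m) :=
    (Homeomorph.addRight (-φ x₀)).trans ℓ.toHomeomorph
  have hh : ∀ z, h z = ℓ (z + -φ x₀) := fun z => rfl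
  have hhd : ∀ z, HasFDerivAt h (ℓ : EuclideanSpace ℝ (Fin n) →L[ℝ] _) z := fun z => by
    have := (ℓ.hasFDerivAt (x := z + -φ x₀)).comp z ((hasFDerivAt_id z).add_const (-φ x₀))
    exact this
  have hhs : ContDiff ℝ ∞ h := ℓ.contDiff.comp (contDiff_id.add contDiff_const)
  have hhs' : ContDiff ℝ ∞ h.symm := by
    have : ⇑h.symm = fun z => ℓ.symm z - -φ x₀ := by
      ext1 z
      rw [sub_neg_eq_add, h.symm_apply_eq]
      simp [hh]
    rw [this]
    exact ℓ.symm.contDiff.sub contDiff_const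
  have key : ∀ x ∈ φ.source, ∀ v, mvfderiv (𝓡 n) (h ∘ φ) x v = ℓ (mvfderiv (𝓡 n) φ x v) := by
    intro x hx v
    rw [mvfderiv_fderiv_comp (hhd _).differentiableAt
      ((hφ x hx).contMDiffAt (φ.open_source.mem_nhds hx) |>.mdifferentiableAt (by simp)),
      (hhd _).fderiv]
    rfl
  refine ⟨m, φ.transHomeomorph h, hx₀, by simp [hh], ?_, ?_, fun x hx => ?_, fun i => ?_⟩
  · exact hhs.contMDiff.comp_contMDiffOn hφ
  · refine hφ'.comp (s := h.symm ⁻¹' φ.target) hhs'.contMDiff.contMDiffOn ?_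
    exact fun z hz => hz
  · have : ⇑(mvfderiv (𝓡 n) (φ.transHomeomorph h) x) = ℓ ∘ mvfderiv (𝓡 n) φ x :=
      funext (key x hx)
    rw [this]
    exact ℓ.bijective.comp (hb x hx)
  · exact (key x₀ hx₀ _).trans (hℓ i)

end Manifold

end DiracReduction

namespace DiracReduction

open Filter Topology VectorField

/-! ### Frobenius theorem on manifolds -/

section

theorem mvfderiv_congr {n : ℕ} {P F : Type*} [TopologicalSpace P]
    [ChartedSpace (EuclideanSpace ℝ (Fin n)) P] [NormedAddCommGroup F] [NormedSpace ℝ F]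
    {f g : P → F} {x : P} (h : f =ᶠ[𝓝 x] g) : mvfderiv (𝓡 n) f x = mvfderiv (𝓡 n) g x := by
  have h1 := h.mfderiv_eq (I := 𝓡 n) (I' := 𝓘(ℝ, F))
  simp only [mvfderiv]
  rw [h1]
  rfl

variable {n : ℕ} {P : Type*} [TopologicalSpace P] [ChartedSpace (EuclideanSpace ℝ (Fin n)) P]
  [IsManifold (𝓡 n) ∞ P]

/-- The space of sections of `D` is closed under the Lie bracket. -/
def IsInvolutive (D : ∀ x : P, Submodule ℝ (Tan n x)) : Prop :=
  ∀ U : Set P, IsOpen U → ∀ X Y : VField n P, SmoothVFieldOn U X → SmoothVFieldOn U Y →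
    (∀ x ∈ U, X x ∈ D x) → (∀ x ∈ U, Y x ∈ D x) → ∀ x ∈ U, mlieBracket (𝓡 n) X Y x ∈ D x

/-- Near every point, a subbundle of `TP` is in suitable coordinates the family of graphs of
linear maps `A w : E₁ → E₂`, together with fields in `D` projecting to the constant fields of
`E₁`. -/
theorem exists_graph_chart {D : ∀ x : P, Submodule ℝ (Tan n x)} (hD : IsTanSubbundle D) (x₀ : P) :
    ∃ (k m : ℕ) (q : OpenPartialHomeomorph P
      (EuclideanSpace ℝ (Fin k) × EuclideanSpace ℝ (Fin m)))
      (A : EuclideanSpace ℝ (Fin k) × EuclideanSpace ℝ (Fin m) →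
        EuclideanSpace ℝ (Fin k) →L[ℝ] EuclideanSpace ℝ (Fin m))
      (Z : EuclideanSpace ℝ (Fin k) → VField n P),
      x₀ ∈ q.source ∧ q x₀ = 0 ∧
      ContMDiffOn (𝓡 n) 𝓘(ℝ, EuclideanSpace ℝ (Fin k) × EuclideanSpace ℝ (Fin m)) ∞ q q.source ∧
      ContMDiffOn 𝓘(ℝ, EuclideanSpace ℝ (Fin k) × EuclideanSpace ℝ (Fin m)) (𝓡 n) ∞ q.symm
        q.target ∧
      ContDiffOn ℝ ∞ A q.target ∧
      (∀ x ∈ q.source, ∀ v : Tan n x,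
        v ∈ D x ↔ (mvfderiv (𝓡 n) q x v).2 = A (q x) (mvfderiv (𝓡 n) q x v).1) ∧
      (∀ u, SmoothVFieldOn q.source (Z u)) ∧
      ∀ u, ∀ x ∈ q.source, mvfderiv (𝓡 n) q x (Z u x) = (u, A (q x) u) := by
  obtain ⟨U, hU, hx₀U, k, X, hX, hXU⟩ := hD x₀
  obtain ⟨m, q, hx₀, hq0, hq, hq', hqb, hqX⟩ := exists_adapted_chart x₀ (hXU x₀ hx₀U).1
  set W := q.target ∩ q.symm ⁻¹' U with hW
  have hWo : IsOpen W := q.isOpen_inter_preimage_symm hU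
  have hqd : ∀ x ∈ q.source, ContMDiffAt (𝓡 n)
      𝓘(ℝ, EuclideanSpace ℝ (Fin k) × EuclideanSpace ℝ (Fin m)) ∞ q x := fun x hx =>
    hq.contMDiffAt (q.open_source.mem_nhds hx)
  -- The frame of `D` written in the coordinates `q`; below, `g z` is the map sending coefficients
  -- to the corresponding combination of the frame.
  let hfun : Fin k → EuclideanSpace ℝ (Fin k) × EuclideanSpace ℝ (Fin m) →
      EuclideanSpace ℝ (Fin k) × EuclideanSpace ℝ (Fin m) := fun i z =>
    mvfderiv (𝓡 n) q (q.symm z) (X i (q.symm z))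
  have hfs : ∀ i, ContDiffOn ℝ ∞ (hfun i) W := by
    intro i
    rw [← contMDiffOn_iff_contDiffOn]
    intro z hz
    have h1 : ContMDiffAt (𝓡 n) 𝓘(ℝ, EuclideanSpace ℝ (Fin k) × EuclideanSpace ℝ (Fin m)) ∞
        (fun x => mvfderiv (𝓡 n) q x (X i x)) (q.symm z) :=
      contMDiffAt_mvfderiv_apply (hqd _ (q.map_target hz.1))
        ((hX i).contMDiffAt (hU.mem_nhds hz.2))
    exact (h1.comp z (hq'.contMDiffAt (q.open_target.mem_nhds hz.1))).contMDiffWithinAt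
  let g : EuclideanSpace ℝ (Fin k) × EuclideanSpace ℝ (Fin m) →
      EuclideanSpace ℝ (Fin k) →L[ℝ] EuclideanSpace ℝ (Fin k) × EuclideanSpace ℝ (Fin m) :=
    fun z => ∑ i, (EuclideanSpace.proj i : EuclideanSpace ℝ (Fin k) →L[ℝ] ℝ).smulRight (hfun i z)
  have hg : ContDiffOn ℝ ∞ g W :=
    ContDiffOn.sum fun i _ => contDiffOn_const.smulRight (hfs i)
  have hgapp : ∀ z c, g z c = ∑ i, c i • hfun i z := fun z c => by
    simp [g]
  have hgX : ∀ x ∈ q.source, ∀ c : EuclideanSpace ℝ (Fin k),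
      g (q x) c = mvfderiv (𝓡 n) q x (∑ i, c i • X i x) := by
    intro x hx c
    rw [hgapp, map_sum]
    refine Finset.sum_congr rfl fun i _ => ?_
    rw [map_smul]
    exact congrArg (fun y => c i • mvfderiv (𝓡 n) q y (X i y)) (q.left_inv hx)
  -- The first component of the frame. The chart was chosen so that it is the identity at `0`; where
  -- it is invertible, `D` is the graph of the second component of `g` composed with the inverse of
  -- `N`.
  let N := fun z => ContinuousLinearMap.fst ℝ _ _ ∘L g z
  have hN : ContDiffOn ℝ ∞ N W := contDiffOn_const.clm_comp hg
  have hN0 : N 0 = ContinuousLinearMap.id ℝ _ := by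
    ext1 c
    change (g 0 c).1 = c
    rw [← hq0, hgX x₀ hx₀, map_sum]
    simp only [map_smul, hqX]
    ext j
    simp [Prod.fst_sum, Pi.single_apply]
  set V := W ∩ N ⁻¹' range (ContinuousLinearEquiv.toContinuousLinearMap) with hV
  have hVo : IsOpen V := hN.continuousOn.isOpen_inter_preimage hWo ContinuousLinearEquiv.isOpen
  have h0V : (0 : EuclideanSpace ℝ (Fin k) × EuclideanSpace ℝ (Fin m)) ∈ V := by
    refine ⟨⟨hq0 ▸ q.map_source hx₀, ?_⟩, ContinuousLinearEquiv.refl ℝ _, hN0.symm⟩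
    rw [mem_preimage, ← hq0, q.left_inv hx₀]
    exact hx₀U
  let R := fun z => (N z).inverse
  have hR : ContDiffOn ℝ ∞ R V := by
    rintro z ⟨hzW, T, hT⟩
    have h1 := contDiffAt_map_inverse (𝕜 := ℝ) (n := ∞) T
    rw [hT] at h1
    exact (h1.comp z (hN.contDiffAt (hWo.mem_nhds hzW))).contDiffWithinAt
  have hNR : ∀ z ∈ V, ∀ u, N z (R z u) = u := by
    rintro z ⟨-, T, hT⟩ u
    exact ContinuousLinearMap.IsInvertible.self_apply_inverse ⟨T, hT⟩ u
  have hRN : ∀ z ∈ V, ∀ u, R z (N z u) = u := by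
    rintro z ⟨-, T, hT⟩ u
    exact ContinuousLinearMap.IsInvertible.inverse_apply_self ⟨T, hT⟩ u
  let A := fun z => (ContinuousLinearMap.snd ℝ _ _ ∘L g z) ∘L R z
  have hA : ContDiffOn ℝ ∞ A V :=
    (contDiffOn_const.clm_comp (hg.mono inter_subset_left)).clm_comp hR
  -- The frame coefficients `R (q x) u` are those for which the first component in coordinates is
  -- the constant `u`.
  let Z : EuclideanSpace ℝ (Fin k) → VField n P := fun u x => ∑ i, R (q x) u i • X i x
  have hsrc : ∀ x, x ∈ (q.symm.restrOpen V hVo).symm.source → x ∈ q.source ∧ q x ∈ V ∧ x ∈ U := by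
    intro x hx
    have : x ∈ q.source ∧ q x ∈ V := by simpa using hx
    refine ⟨this.1, this.2, ?_⟩
    have h2 := this.2.1.2
    rwa [mem_preimage, q.left_inv this.1] at h2
  refine ⟨k, m, (q.symm.restrOpen V hVo).symm, A, Z, ?_, hq0, ?_, ?_, ?_, ?_, ?_, ?_⟩
  · have : x₀ ∈ q.source ∧ q x₀ ∈ V := ⟨hx₀, hq0 ▸ h0V⟩
    simpa using this
  · exact hq.mono fun x hx => (hsrc x hx).1
  · exact hq'.mono inter_subset_left
  · exact hA.mono inter_subset_right
  · intro x hx v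
    obtain ⟨h1, h2, h3⟩ := hsrc x hx
    change _ ↔ (mvfderiv (𝓡 n) q x v).2 = (g (q x) (R (q x) (mvfderiv (𝓡 n) q x v).1)).2
    rw [← (hXU x h3).2, Submodule.mem_span_range_iff_exists_fun]
    constructor
    · rintro ⟨c, rfl⟩
      have h4 := hgX x h1 (WithLp.toLp 2 c)
      have h5 : R (q x) (g (q x) (WithLp.toLp 2 c)).1 = WithLp.toLp 2 c := hRN _ h2 _
      simp only at h4
      rw [← h4, h5]
    · intro h
      refine ⟨R (q x) (mvfderiv (𝓡 n) q x v).1, (hqb x h1).1 ?_⟩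
      rw [← hgX x h1]
      exact Prod.ext (hNR _ h2 _) h.symm
  · intro u
    refine ContMDiffOn.sum_section (V := fun x : P => Tan n x) fun i _ => ?_
    refine ContMDiffOn.smul_section (V := fun x : P => Tan n x) (f := fun x => R (q x) u i) ?_
      ((hX i).mono fun x hx => (hsrc x hx).2.2)
    have h1 : ContDiffOn ℝ ∞ (fun z => R z u i) V :=
      (EuclideanSpace.proj i : EuclideanSpace ℝ (Fin k) →L[ℝ] ℝ).contDiff.comp_contDiffOn
        (hR.clm_apply contDiffOn_const)
    exact h1.contMDiffOn.comp (hq.mono fun x hx => (hsrc x hx).1) fun x hx => (hsrc x hx).2.1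
  · intro u x hx
    obtain ⟨h1, h2, h3⟩ := hsrc x hx
    change mvfderiv (𝓡 n) q x (Z u x) = _
    rw [← hgX x h1]
    exact Prod.ext (hNR _ h2 _) rfl

/-- The fields `Z u`, `Z v` of a graph chart have constant first components, so their bracket has
first component `0`. Lying in the graph of `A`, it also has second component `0`, and this is
precisely the symmetry condition on `dA` required by `exists_flattening`. -/
theorem exists_foliated_chart {D : ∀ x : P, Submodule ℝ (Tan n x)} (hD : IsTanSubbundle D)
    (hi : IsInvolutive D) (x₀ : P) :
    ∃ (k m : ℕ) (e : OpenPartialHomeomorph P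
      (EuclideanSpace ℝ (Fin k) × EuclideanSpace ℝ (Fin m))),
      x₀ ∈ e.source ∧ e x₀ = 0 ∧ e.target = univ ∧
      ContMDiffOn (𝓡 n) 𝓘(ℝ, EuclideanSpace ℝ (Fin k) × EuclideanSpace ℝ (Fin m)) ∞ e e.source ∧
      ContMDiff 𝓘(ℝ, EuclideanSpace ℝ (Fin k) × EuclideanSpace ℝ (Fin m)) (𝓡 n) ∞ e.symm ∧
      ∀ x ∈ e.source, ∀ v : Tan n x, v ∈ D x ↔ (mvfderiv (𝓡 n) e x v).2 = 0 := by
  have h2 : (2 : ℕ∞ω) ≤ ∞ := WithTop.coe_le_coe.2 (le_top : (2 : ℕ∞) ≤ ⊤)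
  obtain ⟨k, m, q, A, Z, hx₀, hq0, hq, hq', hA, hAD, hZ, hZq⟩ := exists_graph_chart hD x₀
  have hqd : ∀ x ∈ q.source, ContMDiffAt (𝓡 n)
      𝓘(ℝ, EuclideanSpace ℝ (Fin k) × EuclideanSpace ℝ (Fin m)) ∞ q x := fun x hx =>
    hq.contMDiffAt (q.open_source.mem_nhds hx)
  have hsymm : ∀ z ∈ q.target, ∀ u v,
      fderiv ℝ A z (u, A z u) v = fderiv ℝ A z (v, A z v) u := by
    intro z hz u v
    obtain ⟨x, hx, rfl⟩ : ∃ x ∈ q.source, q x = z := ⟨_, q.map_target hz, q.right_inv hz⟩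
    have hAd : DifferentiableAt ℝ A (q x) :=
      (hA.contDiffAt (q.open_target.mem_nhds hz)).differentiableAt (by simp)
    have hZD : ∀ u, ∀ y ∈ q.source, Z u y ∈ D y := fun u y hy => by
      rw [hAD y hy, hZq u y hy]
    have hZd : ∀ u, VFieldDiffAt (Z u) x := fun u =>
      ((hZ u).contMDiffAt (q.open_source.mem_nhds hx)).mdifferentiableAt (by simp)
    have key : ∀ u v, mvfderiv (𝓡 n) (fun y => mvfderiv (𝓡 n) q y (Z v y)) x (Z u x) =
        (0, fderiv ℝ A (q x) (u, A (q x) u) v) := by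
      intro u v
      have h1 : (fun y => mvfderiv (𝓡 n) q y (Z v y)) =ᶠ[𝓝 x] (fun z => (v, A z v)) ∘ q := by
        filter_upwards [q.open_source.mem_nhds hx] with y hy
        exact hZq v y hy
      have h3 : HasFDerivAt (fun z => (v, A z v))
          ((0 : EuclideanSpace ℝ (Fin k) × EuclideanSpace ℝ (Fin m) →L[ℝ]
            EuclideanSpace ℝ (Fin k)).prod ((fderiv ℝ A (q x)).flip v)) (q x) :=
        (hasFDerivAt_const _ _).prodMk (hAd.hasFDerivAt.clm_apply (hasFDerivAt_const v _)
          |>.congr_fderiv (by ext <;> simp))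
      have h4 : mvfderiv (𝓡 n) (fun y => mvfderiv (𝓡 n) q y (Z v y)) x =
          mvfderiv (𝓡 n) ((fun z => (v, A z v)) ∘ q) x := mvfderiv_congr h1
      rw [h4, mvfderiv_fderiv_comp h3.differentiableAt ((hqd x hx).mdifferentiableAt (by simp)),
        h3.fderiv, hZq u x hx]
      rfl
    -- By `key`, the bracket in coordinates is `(0, dA(u, A u) v - dA(v, A v) u)`.
    have h5 := hi q.source q.open_source (Z u) (Z v) (hZ u) (hZ v) (hZD u) (hZD v) x hx
    rw [hAD x hx, (mvfderiv_mlieBracket ((hqd x hx).of_le h2) (hZd u) (hZd v)).2, key, key] at h5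
    simpa [sub_eq_zero] using h5
  obtain ⟨e, he1, he0, he2, he3, he4, he5⟩ := exists_flattening q.open_target
    (hq0 ▸ q.map_source hx₀) hA hsymm
  have hes : ∀ z, z ∈ e.source := fun z => he1 ▸ mem_univ z
  have h0t : (0 : EuclideanSpace ℝ (Fin k) × EuclideanSpace ℝ (Fin m)) ∈ e.target := by
    rw [← he0]
    exact e.map_source (hes _)
  refine ⟨k, m, q.trans e.symm, ?_, ?_, ?_, ?_, ?_, ?_⟩
  · simpa [hx₀, hq0] using h0t
  · have := e.left_inv (x := 0) (hes _)
    rw [he0] at this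
    simpa [hq0] using this
  · rw [OpenPartialHomeomorph.trans_target]
    refine eq_univ_of_forall fun z => ⟨hes z, he2 (e.map_source (hes z))⟩
  · exact he4.contMDiffOn.comp (hq.mono inter_subset_left) fun x hx => hx.2
  · refine contMDiffOn_univ.1 (hq'.comp he3.contMDiff.contMDiffOn fun z _ => ?_)
    exact he2 (e.map_source (hes z))
  · intro x hx v
    have hx' : x ∈ q.source ∧ q x ∈ e.target := hx
    rw [hAD x hx'.1, he5 _ hx'.2, ← mvfderiv_fderiv_comp
      ((he4.contDiffAt (e.open_target.mem_nhds hx'.2)).differentiableAt (by simp))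
      ((hqd x hx'.1).mdifferentiableAt (by simp))]
    rfl

end

end DiracReduction

namespace DiracReduction

open Filter Topology VectorField

/-! ### Foliated charts: slices, leaves and the local quotient -/

section

variable {n : ℕ} {P : Type*} [TopologicalSpace P] [ChartedSpace (EuclideanSpace ℝ (Fin n)) P]
  {k m : ℕ} {D : ∀ x : P, Submodule ℝ (Tan n x)}

/-- Charts onto `E₁ × E₂` in which `D` is the family of tangent spaces of the slices
`E₁ × {c}`. -/
structure IsFoliatedChart (D : ∀ x : P, Submodule ℝ (Tan n x))
    (e : OpenPartialHomeomorph P (EuclideanSpace ℝ (Fin k) × EuclideanSpace ℝ (Fin m))) :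
    Prop where
  target_eq : e.target = univ
  smooth :
    ContMDiffOn (𝓡 n) 𝓘(ℝ, EuclideanSpace ℝ (Fin k) × EuclideanSpace ℝ (Fin m)) ∞ e e.source
  smooth_symm :
    ContMDiff 𝓘(ℝ, EuclideanSpace ℝ (Fin k) × EuclideanSpace ℝ (Fin m)) (𝓡 n) ∞ e.symm
  mem_iff : ∀ x ∈ e.source, ∀ v : Tan n x, v ∈ D x ↔ (mvfderiv (𝓡 n) e x v).2 = 0

namespace IsFoliatedChart

variable {e : OpenPartialHomeomorph P (EuclideanSpace ℝ (Fin k) × EuclideanSpace ℝ (Fin m))}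

theorem mem_target (he : IsFoliatedChart D e) (z) : z ∈ e.target := he.target_eq ▸ mem_univ z

theorem smoothAt (he : IsFoliatedChart D e) {x : P} (hx : x ∈ e.source) : ContMDiffAt (𝓡 n)
    𝓘(ℝ, EuclideanSpace ℝ (Fin k) × EuclideanSpace ℝ (Fin m)) ∞ e x :=
  he.smooth.contMDiffAt (e.open_source.mem_nhds hx)

theorem mvfderiv_bijective (he : IsFoliatedChart D e) {x : P} (hx : x ∈ e.source) :
    Function.Bijective (mvfderiv (𝓡 n) e x) := by
  have hd : e.MDifferentiable (𝓡 n)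
      𝓘(ℝ, EuclideanSpace ℝ (Fin k) × EuclideanSpace ℝ (Fin m)) :=
    ⟨he.smooth.mdifferentiableOn (by simp),
      (he.smooth_symm.contMDiffOn).mdifferentiableOn (by simp)⟩
  exact hd.mfderiv_bijective hx

/-- A curve in the chart domain is tangent to `D` iff the transversal component of its velocity
vanishes. -/
theorem mfderiv_comp_mem_iff (he : IsFoliatedChart D e) {H : Type*}
    [NormedAddCommGroup H] [NormedSpace ℝ H]
    {γ : H → P} {t : H} (hγ : MDifferentiableAt 𝓘(ℝ, H) (𝓡 n) γ t) (ht : γ t ∈ e.source)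
    (τ : H) : mfderiv 𝓘(ℝ, H) (𝓡 n) γ t τ ∈ D (γ t) ↔ (fderiv ℝ (e ∘ γ) t τ).2 = 0 := by
  rw [he.mem_iff _ ht, ← mfderiv_eq_fderiv, mfderiv_comp t
    ((he.smoothAt ht).mdifferentiableAt (by simp)) hγ]
  rfl

theorem mfderiv_slice (he : IsFoliatedChart D e) (w : EuclideanSpace ℝ (Fin k))
    (c : EuclideanSpace ℝ (Fin m))
    (τ : EuclideanSpace ℝ (Fin k)) :
    mvfderiv (𝓡 n) e (e.symm (w, c)) (mfderiv (𝓡 k) (𝓡 n) (fun w => e.symm (w, c)) w τ) =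
      (τ, 0) := by
  have h1 : ContMDiff (𝓡 k) (𝓡 n) ∞ (fun w => e.symm (w, c)) :=
    he.smooth_symm.comp (contDiff_prodMk_left c).contMDiff
  have h2 := mfderiv_comp w (I'' := 𝓘(ℝ, EuclideanSpace ℝ (Fin k) × EuclideanSpace ℝ (Fin m)))
    ((he.smoothAt (e.map_target (he.mem_target (w, c)))).mdifferentiableAt (by simp))
    (h1.mdifferentiableAt (x := w) (by simp))
  have h3 : e ∘ (fun w => e.symm (w, c)) = fun w => (w, c) := by
    ext1 w
    exact e.right_inv (he.mem_target _)
  rw [h3, mfderiv_eq_fderiv, (hasFDerivAt_prodMk_left w c).fderiv] at h2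
  exact (DFunLike.congr_fun h2 τ).symm

theorem exists_integralManifold (he : IsFoliatedChart D e) {x₀ : P} (hx₀ : x₀ ∈ e.source)
    (h0 : e x₀ = 0) :
    ∃ (k : ℕ) (W : Set (EuclideanSpace ℝ (Fin k))) (s : EuclideanSpace ℝ (Fin k) → P),
      IsOpen W ∧ 0 ∈ W ∧ s 0 = x₀ ∧ ContMDiffOn (𝓡 k) (𝓡 n) ∞ s W ∧
      ∀ w ∈ W, Function.Injective (mfderiv (𝓡 k) (𝓡 n) s w) ∧
        (mfderiv (𝓡 k) (𝓡 n) s w).range = D (s w) := by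
  have hs (w : EuclideanSpace ℝ (Fin k)) : e.symm (w, 0) ∈ e.source :=
    e.map_target (he.mem_target _)
  refine ⟨k, univ, fun w => e.symm (w, 0), isOpen_univ, mem_univ _, ?_,
    (he.smooth_symm.comp (contDiff_prodMk_left 0).contMDiff).contMDiffOn, fun w _ => ⟨?_, ?_⟩⟩
  · exact (congrArg e.symm h0.symm).trans (e.left_inv hx₀)
  · intro τ τ' h
    have h1 := ((he.mfderiv_slice w 0 τ).symm.trans (congrArg _ h)).trans (he.mfderiv_slice w 0 τ')
    exact (Prod.ext_iff.1 h1).1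
  · ext v
    rw [he.mem_iff _ (hs w)]
    constructor
    · rintro ⟨τ, rfl⟩
      exact congrArg Prod.snd (he.mfderiv_slice w 0 τ)
    · intro h
      refine ⟨(mvfderiv (𝓡 n) e (e.symm (w, 0)) v).1, (he.mvfderiv_bijective (hs w)).1 ?_⟩
      exact (he.mfderiv_slice w 0 _).trans (Prod.ext rfl h.symm)

/-- Points of one slice are joined by a straight segment in the first coordinate, which stays in the
chart since the target is the whole space. Conversely, along a curve tangent to `D` the transversal
coordinate has zero derivative. -/
theorem fibre (he : IsFoliatedChart D e) {x y : P} (hx : x ∈ e.source) (hy : y ∈ e.source) :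
    (e x).2 = (e y).2 ↔ SameLeaf D e.source x y := by
  constructor
  · intro h
    have h1 : ContDiff ℝ ∞ fun t : ℝ => (((1 - t) • (e x).1 + t • (e y).1, (e x).2) :
        EuclideanSpace ℝ (Fin k) × EuclideanSpace ℝ (Fin m)) := by fun_prop
    have h2 : ContMDiff 𝓘(ℝ, ℝ) (𝓡 n) ∞
        fun t : ℝ => e.symm ((1 - t) • (e x).1 + t • (e y).1, (e x).2) :=
      he.smooth_symm.comp h1.contMDiff
    refine ⟨_, h2, ?_, ?_, fun t => ⟨e.map_target (he.mem_target _), ?_⟩⟩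
    · simp [e.left_inv hx]
    · simp [h, e.left_inv hy]
    · rw [he.mfderiv_comp_mem_iff (h2.mdifferentiableAt (by simp)) (e.map_target (he.mem_target _))]
      have h3 : e ∘ (fun t : ℝ => e.symm ((1 - t) • (e x).1 + t • (e y).1, (e x).2)) =
          fun t : ℝ => ((1 - t) • (e x).1 + t • (e y).1, (e x).2) := by
        ext1 t
        exact e.right_inv (he.mem_target _)
      rw [h3]
      have h4 : (ContinuousLinearMap.snd ℝ (EuclideanSpace ℝ (Fin k)) (EuclideanSpace ℝ (Fin m))) ∘
          (fun t : ℝ => ((1 - t) • (e x).1 + t • (e y).1, (e x).2)) = fun _ => (e x).2 := rfl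
      have h5 := ((ContinuousLinearMap.snd ℝ (EuclideanSpace ℝ (Fin k))
        (EuclideanSpace ℝ (Fin m))).hasFDerivAt.comp t
        (h1.differentiable (by simp) t).hasFDerivAt).fderiv
      rw [h4] at h5
      have h6 := DFunLike.congr_fun h5 (1 : ℝ)
      simpa using h6.symm
  · rintro ⟨γ, hγ, rfl, rfl, h⟩
    have h1 : ∀ t, DifferentiableAt ℝ (e ∘ γ) t := fun t =>
      (((he.smoothAt (h t).1).comp t (hγ t)).contDiffAt).differentiableAt (by simp)
    have h2 : ∀ t, HasFDerivAt (fun t => (e (γ t)).2) (0 : ℝ →L[ℝ] EuclideanSpace ℝ (Fin m)) t := by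
      intro t
      have h3 := (he.mfderiv_comp_mem_iff (hγ.mdifferentiableAt (by simp)) (h t).1 (1 : ℝ)).1
        (h t).2
      refine ((ContinuousLinearMap.snd ℝ (EuclideanSpace ℝ (Fin k))
        (EuclideanSpace ℝ (Fin m))).hasFDerivAt.comp t (h1 t).hasFDerivAt).congr_fderiv ?_
      ext1
      exact h3
    exact is_const_of_fderiv_eq_zero (fun t => (h2 t).differentiableAt) (fun t => (h2 t).fderiv) 0 1

/-- The leaf space is `EuclideanSpace ℝ (Fin m)` itself: the transversal coordinate is onto because
the chart is, and its kernel and fibres are the defining property and `fibre`. -/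
theorem isQuotientManifold (he : IsFoliatedChart D e) :
    IsQuotientManifold (m := m) D e.source (fun x => (e x).2) := by
  have hd : ∀ x ∈ e.source, ∀ v, mfderiv (𝓡 n) (𝓡 m) (fun x => (e x).2) x v =
      (mvfderiv (𝓡 n) e x v).2 := by
    intro x hx v
    have := mvfderiv_fderiv_comp (ContinuousLinearMap.snd ℝ (EuclideanSpace ℝ (Fin k))
      (EuclideanSpace ℝ (Fin m))).differentiableAt ((he.smoothAt hx).mdifferentiableAt (by simp)) v
    rw [ContinuousLinearMap.fderiv] at this
    exact this
  refine ⟨contDiff_snd.contMDiff.comp_contMDiffOn he.smooth, ?_, fun x hx c => ?_, fun x hx => ?_,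
    fun x hx y hy => he.fibre hx hy⟩
  · refine eq_univ_of_forall fun c => ⟨e.symm (0, c), e.map_target (he.mem_target _), ?_⟩
    simp [e.right_inv (he.mem_target _)]
  · obtain ⟨v, hv⟩ := (he.mvfderiv_bijective hx).2 (0, c)
    exact ⟨v, by rw [hd x hx, hv]⟩
  · ext v
    rw [he.mem_iff x hx, LinearMap.mem_ker, ← hd x hx v]
    rfl

end IsFoliatedChart

end

end DiracReduction

namespace DiracReduction

open Filter Topology VectorField

/-! ### Local sections of submersions -/

section Submersion

variable {n m : ℕ} {P Q : Type*} [TopologicalSpace P] [ChartedSpace (EuclideanSpace ℝ (Fin n)) P]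
  [IsManifold (𝓡 n) ∞ P] [TopologicalSpace Q] [ChartedSpace (EuclideanSpace ℝ (Fin m)) Q]
  [IsManifold (𝓡 m) ∞ Q]

/-- Choose a linear right inverse `R'` of the derivative. Restricted to the affine slice `y ↦ a + R'
y`, the map `f` has identity derivative at `0`; invert it there and return to the slice. -/
theorem exists_contDiff_rightInverse {E F : Type*} [NormedAddCommGroup E] [NormedSpace ℝ E]
    [NormedAddCommGroup F] [NormedSpace ℝ F] [FiniteDimensional ℝ E] [FiniteDimensional ℝ F]
    {f : E → F} {a : E} (hf : ∀ᶠ x in 𝓝 a, ContDiffAt ℝ ∞ f x)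
    (hs : Function.Surjective (fderiv ℝ f a)) :
    ∃ σ : F → E, ContDiffAt ℝ ∞ σ (f a) ∧ σ (f a) = a ∧ ∀ᶠ y in 𝓝 (f a), f (σ y) = y := by
  obtain ⟨R, hR⟩ := LinearMap.exists_rightInverse_of_surjective (fderiv ℝ f a).toLinearMap
    (LinearMap.range_eq_top.2 hs)
  let R' : F →L[ℝ] E := LinearMap.toContinuousLinearMap R
  have hR' : ∀ y, fderiv ℝ f a (R' y) = y := fun y => LinearMap.congr_fun hR y
  let r : F → E := fun y => a + R' y
  have hr : ContDiff ℝ ∞ r := contDiff_const.add R'.contDiff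
  have hr0 : r 0 = a := by simp [r]
  have hrd : HasFDerivAt r R' 0 := (R'.hasFDerivAt (x := 0)).const_add a
  have h1 : ∀ᶠ y in 𝓝 0, ContDiffAt ℝ ∞ (f ∘ r) y := by
    have h2 : Tendsto r (𝓝 0) (𝓝 a) := by
      have := hr.continuous.tendsto 0
      rwa [hr0] at this
    filter_upwards [h2.eventually hf] with y hy
    exact hy.comp y hr.contDiffAt
  have h3 : HasFDerivAt (f ∘ r) (ContinuousLinearMap.id ℝ F) 0 := by
    have h4 : HasFDerivAt f (fderiv ℝ f a) (r 0) := by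
      rw [hr0]
      exact (hf.self_of_nhds.differentiableAt (by simp)).hasFDerivAt
    exact (h4.comp 0 hrd).congr_fderiv (by ext1 y; exact hR' y)
  obtain ⟨e, he0, hef, -, hes, -⟩ := exists_smooth_localInverse h1
    (by rw [h3.fderiv]; exact ⟨ContinuousLinearEquiv.refl ℝ F, rfl⟩)
  have he : ∀ y, e y = f (r y) := fun y => congrFun hef y
  have he' : e 0 = f a := by rw [he, hr0]
  have ht : f a ∈ e.target := he' ▸ e.map_source he0
  have hi : e.symm (f a) = 0 := by rw [← he', e.left_inv he0]
  refine ⟨r ∘ e.symm, hr.contDiffAt.comp _ (hes.contDiffAt (e.open_target.mem_nhds ht)), ?_, ?_⟩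
  · simp [hi, hr0]
  · filter_upwards [e.open_target.mem_nhds ht] with y hy
    exact (he _).symm.trans (e.right_inv hy)

/-- A submersion has smooth local sections. -/
theorem exists_localSection {U : Set P} (hU : IsOpen U) {p : P → Q}
    (hp : ContMDiffOn (𝓡 n) (𝓡 m) ∞ p U) {x : P} (hx : x ∈ U)
    (hs : Function.Surjective (mfderiv (𝓡 n) (𝓡 m) p x)) :
    ∃ σ : Q → P, ContMDiffAt (𝓡 m) (𝓡 n) ∞ σ (p x) ∧ σ (p x) = x ∧
      ∀ᶠ y in 𝓝 (p x), p (σ y) = y := by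
  let φ := extChartAt (𝓡 n) x
  let ψ := extChartAt (𝓡 m) (p x)
  have hpx : ContMDiffAt (𝓡 n) (𝓡 m) ∞ p x := hp.contMDiffAt (hU.mem_nhds hx)
  let f : EuclideanSpace ℝ (Fin n) → EuclideanSpace ℝ (Fin m) := ψ ∘ p ∘ φ.symm
  have hfx : f (φ x) = ψ (p x) := by simp [f, φ]
  have hf : ∀ᶠ z in 𝓝 (φ x), ContDiffAt ℝ ∞ f z := by
    have h1 : ∀ᶠ y in 𝓝 x, y ∈ U ∧ p y ∈ ψ.source :=
      (hU.eventually_mem hx).and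
        (hpx.continuousAt.eventually (extChartAt_source_mem_nhds (I := 𝓡 m) (p x)))
    have h2 : Tendsto φ.symm (𝓝 (φ x)) (𝓝 x) := by
      have := continuousAt_extChartAt_symm (I := 𝓡 n) x
      rwa [ContinuousAt, extChartAt_to_inv] at this
    filter_upwards [h2.eventually h1, extChartAt_target_mem_nhds (I := 𝓡 n) x] with z hz hz'
    rw [← contMDiffAt_iff_contDiffAt]
    have h3 : ContMDiffAt (𝓡 n) (𝓡 n) ∞ φ.symm z :=
      (contMDiffOn_extChartAt_symm (I := 𝓡 n) x).contMDiffAt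
        ((isOpen_extChartAt_target (I := 𝓡 n) x).mem_nhds hz')
    have h4 : ContMDiffAt (𝓡 n) (𝓡 m) ∞ p (φ.symm z) := hp.contMDiffAt (hU.mem_nhds hz.1)
    have h5 : ContMDiffAt (𝓡 m) (𝓡 m) ∞ ψ (p (φ.symm z)) :=
      contMDiffAt_extChartAt' (by simpa [ψ] using hz.2)
    exact h5.comp z (h4.comp z h3)
  have hfd : Function.Surjective (fderiv ℝ f (φ x)) := by
    rw [(hpx.mdifferentiableAt (by simp)).mfderiv, ModelWithCorners.Boundaryless.range_eq_univ,
      fderivWithin_univ] at hs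
    exact hs
  obtain ⟨σ, h1, h2, h3⟩ := exists_contDiff_rightInverse hf hfd
  rw [hfx] at h1 h2 h3
  refine ⟨φ.symm ∘ σ ∘ ψ, ?_, ?_, ?_⟩
  · have h4 : ContMDiffAt (𝓡 m) (𝓡 m) ∞ ψ (p x) := contMDiffAt_extChartAt
    have h5 : ContMDiffAt (𝓡 n) (𝓡 n) ∞ φ.symm (σ (ψ (p x))) := by
      rw [h2]
      exact (contMDiffOn_extChartAt_symm (I := 𝓡 n) x).contMDiffAt
        (extChartAt_target_mem_nhds (I := 𝓡 n) x)
    exact h5.comp (p x) (h1.contMDiffAt.comp (p x) h4)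
  · simp [h2, φ]
  · have h4 : Tendsto ψ (𝓝 (p x)) (𝓝 (ψ (p x))) := continuousAt_extChartAt (I := 𝓡 m) (p x)
    have h5 : Tendsto (φ.symm ∘ σ ∘ ψ) (𝓝 (p x)) (𝓝 x) := by
      have h6 := continuousAt_extChartAt_symm (I := 𝓡 n) x
      rw [ContinuousAt, extChartAt_to_inv] at h6
      have h7 := h1.continuousAt.tendsto
      rw [h2] at h7
      exact h6.comp (h7.comp h4)
    have h8 : ∀ᶠ y in 𝓝 x, p y ∈ ψ.source :=
      hpx.continuousAt.eventually (extChartAt_source_mem_nhds (I := 𝓡 m) (p x))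
    filter_upwards [h4.eventually h3, h5.eventually h8,
      extChartAt_source_mem_nhds (I := 𝓡 m) (p x)] with y hy hy' hy''
    exact ψ.injOn hy' hy'' hy

/-- A function on the base of a surjective submersion is smooth if its pullback is. -/
theorem contMDiff_of_comp_submersion {U : Set P} (hU : IsOpen U) {p : P → Q}
    (hp : ContMDiffOn (𝓡 n) (𝓡 m) ∞ p U)
    (hs : ∀ x ∈ U, Function.Surjective (mfderiv (𝓡 n) (𝓡 m) p x)) (hsurj : p '' U = univ)
    {h : Q → ℝ} (hh : ContMDiffOn (𝓡 n) 𝓘(ℝ, ℝ) ∞ (h ∘ p) U) : ContMDiff (𝓡 m) 𝓘(ℝ, ℝ) ∞ h := by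
  intro q
  obtain ⟨x, hx, rfl⟩ : q ∈ p '' U := hsurj ▸ mem_univ q
  obtain ⟨σ, h1, h2, h3⟩ := exists_localSection hU hp hx (hs x hx)
  have h4 : ContMDiffAt (𝓡 n) 𝓘(ℝ, ℝ) ∞ (h ∘ p) (σ (p x)) := by
    rw [h2]
    exact hh.contMDiffAt (hU.mem_nhds hx)
  refine (h4.comp (p x) h1).congr_of_eventuallyEq ?_
  filter_upwards [h3] with y hy
  simp [hy]

end Submersion

end DiracReduction

namespace DiracReduction

open Filter Topology VectorField

/-! ### Smoothness of bivectors in coordinates -/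

section

variable {m : ℕ} {Q : Type*} [TopologicalSpace Q] [ChartedSpace (EuclideanSpace ℝ (Fin m)) Q]

theorem eq_sum_clm
    (A : (EuclideanSpace ℝ (Fin m) →L[ℝ] ℝ) →L[ℝ] EuclideanSpace ℝ (Fin m)) :
    A = ∑ i, ∑ j, A (EuclideanSpace.proj j) i •
      (ContinuousLinearMap.apply ℝ ℝ (EuclideanSpace.single j (1 : ℝ))).smulRight
        (EuclideanSpace.single i (1 : ℝ)) := by
  ext α k
  have hα : α = ∑ j, α (EuclideanSpace.single j 1) •
      (EuclideanSpace.proj j : EuclideanSpace ℝ (Fin m) →L[ℝ] ℝ) := by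
    refine ContinuousLinearMap.coe_injective
      ((EuclideanSpace.basisFun (Fin m) ℝ).toBasis.ext fun i => ?_)
    simp
  conv_lhs => rw [hα]
  simp [Pi.single_apply, mul_comm]

/-- The coordinate functions of the preferred chart at `q₀`. -/
noncomputable def chartCoord (q₀ : Q) (i : Fin m) (q : Q) : ℝ :=
  (extChartAt (𝓡 m) q₀ q) i

variable [IsManifold (𝓡 m) ∞ Q]

theorem contMDiffOn_chartCoord (q₀ : Q) (i : Fin m) :
    ContMDiffOn (𝓡 m) 𝓘(ℝ, ℝ) ∞ (chartCoord q₀ i) (chartAt (EuclideanSpace ℝ (Fin m)) q₀).source :=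
  (EuclideanSpace.proj i : EuclideanSpace ℝ (Fin m) →L[ℝ] ℝ).contDiff.contMDiff.comp_contMDiffOn
    (contMDiffOn_extChartAt (I := 𝓡 m) (n := ∞))

theorem mvfderiv_chartCoord {q₀ q : Q} (hq : q ∈ (chartAt (EuclideanSpace ℝ (Fin m)) q₀).source)
    (i : Fin m) (v : Tan m q) : mvfderiv (F := ℝ) (𝓡 m) (chartCoord q₀ i) q v =
      (EuclideanSpace.proj i : EuclideanSpace ℝ (Fin m) →L[ℝ] ℝ)
        (mfderiv (𝓡 m) (𝓡 m) (extChartAt (𝓡 m) q₀) q v) := by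
  have := mvfderiv_fderiv_comp (x := q) (g := EuclideanSpace.proj i)
    (EuclideanSpace.proj i : EuclideanSpace ℝ (Fin m) →L[ℝ] ℝ).differentiableAt
    (mdifferentiableAt_extChartAt (I := 𝓡 m) hq) v
  rw [ContinuousLinearMap.fderiv] at this
  exact this

/-- A bundle map `T*Q → TQ` is smooth if its matrix entries in coordinates are smooth. -/
theorem contMDiffAt_sharp {S : ∀ q : Q, Cotan m q →L[ℝ] Tan m q} {q₀ : Q}
    (h : ∀ i j : Fin m, ContMDiffAt (𝓡 m) 𝓘(ℝ, ℝ) ∞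
      (fun q : Q => diff (n := m) (chartCoord q₀ i) q
        (S q (diff (n := m) (chartCoord q₀ j) q))) q₀) :
    ContMDiffAt (𝓡 m)
      ((𝓡 m).prod 𝓘(ℝ, (EuclideanSpace ℝ (Fin m) →L[ℝ] ℝ) →L[ℝ] EuclideanSpace ℝ (Fin m))) ∞
      (fun x => TotalSpace.mk'
        ((EuclideanSpace ℝ (Fin m) →L[ℝ] ℝ) →L[ℝ] EuclideanSpace ℝ (Fin m))
        (E := fun x : Q => Cotan m x →L[ℝ] Tan m x) x (S x)) q₀ := by
  rw [contMDiffAt_hom_bundle]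
  refine ⟨contMDiffAt_id, ?_⟩
  -- The matrix of `S` in the bundle trivializations at `q₀` has entries `⟨dxᵢ, S dxⱼ⟩`, which are
  -- the functions assumed smooth.
  have key : ∀ᶠ q in 𝓝 q₀, ∀ i j : Fin m, ContinuousLinearMap.inCoordinates
      (EuclideanSpace ℝ (Fin m) →L[ℝ] ℝ) (fun x : Q => Cotan m x)
      (EuclideanSpace ℝ (Fin m)) (fun x : Q => Tan m x) q₀ q q₀ q (S q) (EuclideanSpace.proj j) i =
        diff (chartCoord q₀ i) q (S q (diff (chartCoord q₀ j) q)) := by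
    filter_upwards [(chartAt (EuclideanSpace ℝ (Fin m)) q₀).open_source.mem_nhds
      (mem_chart_source _ q₀)] with q hq i j
    -- The cotangent trivialization at `q₀` turns the constant covector `proj j` into the
    -- differential of the `j`-th coordinate.
    have h1 : ((trivializationAt (EuclideanSpace ℝ (Fin m) →L[ℝ] ℝ) (fun x : Q => Cotan m x)
        q₀).symmL ℝ q (EuclideanSpace.proj j)) = diff (chartCoord q₀ j) q := by
      ext v
      have hb : q ∈ (trivializationAt (EuclideanSpace ℝ (Fin m) →L[ℝ] ℝ)
          (fun x : Q => Cotan m x) q₀).baseSet := by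
        rw [hom_trivializationAt_baseSet]
        exact ⟨hq, mem_univ _⟩
      rw [Trivialization.symmL_apply _ hb, mvfderiv_chartCoord hq]
      have h2 := Pretrivialization.continuousLinearMap_symm_apply' (RingHom.id ℝ)
        (e₁ := trivializationAt (EuclideanSpace ℝ (Fin m)) (fun x : Q => Tan m x) q₀)
        (e₂ := trivializationAt ℝ (Trivial Q ℝ) q₀) (b := q) ⟨hq, mem_univ _⟩
        (EuclideanSpace.proj j)
      rw [TangentBundle.continuousLinearMapAt_trivializationAt hq] at h2
      refine (DFunLike.congr_fun h2 v).trans ?_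
      simp
      rfl
    rw [ContinuousLinearMap.inCoordinates]
    simp only [ContinuousLinearMap.comp_apply]
    rw [h1, TangentBundle.continuousLinearMapAt_trivializationAt hq]
    exact (mvfderiv_chartCoord hq i _).symm
  have h2 : ∀ i j : Fin m, ContMDiffAt (𝓡 m) 𝓘(ℝ, ℝ) ∞ (fun q => ContinuousLinearMap.inCoordinates
      (EuclideanSpace ℝ (Fin m) →L[ℝ] ℝ) (fun x : Q => Cotan m x)
      (EuclideanSpace ℝ (Fin m)) (fun x : Q => Tan m x) q₀ q q₀ q (S q) (EuclideanSpace.proj j) i)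
      q₀ :=
    fun i j => (h i j).congr_of_eventuallyEq (key.mono fun q hq => hq i j)
  refine (ContMDiffAt.congr_of_eventuallyEq ?_ (.of_forall fun q => eq_sum_clm _))
  refine ContMDiffAt.sum fun i _ => ContMDiffAt.sum fun j _ => ?_
  exact (h2 i j).smul contMDiffAt_const

end

end DiracReduction

namespace DiracReduction

open Filter Topology VectorField

/-! ### Pushing a Poisson structure forward to a quotient -/

section

variable {n m : ℕ} {P Q : Type*} [TopologicalSpace P] [ChartedSpace (EuclideanSpace ℝ (Fin n)) P]
  [TopologicalSpace Q] [ChartedSpace (EuclideanSpace ℝ (Fin m)) Q]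

/-- The differential of a map between manifolds, as a linear map between the model spaces. -/
noncomputable def dmap (n m : ℕ) {P Q : Type*} [TopologicalSpace P]
    [ChartedSpace (EuclideanSpace ℝ (Fin n)) P] [TopologicalSpace Q]
    [ChartedSpace (EuclideanSpace ℝ (Fin m)) Q] (p : P → Q) (x : P) :
    EuclideanSpace ℝ (Fin n) →L[ℝ] EuclideanSpace ℝ (Fin m) :=
  mfderiv (𝓡 n) (𝓡 m) p x

theorem diff_comp {f : Q → ℝ} {p : P → Q} {x : P} {q : Q} (hq : p x = q)
    (hf : MDifferentiableAt (𝓡 m) 𝓘(ℝ, ℝ) f q) (hp : MDifferentiableAt (𝓡 n) (𝓡 m) p x) :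
    (diff (f ∘ p) x : Cotan n x) = (diff f q : Cotan m q).comp (dmap n m p x) := by
  subst hq
  exact mvfderiv_comp x hf hp

theorem IsQuotientManifold.diff_comp_mem {D : ∀ x : P, Submodule ℝ (Tan n x)} {U : Set P}
    (hU : IsOpen U) {p : P → Q}
    (hq : IsQuotientManifold (m := m) D U p) {x : P} (hx : x ∈ U) {f : Q → ℝ}
    (hf : MDifferentiableAt (𝓡 m) 𝓘(ℝ, ℝ) f (p x)) :
    (diff (f ∘ p) x : Cotan n x) ∈ annihilator D x := by
  intro v hv
  rw [diff_comp rfl hf ((hq.smooth.contMDiffAt (hU.mem_nhds hx)).mdifferentiableAt (by simp))]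
  rw [← hq.ker_eq x hx] at hv
  have : dmap n m p x v = 0 := hv
  exact (congrArg (diff f (p x) : Cotan m (p x)) this).trans
    (map_zero (diff f (p x) : Cotan m (p x)))

variable [IsManifold (𝓡 n) ∞ P]

/-- The bivector `p_* π` at the image of `x`. -/
noncomputable def pushSharp (πP : PoissonStructure n P) (p : P → Q) (x : P) :
    (EuclideanSpace ℝ (Fin m) →L[ℝ] ℝ) →L[ℝ] EuclideanSpace ℝ (Fin m) :=
  dmap n m p x ∘L (πP.sharp x :
    (EuclideanSpace ℝ (Fin n) →L[ℝ] ℝ) →L[ℝ] EuclideanSpace ℝ (Fin n)) ∘L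
    ContinuousLinearMap.precomp ℝ (dmap n m p x)

theorem bracket_comp (πP : PoissonStructure n P) {p : P → Q} {x : P} {q : Q} (hq : p x = q)
    {f g : Q → ℝ} (hf : MDifferentiableAt (𝓡 m) 𝓘(ℝ, ℝ) f q)
    (hg : MDifferentiableAt (𝓡 m) 𝓘(ℝ, ℝ) g q) (hp : MDifferentiableAt (𝓡 n) (𝓡 m) p x) :
    πP.bracket (f ∘ p) (g ∘ p) x =
      (diff g q : Cotan m q) (pushSharp πP p x (diff f q : Cotan m q)) := by
  rw [PoissonStructure.bracket, diff_comp hq hf hp, diff_comp hq hg hp]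
  rfl

theorem PoissonStructure.bracket_congr (πP : PoissonStructure n P) {f f' g g' : P → ℝ} {x : P}
    (hf : f =ᶠ[𝓝 x] f') (hg : g =ᶠ[𝓝 x] g') : πP.bracket f g x = πP.bracket f' g' x := by
  simp only [PoissonStructure.bracket, diff_congr hf, diff_congr hg]

theorem PoissonStructure.bracket_congr_eventually (πP : PoissonStructure n P) {f f' g g' : P → ℝ}
    {x : P} (hf : f =ᶠ[𝓝 x] f') (hg : g =ᶠ[𝓝 x] g') : πP.bracket f g =ᶠ[𝓝 x] πP.bracket f' g' := by
  filter_upwards [hf.eventuallyEq_nhds, hg.eventuallyEq_nhds] with y hy hy'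
  exact πP.bracket_congr hy hy'

theorem PoissonStructure.jacobi_bracket (πP : PoissonStructure n P) {f g h : P → ℝ}
    (hf : ContMDiff (𝓡 n) 𝓘(ℝ, ℝ) ∞ f) (hg : ContMDiff (𝓡 n) 𝓘(ℝ, ℝ) ∞ g)
    (hh : ContMDiff (𝓡 n) 𝓘(ℝ, ℝ) ∞ h) (x : P) :
    πP.bracket f (πP.bracket g h) x + πP.bracket g (πP.bracket h f) x +
      πP.bracket h (πP.bracket f g) x = 0 :=
  πP.jacobi f g h hf hg hh x

variable [T2Space P] [IsManifold (𝓡 m) ∞ Q] [T2Space Q]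

/-- A Poisson structure descends to the quotient by `D` if the brackets of basic functions are
locally constant along `D`. -/
theorem exists_poissonStructure_quotient (πP : PoissonStructure n P)
    {D : ∀ x : P, Submodule ℝ (Tan n x)} {U : Set P} (hU : IsOpen U) {p : P → Q}
    (hq : IsQuotientManifold (m := m) D U p)
    (hD : ∀ f g : Q → ℝ, ContMDiff (𝓡 m) 𝓘(ℝ, ℝ) ∞ f → ContMDiff (𝓡 m) 𝓘(ℝ, ℝ) ∞ g →
      ∀ x ∈ U, ∀ v ∈ D x, (diff (πP.bracket (f ∘ p) (g ∘ p)) x : Cotan n x) v = 0) :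
    ∃ πQ : PoissonStructure m Q, IsPoissonMapOn πP πQ U p := by
  have hps : ∀ x ∈ U, ContMDiffAt (𝓡 n) (𝓡 m) ∞ p x := fun x hx =>
    hq.smooth.contMDiffAt (hU.mem_nhds hx)
  have hpd : ∀ x ∈ U, MDifferentiableAt (𝓡 n) (𝓡 m) p x := fun x hx =>
    (hps x hx).mdifferentiableAt (by simp)
  have hbs : ∀ f g : Q → ℝ, ContMDiff (𝓡 m) 𝓘(ℝ, ℝ) ∞ f → ContMDiff (𝓡 m) 𝓘(ℝ, ℝ) ∞ g →
      ∀ x ∈ U, ContMDiffAt (𝓡 n) 𝓘(ℝ, ℝ) ∞ (πP.bracket (f ∘ p) (g ∘ p)) x :=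
    fun f g hf hg x hx => πP.bracket_smoothAt ((hf _).comp x (hps x hx)) ((hg _).comp x (hps x hx))
  -- Points of a fibre are joined by a curve tangent to `D`, along which the bracket has zero
  -- derivative by `hD`.
  have hconst : ∀ f g : Q → ℝ, ContMDiff (𝓡 m) 𝓘(ℝ, ℝ) ∞ f → ContMDiff (𝓡 m) 𝓘(ℝ, ℝ) ∞ g →
      ∀ x ∈ U, ∀ y ∈ U, p x = p y →
        πP.bracket (f ∘ p) (g ∘ p) x = πP.bracket (f ∘ p) (g ∘ p) y := by
    intro f g hf hg x hx y hy hxy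
    obtain ⟨γ, hγ, rfl, rfl, h⟩ := (hq.fibre x hx y hy).1 hxy
    have h1 : ∀ t, HasFDerivAt (fun t => πP.bracket (f ∘ p) (g ∘ p) (γ t)) (0 : ℝ →L[ℝ] ℝ) t := by
      intro t
      have h2 := (hbs f g hf hg _ (h t).1).comp t (hγ t)
      have h3 := (h2.contDiffAt.differentiableAt (by simp)).hasFDerivAt
      refine h3.congr_fderiv ?_
      ext1
      rw [← mfderiv_eq_fderiv, mfderiv_comp t
        ((hbs f g hf hg _ (h t).1).mdifferentiableAt (by simp))
        ((hγ t).mdifferentiableAt (by simp))]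
      exact hD f g hf hg _ (h t).1 _ (h t).2
    exact is_const_of_fderiv_eq_zero (fun t => (h1 t).differentiableAt) (fun t => (h1 t).fderiv) 0 1
  have hsec : ∀ q : Q, ∃ x ∈ U, p x = q := fun q => by
    have : q ∈ p '' U := hq.surjective ▸ mem_univ q
    exact this
  choose s hsU hs using hsec
  -- The bivector is pushed forward from an arbitrarily chosen point of each fibre. The section `s`
  -- need not be continuous: by `hconst` the brackets do not depend on it, and smoothness is
  -- recovered by descending functions along the submersion.
  let S : ∀ q : Q, Cotan m q →L[ℝ] Tan m q := fun q => pushSharp πP p (s q)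
  have hS : ∀ (f g : Q → ℝ), ContMDiff (𝓡 m) 𝓘(ℝ, ℝ) ∞ f → ContMDiff (𝓡 m) 𝓘(ℝ, ℝ) ∞ g →
      ∀ x ∈ U, πP.bracket (f ∘ p) (g ∘ p) x =
        (diff g (p x) : Cotan m (p x)) (S (p x) (diff f (p x))) := by
    intro f g hf hg x hx
    rw [hconst f g hf hg x hx (s (p x)) (hsU _) (hs _).symm]
    exact bracket_comp πP (hs _) (hf.mdifferentiableAt (by simp)) (hg.mdifferentiableAt (by simp))
      (hpd _ (hsU _))
  let br : (Q → ℝ) → (Q → ℝ) → Q → ℝ := fun f g x => diff (n := m) g x (S x (diff f x))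
  have hbr : ∀ f g : Q → ℝ, ContMDiff (𝓡 m) 𝓘(ℝ, ℝ) ∞ f → ContMDiff (𝓡 m) 𝓘(ℝ, ℝ) ∞ g →
      EqOn (br f g ∘ p) (πP.bracket (f ∘ p) (g ∘ p)) U := fun f g hf hg x hx =>
    (hS f g hf hg x hx).symm
  have hbrs : ∀ f g : Q → ℝ, ContMDiff (𝓡 m) 𝓘(ℝ, ℝ) ∞ f → ContMDiff (𝓡 m) 𝓘(ℝ, ℝ) ∞ g →
      ContMDiff (𝓡 m) 𝓘(ℝ, ℝ) ∞ (br f g) := fun f g hf hg =>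
    contMDiff_of_comp_submersion hU hq.smooth hq.submersion hq.surjective fun x hx =>
      ((hbs f g hf hg x hx).contMDiffWithinAt).congr (hbr f g hf hg) (hbr f g hf hg hx)
  refine ⟨⟨S, fun q₀ => contMDiffAt_sharp fun i j => ?_, fun q α β => ?_, ?_⟩, hq.smooth, hS⟩
  -- The matrix entries of `S` are, near `q₀`, brackets of cut-off coordinate functions, and these
  -- are smooth by `hbrs`.
  · obtain ⟨f, hf, hf'⟩ := exists_global_function
      (chartAt (EuclideanSpace ℝ (Fin m)) q₀).open_source (mem_chart_source _ q₀)
      (contMDiffOn_chartCoord q₀ j)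
    obtain ⟨g, hg, hg'⟩ := exists_global_function
      (chartAt (EuclideanSpace ℝ (Fin m)) q₀).open_source (mem_chart_source _ q₀)
      (contMDiffOn_chartCoord q₀ i)
    refine (hbrs f g hf hg q₀).congr_of_eventuallyEq ?_
    filter_upwards [hf'.eventuallyEq_nhds, hg'.eventuallyEq_nhds] with q h1 h2
    simp only [br]
    rw [diff_congr h1, diff_congr h2]
  · exact πP.skew (s q)
      (ContinuousLinearMap.comp (show EuclideanSpace ℝ (Fin m) →L[ℝ] ℝ from α) (dmap n m p (s q)))
      (ContinuousLinearMap.comp (show EuclideanSpace ℝ (Fin m) →L[ℝ] ℝ from β) (dmap n m p (s q)))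
  · intro f g h hf hg hh
    change ∀ x, br f (br g h) x + br g (br h f) x + br h (br f g) x = 0
    intro q
    obtain ⟨x, hx, rfl⟩ : q ∈ p '' U := hq.surjective ▸ mem_univ q
    -- The Jacobi identity on `P` is stated for globally smooth functions, while `f ∘ p` is smooth
    -- only on `U`; a global function with the same germ at `x` suffices.
    have hext : ∀ f : Q → ℝ, ContMDiff (𝓡 m) 𝓘(ℝ, ℝ) ∞ f →
        ∃ f' : P → ℝ, ContMDiff (𝓡 n) 𝓘(ℝ, ℝ) ∞ f' ∧ f' =ᶠ[𝓝 x] f ∘ p := fun f hf =>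
      exists_global_function hU hx (hf.comp_contMDiffOn hq.smooth)
    obtain ⟨f', hf1, hf2⟩ := hext f hf
    obtain ⟨g', hg1, hg2⟩ := hext g hg
    obtain ⟨h', hh1, hh2⟩ := hext h hh
    have key : ∀ {f g h : Q → ℝ} {f' g' h' : P → ℝ}, ContMDiff (𝓡 m) 𝓘(ℝ, ℝ) ∞ f →
        ContMDiff (𝓡 m) 𝓘(ℝ, ℝ) ∞ g → ContMDiff (𝓡 m) 𝓘(ℝ, ℝ) ∞ h → f' =ᶠ[𝓝 x] f ∘ p →
        g' =ᶠ[𝓝 x] g ∘ p → h' =ᶠ[𝓝 x] h ∘ p →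
        br f (br g h) (p x) = πP.bracket f' (πP.bracket g' h') x := by
      intro f g h f' g' h' hf hg hh hf2 hg2 hh2
      rw [← Function.comp_apply (f := br f (br g h)), hbr _ _ hf (hbrs _ _ hg hh) hx]
      refine πP.bracket_congr hf2.symm ?_
      refine EventuallyEq.trans ?_ (πP.bracket_congr_eventually hg2 hh2).symm
      exact eventuallyEq_of_mem (hU.mem_nhds hx) (hbr g h hg hh)
    rw [key hf hg hh hf2 hg2 hh2, key hg hh hf hg2 hh2 hf2, key hh hf hg hh2 hf2 hg2]
    exact πP.jacobi_bracket hf1 hg1 hh1 x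

end

end DiracReduction

namespace DiracReduction

open Filter Topology VectorField

/-! ### Dirac structures give integrability and a quotient Poisson structure -/

section

variable {n : ℕ} {P : Type*} [TopologicalSpace P] [ChartedSpace (EuclideanSpace ℝ (Fin n)) P]
  [IsManifold (𝓡 n) ∞ P] {D : ∀ x : P, Submodule ℝ (Tan n x)}

theorem exists_local_vField (hD : IsTanSubbundle D) {x : P} {v : Tan n x} (hv : v ∈ D x) :
    ∃ (U : Set P) (Y : VField n P), IsOpen U ∧ x ∈ U ∧ SmoothVFieldOn U Y ∧ (∀ y ∈ U, Y y ∈ D y) ∧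
      Y x = v := by
  obtain ⟨U, hU, hx, k, X, hX, hXU⟩ := hD x
  rw [← (hXU x hx).2, Submodule.mem_span_range_iff_exists_fun] at hv
  obtain ⟨c, rfl⟩ := hv
  refine ⟨U, fun y => ∑ i, c i • X i y, hU, hx, ?_, fun y hy => ?_, rfl⟩
  · exact ContMDiffOn.sum_section (V := fun x : P => Tan n x) fun i _ =>
      ContMDiffOn.smul_section (V := fun x : P => Tan n x) (f := fun _ => c i)
        contMDiffOn_const (hX i)
  · rw [← (hXU y hy).2]
    exact Submodule.sum_mem _ fun i _ =>
      Submodule.smul_mem _ _ (Submodule.subset_span ⟨i, rfl⟩)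

variable [T2Space P] {πP : PoissonStructure n P}

theorem IsDirac.isInvolutive (h : IsDirac πP (nullBundle D)) : IsInvolutive D :=
  fun _ hU _ _ hX hY hXD hYD _ hx => h.mlieBracket_mem hU hx hX hY hXD hYD

/-- The bracket of two functions which are constant along `D` is constant along `D`. -/
theorem IsDirac.diff_bracket_eq_zero (h : IsDirac πP (nullBundle D)) (hD : IsTanSubbundle D)
    {U : Set P} (hU : IsOpen U) {f g : P → ℝ} (hf : ContMDiffOn (𝓡 n) 𝓘(ℝ, ℝ) ∞ f U)
    (hg : ContMDiffOn (𝓡 n) 𝓘(ℝ, ℝ) ∞ g U) (hfD : ∀ x ∈ U, (diff f x : Cotan n x) ∈ annihilator D x)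
    (hgD : ∀ x ∈ U, (diff g x : Cotan n x) ∈ annihilator D x) {x : P} (hx : x ∈ U) {v : Tan n x}
    (hv : v ∈ D x) : (diff (πP.bracket f g) x : Cotan n x) v = 0 := by
  obtain ⟨V, Y, hV, hxV, hY, hYD, rfl⟩ := exists_local_vField hD hv
  have hfs : ∀ y ∈ U, ContMDiffAt (𝓡 n) 𝓘(ℝ, ℝ) ∞ f y := fun y hy =>
    hf.contMDiffAt (hU.mem_nhds hy)
  have hgs : ∀ y ∈ U, ContMDiffAt (𝓡 n) 𝓘(ℝ, ℝ) ∞ g y := fun y hy =>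
    hg.contMDiffAt (hU.mem_nhds hy)
  -- `df` and `dg` lie in `D^⊥`, hence so does `[df, dg]`; its value on `Y` will be identified with
  -- `Y{f, g}`.
  have h1 := h.formBracket_mem (ξ := diff f) (η := diff g) hU hx
    (fun y hy => (oneFormSmoothAt_diff (hfs y hy)).contMDiffWithinAt)
    (fun y hy => (oneFormSmoothAt_diff (hgs y hy)).contMDiffWithinAt) hfD hgD (Y x) (hYD x hxV)
  have hYx : VFieldDiffAt Y x := (VFieldSmoothAt.diffAt (hY.contMDiffAt (hV.mem_nhds hxV)))
  have hz : ∀ f : P → ℝ, (∀ x ∈ U, (diff f x : Cotan n x) ∈ annihilator D x) →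
      (fun y => (diff f y : Cotan n y) (Y y)) =ᶠ[𝓝 x] 0 := fun f hfD => by
    filter_upwards [hU.mem_nhds hx, hV.mem_nhds hxV] with y hy hy'
    exact hfD y hy _ (hYD y hy')
  have e1 := diff_congr (n := n) (hz f hfD)
  have e2 := diff_congr (n := n) (hz g hgD)
  rw [diff_zero] at e1 e2
  have e3 := πP.cob_diff (hfs x hx) (hgs x hx) hYx
  have e4 := πP.formBracket_apply (oneFormSmoothAt_diff (hfs x hx)).diffAt
    (oneFormSmoothAt_diff (hgs x hx)).diffAt hYx
  have e5 : pairing (diff f) Y = fun y => (diff f y : Cotan n y) (Y y) := rfl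
  have e6 : pairing (diff g) Y = fun y => (diff g y : Cotan n y) (Y y) := rfl
  rw [h1, e3, e5, e6, e1, e2] at e4
  simpa using e4.symm

theorem IsDirac.exists_poissonStructure_quotient (h : IsDirac πP (nullBundle D))
    (hD : IsTanSubbundle D) {m : ℕ} {Q : Type*} [TopologicalSpace Q]
    [ChartedSpace (EuclideanSpace ℝ (Fin m)) Q] [IsManifold (𝓡 m) ∞ Q] [T2Space Q] {U : Set P}
    (hU : IsOpen U) {p : P → Q} (hq : IsQuotientManifold (m := m) D U p) :
    ∃ πQ : PoissonStructure m Q, IsPoissonMapOn πP πQ U p := by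
  refine DiracReduction.exists_poissonStructure_quotient πP hU hq fun f g hf hg x hx v hv => ?_
  exact h.diff_bracket_eq_zero hD hU (hf.comp_contMDiffOn hq.smooth) (hg.comp_contMDiffOn hq.smooth)
    (fun y hy => hq.diff_comp_mem hU hy (hf.mdifferentiableAt (by simp)))
    (fun y hy => hq.diff_comp_mem hU hy (hg.mdifferentiableAt (by simp))) hx hv

theorem IsDirac.exists_isFoliatedChart (h : IsDirac πP (nullBundle D)) (hD : IsTanSubbundle D)
    (x₀ : P) : ∃ (k m : ℕ) (e : OpenPartialHomeomorph P
      (EuclideanSpace ℝ (Fin k) × EuclideanSpace ℝ (Fin m))),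
      x₀ ∈ e.source ∧ e x₀ = 0 ∧ IsFoliatedChart D e := by
  obtain ⟨k, m, e, h1, h2, h3, h4, h5, h6⟩ := exists_foliated_chart hD h.isInvolutive x₀
  exact ⟨k, m, e, h1, h2, h3, h4, h5, h6⟩

theorem IsDirac.isIntegrableDistribution (h : IsDirac πP (nullBundle D)) (hD : IsTanSubbundle D) :
    IsIntegrableDistribution D := by
  intro x₀
  obtain ⟨k, m, e, h1, h2, he⟩ := h.exists_isFoliatedChart hD x₀
  exact he.exists_integralManifold h1 h2

theorem IsDirac.descendsLocally (h : IsDirac πP (nullBundle D)) (hD : IsTanSubbundle D) :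
    DescendsLocally πP D := by
  intro x₀
  obtain ⟨k, m, e, h1, h2, he⟩ := h.exists_isFoliatedChart hD x₀
  exact ⟨e.source, e.open_source, h1, m, EuclideanSpace ℝ (Fin m), inferInstance, inferInstance,
    inferInstance, inferInstance, fun x => (e x).2, he.isQuotientManifold,
    h.exists_poissonStructure_quotient hD e.open_source he.isQuotientManifold⟩

end

end DiracReduction

namespace DiracReduction

open Filter Topology VectorField

/-! ### From a basic frame to a Dirac structure -/

section

variable {n : ℕ} {P : Type*} [TopologicalSpace P] [ChartedSpace (EuclideanSpace ℝ (Fin n)) P]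
  {D : ∀ x : P, Submodule ℝ (Tan n x)}

theorem diff_pairing_eq_zero {ξ : OneForm n P} {Y : VField n P} {x : P}
    (hξ : ∀ᶠ z in 𝓝 x, ξ z ∈ annihilator D z) (hY : ∀ᶠ z in 𝓝 x, Y z ∈ D z) :
    (diff (pairing ξ Y) x : Cotan n x) = 0 := by
  rw [← diff_zero (n := n) x]
  refine diff_congr ?_
  filter_upwards [hξ, hY] with z hz hz'
  exact hz _ hz'

theorem minusPairing_eq_zero {e₁ e₂ : GenSection n P} (h₁ : ∀ x, e₁ x ∈ nullBundle D x)
    (h₂ : ∀ x, e₂ x ∈ nullBundle D x) : minusPairing e₁ e₂ = 0 := by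
  ext x
  have h1 : (e₁ x).2 (e₂ x).1 = 0 := (h₁ x).2 _ (h₂ x).1
  have h2 : (e₂ x).2 (e₁ x).1 = 0 := (h₂ x).2 _ (h₁ x).1
  simp [minusPairing, h1, h2]

theorem isIsotropic_nullBundle (x : P) : IsIsotropic (nullBundle D x) := by
  intro a ha b hb
  have h1 : a.2 b.1 = 0 := ha.2 _ hb.1
  have h2 : b.2 a.1 = 0 := hb.2 _ ha.1
  simp [plusPairing, h1, h2]

end

section

variable {n : ℕ} {P : Type*} [TopologicalSpace P] [ChartedSpace (EuclideanSpace ℝ (Fin n)) P]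
  [IsManifold (𝓡 n) ∞ P] {D : ∀ x : P, Submodule ℝ (Tan n x)} {πP : PoissonStructure n P}

/-- Independent functions `y₁, …, yₘ` on `U` whose common level sets are tangent to `D`, and whose
brackets are constant along `D`. -/
structure IsBasicFrame (πP : PoissonStructure n P) (D : ∀ x : P, Submodule ℝ (Tan n x))
    (U : Set P) {m : ℕ} (y : Fin m → P → ℝ) : Prop where
  isOpen : IsOpen U
  smooth : ∀ i, ContMDiffOn (𝓡 n) 𝓘(ℝ, ℝ) ∞ (y i) U
  linearIndependent : ∀ x ∈ U, LinearIndependent ℝ fun i => (diff (y i) x : Cotan n x)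
  mem_iff : ∀ x ∈ U, ∀ v, v ∈ D x ↔ ∀ i, (diff (y i) x : Cotan n x) v = 0
  bracket : ∀ i j, ∀ x ∈ U, ∀ v ∈ D x, (diff (πP.bracket (y i) (y j)) x : Cotan n x) v = 0

namespace IsBasicFrame

variable {U : Set P} {m : ℕ} {y : Fin m → P → ℝ} {x : P}

theorem smoothAt (h : IsBasicFrame πP D U y) (hx : x ∈ U) (i : Fin m) :
    ContMDiffAt (𝓡 n) 𝓘(ℝ, ℝ) ∞ (y i) x := (h.smooth i).contMDiffAt (h.isOpen.mem_nhds hx)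

theorem diff_mem (h : IsBasicFrame πP D U y) (hx : x ∈ U) (i : Fin m) :
    (diff (y i) x : Cotan n x) ∈ annihilator D x := fun v hv => (h.mem_iff x hx v).1 hv i

/-- `D` is the common kernel of finitely many functionals, and a functional vanishing on such a
kernel is a combination of them. -/
theorem annihilator_eq (h : IsBasicFrame πP D U y) (hx : x ∈ U) :
    annihilator D x = Submodule.span ℝ (range fun i => (diff (y i) x : Cotan n x)) := by
  apply le_antisymm
  · intro ξ hξ
    have h1 : ξ.toLinearMap ∈ Submodule.span ℝ
        (range fun i => (diff (y i) x : Cotan n x).toLinearMap) := by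
      refine mem_span_of_iInf_ker_le_ker fun v hv => ?_
      refine hξ v ((h.mem_iff x hx v).2 fun i => ?_)
      exact (Submodule.mem_iInf _).1 hv i
    rw [Submodule.mem_span_range_iff_exists_fun] at h1 ⊢
    obtain ⟨c, hc⟩ := h1
    refine ⟨c, ?_⟩
    ext v
    simpa using LinearMap.congr_fun hc v
  · rw [Submodule.span_le]
    rintro _ ⟨i, rfl⟩
    exact h.diff_mem hx i

theorem eventually_eq_zero (h : IsBasicFrame πP D U y) (hx : x ∈ U) {Y : VField n P}
    (hYD : ∀ᶠ z in 𝓝 x, Y z ∈ D z) (i : Fin m) :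
    (fun z => (diff (y i) z : Cotan n z) (Y z)) =ᶠ[𝓝 x] 0 := by
  filter_upwards [hYD, h.isOpen.mem_nhds hx] with z hz hz'
  exact h.diff_mem hz' i _ hz

/-- Near `x` both fields annihilate every `yᵢ`, hence so does their commutator, and `D` is the
common kernel of the `dyᵢ`. -/
theorem mlieBracket_mem (h : IsBasicFrame πP D U y) (hx : x ∈ U) {X Y : VField n P}
    (hX : VFieldDiffAt X x) (hY : VFieldDiffAt Y x) (hXD : ∀ᶠ z in 𝓝 x, X z ∈ D z)
    (hYD : ∀ᶠ z in 𝓝 x, Y z ∈ D z) : mlieBracket (𝓡 n) X Y x ∈ D x := by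
  have h2 : (2 : ℕ∞ω) ≤ ∞ := WithTop.coe_le_coe.2 (le_top : (2 : ℕ∞) ≤ ⊤)
  rw [h.mem_iff x hx]
  intro i
  have e1 := diff_congr (n := n) (h.eventually_eq_zero hx hXD i)
  have e2 := diff_congr (n := n) (h.eventually_eq_zero hx hYD i)
  rw [diff_zero] at e1 e2
  simp only [diff] at e1 e2
  rw [(mvfderiv_mlieBracket ((h.smoothAt hx i).of_le h2) hX hY).2, e1, e2]
  simp

/-- By tensoriality in each form, only the values on the spanning covectors `dyᵢ`, `dyⱼ` matter, and
there `cob` reduces to `Y{yᵢ, yⱼ} = 0`. Membership of `ξ` and `η` in `D^⊥` is needed only at the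
point. -/
theorem cob_eq_zero (h : IsBasicFrame πP D U y) (hx : x ∈ U) {ξ η : OneForm n P} {Y : VField n P}
    (hξ : OneFormDiffAt ξ x) (hη : OneFormDiffAt η x) (hY : VFieldDiffAt Y x)
    (hYD : ∀ᶠ z in 𝓝 x, Y z ∈ D z) (hξD : ξ x ∈ annihilator D x) (hηD : η x ∈ annihilator D x) :
    πP.cob ξ η Y x = 0 := by
  have hdy : ∀ i, OneFormDiffAt (n := n) (diff (y i)) x := fun i =>
    (oneFormSmoothAt_diff (h.smoothAt hx i)).diffAt
  have h1 : ∀ i j, πP.cob (diff (y i)) (diff (y j)) Y x = 0 := by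
    intro i j
    have e1 := diff_congr (n := n) (h.eventually_eq_zero hx hYD i)
    have e2 := diff_congr (n := n) (h.eventually_eq_zero hx hYD j)
    rw [diff_zero] at e1 e2
    rw [πP.cob_diff (h.smoothAt hx i) (h.smoothAt hx j) hY, e1, e2,
      h.bracket i j x hx _ hYD.self_of_nhds]
    simp
  have h2 : ∀ i, πP.cob (diff (y i)) η Y x = 0 := by
    intro i
    have ht := πP.cob_tensorial_right (Y := Y) (hdy i)
    have hle : annihilator D x ≤ (TensorialAt.mkHom _ x ht).toLinearMap.ker := by
      rw [h.annihilator_eq hx, Submodule.span_le]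
      rintro _ ⟨j, rfl⟩
      exact (TensorialAt.mkHom_apply ht (hdy j)).trans (h1 i j)
    exact (TensorialAt.mkHom_apply ht hη).symm.trans (hle hηD)
  have ht := πP.cob_tensorial_left (Y := Y) hη
  have hle : annihilator D x ≤ (TensorialAt.mkHom _ x ht).toLinearMap.ker := by
    rw [h.annihilator_eq hx, Submodule.span_le]
    rintro _ ⟨j, rfl⟩
    exact (TensorialAt.mkHom_apply ht (hdy j)).trans (h2 j)
  exact (TensorialAt.mkHom_apply ht hξ).symm.trans (hle hξD)

end IsBasicFrame

namespace IsBasicFrame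

variable {U : Set P} {m : ℕ} {y : Fin m → P → ℝ} {x : P}

theorem formBracket_mem (h : IsBasicFrame πP D U y) (hD : IsTanSubbundle D) (hx : x ∈ U)
    {ξ η : OneForm n P} (hξ : OneFormDiffAt ξ x) (hη : OneFormDiffAt η x)
    (hξD : ∀ᶠ z in 𝓝 x, ξ z ∈ annihilator D z) (hηD : ∀ᶠ z in 𝓝 x, η z ∈ annihilator D z) :
    πP.formBracket ξ η x ∈ annihilator D x := by
  intro v hv
  obtain ⟨V, Y, hV, hxV, hY, hYD, rfl⟩ := exists_local_vField hD hv
  have hYx : VFieldDiffAt Y x := (VFieldSmoothAt.diffAt (hY.contMDiffAt (hV.mem_nhds hxV)))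
  have hYD' : ∀ᶠ z in 𝓝 x, Y z ∈ D z := eventually_of_mem (hV.mem_nhds hxV) hYD
  rw [πP.formBracket_apply hξ hη hYx, diff_pairing_eq_zero hξD hYD', diff_pairing_eq_zero hηD hYD',
    h.cob_eq_zero hx hξ hη hYx hYD' hξD.self_of_nhds hηD.self_of_nhds]
  simp

theorem lieDerivForm_mem (h : IsBasicFrame πP D U y) (hD : IsTanSubbundle D) (hx : x ∈ U)
    {X : VField n P} {ξ : OneForm n P} (hX : VFieldDiffAt X x) (hξ : OneFormDiffAt ξ x)
    (hXD : ∀ᶠ z in 𝓝 x, X z ∈ D z) (hξD : ∀ᶠ z in 𝓝 x, ξ z ∈ annihilator D z) :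
    lieDerivForm X ξ x ∈ annihilator D x := by
  intro v hv
  obtain ⟨V, Y, hV, hxV, hY, hYD, rfl⟩ := exists_local_vField hD hv
  have hYx : VFieldDiffAt Y x := (VFieldSmoothAt.diffAt (hY.contMDiffAt (hV.mem_nhds hxV)))
  have hYD' : ∀ᶠ z in 𝓝 x, Y z ∈ D z := eventually_of_mem (hV.mem_nhds hxV) hYD
  rw [lieDerivForm_apply X ξ x Y hYx hξ, diff_pairing_eq_zero hξD hYD',
    hξD.self_of_nhds _ (h.mlieBracket_mem hx hX hYx hXD hYD')]
  simp

theorem lieDerivVField_mem (h : IsBasicFrame πP D U y) (hx : x ∈ U)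
    {X : VField n P} {ξ : OneForm n P} (hX : VFieldDiffAt X x) (hξ : OneFormDiffAt ξ x)
    (hXD : ∀ᶠ z in 𝓝 x, X z ∈ D z) (hξD : ∀ᶠ z in 𝓝 x, ξ z ∈ annihilator D z) :
    πP.lieDerivVField ξ X x ∈ D x := by
  have hext : ∀ η : Cotan n x, OneFormDiffAt (extendCotan η) x := fun η =>
    FiberBundle.mdifferentiableAt_extend (V := fun x : P => Cotan n x) _ _ _
  have hext' : ∀ η : Cotan n x, extendCotan η x = η := fun η => by simp [extendCotan]
  have ht := πP.cob_tensorial_right (Y := X) hξ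
  -- The term `(π♯ξ)⟨X, η⟩` cancels against the same term in `⟨X, [ξ, η]⟩`, and `⟨ξ, X⟩ = 0`, so
  -- what remains of `⟨L_ξ X, η⟩` is `-cob ξ η X`, linear in the value of `η`.
  have key : πP.lieDerivVField ξ X x =
      toVector x (-(TensorialAt.mkHom _ x ht).toLinearMap) := by
    rw [PoissonStructure.lieDerivVField]
    congr 1
    ext η
    rw [πP.formBracket_apply hξ (hext η) hX, diff_pairing_eq_zero hξD hXD]
    have : TensorialAt.mkHom _ x ht η = πP.cob ξ (extendCotan η) X x := rfl
    simp [this]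
  rw [key, h.mem_iff x hx]
  intro i
  rw [apply_toVector]
  have : TensorialAt.mkHom _ x ht (diff (y i) x : Cotan n x) =
    πP.cob ξ (extendCotan (diff (y i) x)) X x := rfl
  simp only [LinearMap.neg_apply, ContinuousLinearMap.coe_coe, this]
  rw [h.cob_eq_zero hx hξ (hext _) hX hXD hξD.self_of_nhds (by rw [hext']; exact h.diff_mem hx i),
    neg_zero]

/-- Pairing an element of `W` with `(0, dyᵢ)` forces its vector part into `D`; pairing it with `(v,
0)` for `v` in `D` forces its covector part into `D^⊥`. -/
theorem nullBundle_maximal (h : IsBasicFrame πP D U y) (hx : x ∈ U)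
    {W : Submodule ℝ (Tan n x × Cotan n x)} (hW : IsIsotropic W) (hle : nullBundle D x ≤ W) :
    W = nullBundle D x := by
  refine le_antisymm (fun a ha => ⟨?_, ?_⟩) hle
  · refine (h.mem_iff x hx _).2 fun i => ?_
    have h1 := hW (0, diff (y i) x) (hle ⟨Submodule.zero_mem _, h.diff_mem hx i⟩) a ha
    simpa [plusPairing] using h1
  · intro v hv
    have h1 := hW a ha (v, 0) (hle ⟨hv, Submodule.zero_mem _⟩)
    simpa [plusPairing] using h1

theorem exists_frame_nullBundle (h : IsBasicFrame πP D U y) (hD : IsTanSubbundle D) (hx : x ∈ U) :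
    ∃ U : Set P, IsOpen U ∧ x ∈ U ∧ ∃ (k : ℕ) (e : Fin k → GenSection n P),
      (∀ i, SmoothGenSectionOn U (e i)) ∧
      ∀ z ∈ U, LinearIndependent ℝ (fun i => e i z) ∧
        Submodule.span ℝ (range fun i => e i z) = nullBundle D z := by
  obtain ⟨V, hV, hxV, k, X, hX, hXV⟩ := hD x
  let e : Fin k ⊕ Fin m → GenSection n P :=
    Sum.elim (fun i z => (X i z, 0)) (fun j z => (0, diff (y j) z))
  have hes : ∀ i, SmoothGenSectionOn (U ∩ V) (e i) := by
    rintro (i | j)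
    · exact ⟨(hX i).mono inter_subset_right,
        (contMDiff_zeroSection ℝ fun x : P => Cotan n x).contMDiffOn⟩
    · exact ⟨(contMDiff_zeroSection ℝ fun x : P => Tan n x).contMDiffOn,
        fun z hz => (oneFormSmoothAt_diff (h.smoothAt hz.1 j)).contMDiffWithinAt⟩
  refine ⟨U ∩ V, h.isOpen.inter hV, ⟨hx, hxV⟩, k + m, fun i => e (finSumFinEquiv.symm i),
    fun i => hes _, ?_⟩
  · rintro z ⟨hzU, hzV⟩
    have he : (fun i => e i z) = Sum.elim (LinearMap.inl ℝ (Tan n z) (Cotan n z) ∘ fun i => X i z)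
        (LinearMap.inr ℝ (Tan n z) (Cotan n z) ∘ fun j => (diff (y j) z : Cotan n z)) := by
      ext1 i
      rcases i with i | j <;> rfl
    constructor
    · have h1 : LinearIndependent ℝ (fun i => e i z) := by
        rw [he]
        exact linearIndependent_inl_union_inr' (hXV z hzV).1 (h.linearIndependent z hzU)
      exact h1.comp _ finSumFinEquiv.symm.injective
    · have h1 : range (fun i => e (finSumFinEquiv.symm i) z) = range fun i => e i z :=
        finSumFinEquiv.symm.surjective.range_comp fun i => e i z
      rw [h1, he, Sum.elim_range, Submodule.span_union, range_comp, range_comp,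
        Submodule.span_image, Submodule.span_image, (hXV z hzV).2, ← h.annihilator_eq hzU,
        Submodule.map_inl, Submodule.map_inr, Submodule.prod_sup_prod, sup_bot_eq, bot_sup_eq]
      rfl

end IsBasicFrame

/-- Since `(e₁, e₂)₋ = 0`, the terms `d` and `d_*` drop out, and each of the six remaining terms of
the bracket lies in `D` or `D^⊥` separately. -/
theorem isDirac_of_isBasicFrame (hD : IsTanSubbundle D)
    (h : ∀ x₀ : P, ∃ (U : Set P) (m : ℕ) (y : Fin m → P → ℝ), x₀ ∈ U ∧ IsBasicFrame πP D U y) :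
    IsDirac πP (nullBundle D) where
  subbundle x₀ := by
    obtain ⟨U, m, y, hx, h⟩ := h x₀
    exact h.exists_frame_nullBundle hD hx
  isotropic := isIsotropic_nullBundle
  maximal x W hW hle := by
    obtain ⟨U, m, y, hx, h⟩ := h x
    exact h.nullBundle_maximal hx hW hle
  integrable e₁ e₂ he₁ he₂ h₁ h₂ x := by
    obtain ⟨U, m, y, hx, h⟩ := h x
    have hX₁ : VFieldDiffAt (fun x => (e₁ x).1) x :=
      VFieldSmoothAt.diffAt (he₁.1.contMDiffAt univ_mem)
    have hX₂ : VFieldDiffAt (fun x => (e₂ x).1) x :=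
      VFieldSmoothAt.diffAt (he₂.1.contMDiffAt univ_mem)
    have hξ₁ : OneFormDiffAt (fun x => (e₁ x).2) x :=
      OneFormSmoothAt.diffAt (he₁.2.contMDiffAt univ_mem)
    have hξ₂ : OneFormDiffAt (fun x => (e₂ x).2) x :=
      OneFormSmoothAt.diffAt (he₂.2.contMDiffAt univ_mem)
    have d₁ : ∀ᶠ z in 𝓝 x, (e₁ z).1 ∈ D z := .of_forall fun z => (h₁ z).1
    have d₂ : ∀ᶠ z in 𝓝 x, (e₂ z).1 ∈ D z := .of_forall fun z => (h₂ z).1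
    have a₁ : ∀ᶠ z in 𝓝 x, (e₁ z).2 ∈ annihilator D z := .of_forall fun z => (h₁ z).2
    have a₂ : ∀ᶠ z in 𝓝 x, (e₂ z).2 ∈ annihilator D z := .of_forall fun z => (h₂ z).2
    simp only [courantBracket, minusPairing_eq_zero h₁ h₂, πP.dStar_zero, diff_zero]
    refine ⟨Submodule.sub_mem _ (Submodule.sub_mem _ (Submodule.add_mem _ ?_ ?_) ?_)
      (Submodule.zero_mem _), Submodule.add_mem _ (Submodule.sub_mem _ (Submodule.add_mem _ ?_ ?_)
      ?_) (Submodule.zero_mem _)⟩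
    · exact h.mlieBracket_mem hx hX₁ hX₂ d₁ d₂
    · exact h.lieDerivVField_mem hx hX₂ hξ₁ d₂ a₁
    · exact h.lieDerivVField_mem hx hX₁ hξ₂ d₁ a₂
    · exact h.formBracket_mem hD hx hξ₁ hξ₂ a₁ a₂
    · exact h.lieDerivForm_mem hD hx hX₁ hξ₂ d₁ a₂
    · exact h.lieDerivForm_mem hD hx hX₂ hξ₁ d₂ a₁

end

end DiracReduction

namespace DiracReduction

open Filter Topology VectorField

/-! ### From a quotient Poisson structure to a Dirac structure -/

section

variable {n m : ℕ} {P Q : Type*} [TopologicalSpace P] [ChartedSpace (EuclideanSpace ℝ (Fin n)) P]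
  [IsManifold (𝓡 n) ∞ P] [TopologicalSpace Q] [ChartedSpace (EuclideanSpace ℝ (Fin m)) Q]
  [IsManifold (𝓡 m) ∞ Q] {D : ∀ x : P, Submodule ℝ (Tan n x)} {πP : PoissonStructure n P}

/-- The frame consists of coordinates on `Q`, cut off to be globally smooth and pulled back by `p`.
Submersivity makes their differentials independent with common kernel `ker dp = D`, and `{fᵢ ∘ p, fⱼ
∘ p} = {fᵢ, fⱼ} ∘ p` is constant along `D` because it factors through `p`. -/
theorem exists_isBasicFrame [T2Space Q] {U : Set P} (hU : IsOpen U) {p : P → Q}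
    (hq : IsQuotientManifold (m := m) D U p) {πQ : PoissonStructure m Q}
    (hp : IsPoissonMapOn πP πQ U p) {x₀ : P} (hx₀ : x₀ ∈ U) :
    ∃ (V : Set P) (m : ℕ) (y : Fin m → P → ℝ), x₀ ∈ V ∧ IsBasicFrame πP D V y := by
  let φ := extChartAt (𝓡 m) (p x₀)
  have hext : ∀ i : Fin m, ∃ f : Q → ℝ, ContMDiff (𝓡 m) 𝓘(ℝ, ℝ) ∞ f ∧
      f =ᶠ[𝓝 (p x₀)] chartCoord (p x₀) i := fun i =>
    exists_global_function (chartAt (EuclideanSpace ℝ (Fin m)) (p x₀)).open_source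
      (mem_chart_source _ _) (contMDiffOn_chartCoord (p x₀) i)
  choose f hf hf' using hext
  obtain ⟨O, hO, hOo, hpO⟩ := eventually_nhds_iff.1 ((eventually_all.2 hf').and
    ((chartAt (EuclideanSpace ℝ (Fin m)) (p x₀)).open_source.eventually_mem
      (mem_chart_source _ (p x₀))))
  have hfd : ∀ i q, MDifferentiableAt (𝓡 m) 𝓘(ℝ, ℝ) (f i) q := fun i q =>
    (hf i).mdifferentiableAt (by simp)
  have hpd : ∀ x ∈ U, MDifferentiableAt (𝓡 n) (𝓡 m) p x := fun x hx =>
    (hq.smooth.contMDiffAt (hU.mem_nhds hx)).mdifferentiableAt (by simp)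
  let T : ∀ q : Q, EuclideanSpace ℝ (Fin m) →L[ℝ] EuclideanSpace ℝ (Fin m) :=
    fun q => mfderiv (𝓡 m) (𝓡 m) φ q
  have hT : ∀ q ∈ O, Function.Bijective (T q) := by
    intro q hqO
    obtain ⟨T', hT'⟩ := isInvertible_mfderiv_extChartAt (I := 𝓡 m) (x := p x₀) (y := q)
      (by simpa using (hO q hqO).2)
    have h1 : T q = mfderiv (𝓡 m) (𝓡 m) φ q := rfl
    have h2 : ⇑(T q) = T' := congrArg DFunLike.coe hT'.symm
    rw [h2]
    exact T'.bijective
  have key : ∀ x ∈ U, p x ∈ O → ∀ i (v : Tan n x),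
      (diff (f i ∘ p) x : Cotan n x) v = T (p x) (dmap n m p x v) i := by
    intro x hx hxO i v
    have h1 : f i =ᶠ[𝓝 (p x)] chartCoord (p x₀) i := by
      filter_upwards [hOo.mem_nhds hxO] with q hq
      exact (hO q hq).1 i
    rw [diff_comp rfl (hfd i _) (hpd x hx), diff_congr h1]
    exact mvfderiv_chartCoord (hO _ hxO).2 i _
  refine ⟨U ∩ p ⁻¹' O, m, fun i => f i ∘ p, ⟨hx₀, hpO⟩,
    hq.smooth.continuousOn.isOpen_inter_preimage hU hOo,
    fun i => (hf i).comp_contMDiffOn (hq.smooth.mono inter_subset_left), ?_, ?_, ?_⟩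
  · rintro x ⟨hx, hxO⟩
    rw [Fintype.linearIndependent_iff]
    intro c hc i
    obtain ⟨w, hw⟩ := (hT _ hxO).2 (EuclideanSpace.single i 1)
    obtain ⟨v, hv⟩ := hq.submersion x hx w
    have hv' : dmap n m p x v = w := hv
    have h1 := DFunLike.congr_fun hc v
    simp only [sum_apply, smul_apply, key x hx hxO, hv', hw] at h1
    simpa [Pi.single_apply] using h1
  · rintro x ⟨hx, hxO⟩ v
    rw [← hq.ker_eq x hx]
    simp only [key x hx hxO]
    constructor
    · intro h i
      have : dmap n m p x v = 0 := h
      simp [this]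
    · intro h
      have h1 : T (p x) (dmap n m p x v) = T (p x) 0 := by
        ext i
        simpa using h i
      exact (hT _ hxO).1 h1
  · rintro i j x ⟨hx, -⟩ v hv
    have h1 : πP.bracket (f i ∘ p) (f j ∘ p) =ᶠ[𝓝 x] πQ.bracket (f i) (f j) ∘ p :=
      eventuallyEq_of_mem (hU.mem_nhds hx) (hp.2 _ _ (hf i) (hf j))
    rw [diff_congr h1]
    exact hq.diff_comp_mem hU hx
      ((πQ.bracket_smoothAt (hf i _) (hf j _)).mdifferentiableAt (by simp)) v hv

theorem isDirac_of_descendsLocally (hD : IsTanSubbundle D) (h : DescendsLocally πP D) :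
    IsDirac πP (nullBundle D) := by
  refine isDirac_of_isBasicFrame hD fun x₀ => ?_
  obtain ⟨U, hU, hx₀, m, Q, _, _, _, _, p, hq, πQ, hp⟩ := h x₀
  exact exists_isBasicFrame hU hq hp hx₀

theorem isDirac_of_isPoissonMapOn [T2Space Q] (hD : IsTanSubbundle D) {p : P → Q}
    (hq : IsQuotientManifold (m := m) D univ p) {πQ : PoissonStructure m Q}
    (hp : IsPoissonMapOn πP πQ univ p) : IsDirac πP (nullBundle D) :=
  isDirac_of_isBasicFrame hD fun x₀ => exists_isBasicFrame isOpen_univ hq hp (mem_univ x₀)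

end

end DiracReduction

open DiracReduction
theorem corollary7p2 {n : ℕ} {P : Type*} [TopologicalSpace P]
    [ChartedSpace (EuclideanSpace ℝ (Fin n)) P] [IsManifold (𝓡 n) ∞ P] [T2Space P]
    (πP : PoissonStructure n P) (D : ∀ x : P, Submodule ℝ (TangentSpace (𝓡 n) x))
    (hD : IsTanSubbundle D) :
    (IsDirac πP (nullBundle D) ↔ IsIntegrableDistribution D ∧ DescendsLocally πP D) ∧
    ∀ (m : ℕ) (Q : Type*) [TopologicalSpace Q] [ChartedSpace (EuclideanSpace ℝ (Fin m)) Q]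
      [IsManifold (𝓡 m) ∞ Q] [T2Space Q] (p : P → Q), IsQuotientManifold (m := m) D univ p →
      (IsDirac πP (nullBundle D) ↔
        IsIntegrableDistribution D ∧ ∃ πQ : PoissonStructure m Q, IsPoissonMapOn πP πQ univ p) := by
  refine ⟨⟨fun h => ⟨h.isIntegrableDistribution hD, h.descendsLocally hD⟩,
    fun h => isDirac_of_descendsLocally hD h.2⟩, ?_⟩
  intro m Q _ _ _ _ p hq
  exact ⟨fun h => ⟨h.isIntegrableDistribution hD,
      h.exists_poissonStructure_quotient hD isOpen_univ hq⟩,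
    fun ⟨_, _, hp⟩ => isDirac_of_isPoissonMapOn hD hq hp⟩
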